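/- **Setting.** Let $\mathcal G\rightrightarrows M$ be a Lie groupoid ($M$, $\mathcal G$ finite-dimensional Hausdorff smooth manifolds without boundary) with source $s$, target $t$, units $1_x$, the product $gh$ being defined if $s(g)=t(h)$. Let $C\to M$ be a representation of $\mathcal G$, with action maps $\Delta_g:C_{s(g)}\to C_{t(g)}$. Let $B_p\mathcal G$ be the manifold of composable $p$-tuples $(g_1,\dots,g_p)$, $s(g_i)=t(g_{i+1})$ ($B_0\mathcal G=M$), with degeneracies $s_i:B_{p-1}\mathcal G\to B_p\mathcal G$, $s_i(g_1,\dots,g_{p-1})=(g_1,\dots,g_i,1,g_{i+1},\dots,g_{p-1})$, $0\le i\le p-1$; write $t(g_1,\dots,g_p)=t(g_1)$. A form or function on $B_p$ is *normalized* if all its pull-backs by the $s_i$ vanish. Let $\mathfrak g$ be the Lie algebroid of $\mathcal G$, $\mathfrak g_x=\ker(T_{1_x}s)$; for $u\in\Gamma(\mathfrak g)$ let $\vec u$ be the right-invariant vector field of $u$ with flow $\phi^u_\epsilon$, let $B_pu=(\vec u,0,\dots,0)$ be the induced vector field on $B_p\mathcal G$ and $\psi^u_\epsilon(g_1,\dots,g_p)=(\phi^u_\epsilon(g_1),g_2,\dots,g_p)$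 its flow. **The explicit map $VE_\Omega$.** For $\omega\in\Omega^q(B_p\mathcal G,t^*C)$ put $J_u\omega=s_0^*\,i_{B_pu}\omega\in\Omega^{q-1}(B_{p-1}\mathcal G,t^*C)$ and $$R_u\omega=s_0^*\Big(\tfrac{d}{d\epsilon}\Big|_{\epsilon=0}\Delta_{\phi^u_\epsilon(1_{t(g_1)})^{-1}}\circ(\psi^u_\epsilon)^*\omega\Big)\in\Omega^{q}(B_{p-1}\mathcal G,t^*C),$$ where after applying $s_0^*$ the point $t(g_1)$ refers to $(g_1,\dots,g_{p-1})\in B_{p-1}\mathcal G$ (to the point itself if $p=1$). Let $VE_\Omega(\omega)=(c_0(\omega),c_1(\omega),\dots)$ with $c_k(\omega)(u_1,\dots,u_{p-k}|v_1,\dots,v_k)\in\Omega^{q-k}(M,C)$, $0\le k\le\min(p,q)$, $u_i,v_j\in\Gamma(\mathfrak g)$, given by $$c_k(\omega)(u_1,\dots,u_{p-k}|v_1,\dots,v_k)=(-1)^{\frac{k(k-1)}2}\sum_{\sigma\in S_p}\operatorname{sgn}(\sigma)(-1)^{\epsilon(\sigma,k)}D_{\sigma(1)}\cdots D_{\sigma(p)}\omega,$$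 where $D_j=J_{v_j}$ for $j\le k$, $D_j=R_{u_{j-k}}$ for $j>k$, and $\epsilon(\sigma,k)$ is the number of pairs $1\le i<j\le k$ with $\sigma^{-1}(i)>\sigma^{-1}(j)$. Let $W^{p,q}(\mathfrak g,C)$ be the space of sequences $c=(c_0,c_1,\dots)$ of $\mathbb R$-multilinear skew-symmetric maps $c_k:\Gamma(\mathfrak g)^{p-k}\to\Omega^{q-k}(M,S^k\mathfrak g^*\otimes C)$ (forms of negative degree are zero) such that, for $f\in C^\infty(M)$, $$c_k(fu_1,u_2,\dots|\cdot)=f\,c_k(u_1,u_2,\dots|\cdot)+df\wedge c_{k+1}(u_2,\dots|u_1,\cdot).$$ **Forms as functions.** Let $\mathbb G_q\rightrightarrows\mathbb M_q$ be the Lie groupoid with $\mathbb G_q=T\mathcal G\times_{\mathcal G}\cdots\times_{\mathcal G}T\mathcal G\times_{\mathcal G}t^*C^*$ ($q$ copies of $T\mathcal G$) and $\mathbb M_q=TM\times_M\cdots\times_MTM\times_MC^*$ ($q$ copies of $TM$), with componentwise structure: that of the tangent groupoid $T\mathcal G\rightrightarrows TM$ on the tangent vectors and that of the action groupoid $t^*C^*\rightrightarrows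 C^*$, $s(g,\xi)=\Delta_g^*\xi$, $t(g,\xi)=\xi$, $1_\xi=(1,\xi)$, on the covectors. Let $\mathbb A_q\to\mathbb M_q$ be its Lie algebroid; it is also a vector bundle over $\mathfrak g$. Identify $B_p\mathbb G_q$ with $TB_p\mathcal G\times_{B_p\mathcal G}\cdots\times_{B_p\mathcal G}TB_p\mathcal G\times_{B_p\mathcal G}t^*C^*$, and put $\mathfrak F_\omega(U_1,\dots,U_q,\xi)=\langle\xi,\omega(U_1,\dots,U_q)\rangle$. Let $C^\infty_{ext}(B_p\mathbb G_q)$ be the space of smooth functions on $B_p\mathbb G_q$ that are skew-symmetric in the $q$ tangent vectors, vanish whenever one of the $q+1$ entries is zero, and are $(q+1)$-homogeneous under simultaneous scaling of all entries. Let $\Gamma_{ext}(\mathbb M_q,\Lambda^p\mathbb A_q^*)$ be the space of $p$-forms $\alpha$ on $\mathbb A_q$ with the analogous properties: $\sigma^*\alpha=\operatorname{sgn}(\sigma)\alpha$ for $\sigma\in S_q$ permuting the tangent components, $h_\lambda^*\alpha=\lambda^{q+1}\alpha$ for the scalings $h_\lambda$, $\lambda\ge0$, of $\mathbb A_q\to\mathfrak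 g$, and $0_i^*\alpha=0$ for the $q+1$ inclusions $0_i$ that put zero in the $i$-th component. **The Van Est map of $\mathbb G_q$.** For a section $\chi$ of $\mathbb A_q$ put $R_\chi=s_0^*\circ\mathcal L_{B_p\chi}$ on functions on $B_p\mathbb G_q$, and $$\mathrm{VE}(f)(\chi_1,\dots,\chi_p)=\sum_{\sigma\in S_p}\operatorname{sgn}(\sigma)R_{\chi_{\sigma(1)}}\cdots R_{\chi_{\sigma(p)}}f.$$ $\mathrm{VE}_{ext}$ is its restriction to $C^\infty_{ext}(B_p\mathbb G_q)$. **The evaluation map.** For $u\in\Gamma(\mathfrak g)$ let $\mathcal Tu$ and $\mathcal Z_iu$ ($1\le i\le q$) be the sections of $\mathbb A_q$ whose values at $(x_1,\dots,x_q,\xi)\in\mathbb M_q$, over $m\in M$, are the velocities at $\epsilon=0$ of $$\big(T\Phi_\epsilon(x_1),\dots,T\Phi_\epsilon(x_q),(\Phi_\epsilon(m),\Delta^*_{\Phi_\epsilon(m)^{-1}}\xi)\big),\quad\Phi_\epsilon(x)=\phi^u_\epsilon(1_x),$$ and of $$\big(T1(x_1),\dots,T1(x_i)+\epsilon u(m),\dots,T1(x_q),(1_m,\xi)\big).$$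 For a $p$-form $\alpha$ on $\mathbb A_q$, $ev(\alpha)=(c_0(\alpha),c_1(\alpha),\dots)$ is the sequence with $c_k(\alpha)(u_1,\dots,u_{p-k}|v_1,\dots,v_k)\in\Omega^{q-k}(M,C)$ determined by $$\alpha(\mathcal Z_1v_1,\dots,\mathcal Z_kv_k,\mathcal Tu_1,\dots,\mathcal Tu_{p-k})=\mathfrak F_{c_k(\alpha)(u_1,\dots,u_{p-k}|v_1,\dots,v_k)}\circ\mathrm{pr}_{[1,k]},\qquad 0\le k\le\min(p,q),$$ where $\mathrm{pr}_{[1,k]}:\mathbb M_q\to\mathbb M_{q-k}$ forgets the first $k$ tangent vectors. **Lemma.** For all $p,q\ge0$ the square formed by $\mathfrak F$, $\mathrm{VE}_{ext}$, $ev$ and $VE_\Omega$ commutes: for every $\omega\in\Omega^q(B_p\mathcal G,t^*C)$ one has $\mathfrak F_\omega\in C^\infty_{ext}(B_p\mathbb G_q)$, the sequence $ev(\mathrm{VE}_{ext}(\mathfrak F_\omega))$ exists, and $$ev(\mathrm{VE}_{ext}(\mathfrak F_\omega))=VE_\Omega(\omega).$$ If moreover $\omega$ is normalized, then $\mathfrak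 F_\omega$ is normalized, $\mathrm{VE}_{ext}(\mathfrak F_\omega)\in\Gamma_{ext}(\mathbb M_q,\Lambda^p\mathbb A_q^*)$ and $VE_\Omega(\omega)\in W^{p,q}(\mathfrak g,C)$. -/

import Mathlib

open scoped Manifold ContDiff Topology
open Bundle Diffeology

noncomputable section

namespace VanEst

/-! ### Smooth functions on the derived spaces

`M`, `G` and the total spaces of their tangent bundles and of `C`, `C*` are manifolds in Mathlib's
sense.  The nerves, the source fibres and the fibre products built from them are submanifolds of
products of such manifolds.  They carry the subspace diffeology: a family parametrized by `ℝⁿ` is a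
plot iff its components are smooth maps into the manifolds.  A function on an embedded submanifold
is smooth iff it is smooth along all plots, so nothing is lost. -/

/-- The diffeology of a manifold: plots are the smooth maps from `ℝⁿ`. -/
@[reducible] def manifoldDiffeology {E H : Type*} [NormedAddCommGroup E] [NormedSpace ℝ E]
    [TopologicalSpace H] (I : ModelWithCorners ℝ E H) (N : Type*) [TopologicalSpace N]
    [ChartedSpace H N] : DiffeologicalSpace N where
  plots n := {p | ContMDiff (𝓡 n) I ∞ p}
  constant_plots _ := contMDiff_const
  plot_reparam hp hf := ContMDiff.comp hp hf.contMDiff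
  locality := by
    intro n p hp y
    obtain ⟨u, hu, hyu, h⟩ := hp y
    obtain ⟨e, he⟩ : ∃ e : OpenPartialHomeomorph (EuclideanSpace ℝ (Fin n))
        (EuclideanSpace ℝ (Fin n)), (∀ z, e z ∈ u) ∧ ContDiff ℝ ∞ e ∧ y ∈ e.target ∧
        ContDiffOn ℝ ∞ e.symm e.target := by
      obtain ⟨r, hr, hru⟩ := Metric.isOpen_iff.1 hu y hyu
      refine ⟨OpenPartialHomeomorph.univBall y r, fun z => hru ?_,
        OpenPartialHomeomorph.contDiff_univBall, ?_, ?_⟩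
      · have := (OpenPartialHomeomorph.univBall y r).map_source (x := z) (by simp)
        rwa [OpenPartialHomeomorph.univBall_target y hr] at this
      · rw [OpenPartialHomeomorph.univBall_target y hr]; exact Metric.mem_ball_self hr
      · rw [OpenPartialHomeomorph.univBall_target y hr]
        exact OpenPartialHomeomorph.contDiffOn_univBall_symm
    have h1 : ContMDiff (𝓡 n) I ∞ (p ∘ e) := h he.1 he.2.1
    have h2 : ContMDiffAt (𝓡 n) (𝓡 n) ∞ e.symm y :=
      (he.2.2.2.contMDiffOn y he.2.2.1).contMDiffAt (e.open_target.mem_nhds he.2.2.1)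
    have h3 : ContMDiffAt (𝓡 n) I ∞ ((p ∘ e) ∘ e.symm) y := (h1 _).comp y h2
    refine h3.congr_of_eventuallyEq ?_
    filter_upwards [e.open_target.mem_nhds he.2.2.1] with z hz
    simp [e.right_inv hz]

/-- The diffeology pulled back along a map: a family is a plot iff its image is. -/
@[reducible] def pullDiffeology {X Y : Type*} (f : X → Y) (d : DiffeologicalSpace Y) :
    DiffeologicalSpace X where
  plots n := {p | @IsPlot Y d n (f ∘ p)}
  constant_plots x := DiffeologicalSpace.constant_plots (f x)
  plot_reparam {n m p g} hp hf := DiffeologicalSpace.plot_reparam (p := f ∘ p) (f := g) hp hf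
  locality := by
    intro n p hp
    refine DiffeologicalSpace.locality (p := f ∘ p) fun x => ?_
    obtain ⟨u, hu, hxu, h⟩ := hp x
    exact ⟨u, hu, hxu, fun hf hs => h hf hs⟩

/-- Smooth real functions on a diffeological space. -/
def smoothFun (X : Type*) [DiffeologicalSpace X] : Subalgebra ℝ (X → ℝ) where
  carrier := {f | ∀ (n : ℕ) (p : EuclideanSpace ℝ (Fin n) → X), IsPlot p → ContDiff ℝ ∞ (f ∘ p)}
  mul_mem' hf hg n p hp := (hf n p hp).mul (hg n p hp)
  add_mem' hf hg n p hp := (hf n p hp).add (hg n p hp)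
  algebraMap_mem' r _ _ _ := contDiff_const (c := r)

/-! ### Groupoids, nerves -/

/-- Source, target and unit of a groupoid; this is all of the structure that enters the definition
of the spaces `B_p`, of the degeneracies and of the operators of the Van Est map. -/
structure UnitalGraph (Ob Ar : Type*) where
  src : Ar → Ob
  tgt : Ar → Ob
  unit : Ob → Ar
  src_unit : ∀ x, src (unit x) = x
  tgt_unit : ∀ x, tgt (unit x) = x

section Graph

variable {Ob Ar : Type*}

/-- A point of `B_p`: composable arrows `g₁, …, g_p` together with their end points
`x₀ = t(g₁)`, `x_i = s(g_i) = t(g_{i+1})`, so that `B₀` is the space of objects. -/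
structure Simplex (S : UnitalGraph Ob Ar) (p : ℕ) where
  vert : Fin (p + 1) → Ob
  arr : Fin p → Ar
  tgt_arr : ∀ i, S.tgt (arr i) = vert i.castSucc
  src_arr : ∀ i, S.src (arr i) = vert i.succ

variable {S : UnitalGraph Ob Ar}

/-- An object, as a point of `B₀`. -/
def Simplex.pt (S : UnitalGraph Ob Ar) (x : Ob) : Simplex S 0 where
  vert _ := x
  arr := Fin.elim0
  tgt_arr i := i.elim0
  src_arr i := i.elim0

/-- The source fibre `s⁻¹(x)`. -/
abbrev SrcFibre (S : UnitalGraph Ob Ar) (x : Ob) := {h : Ar // S.src h = x}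

/-- The unit, as a point of the source fibre. -/
def SrcFibre.one (S : UnitalGraph Ob Ar) (x : Ob) : SrcFibre S x := ⟨S.unit x, S.src_unit x⟩

/-- `(g₁, …, g_p) ↦ (h, g₁, …, g_p)` for `s(h) = t(g₁)` and `t(h) = x`. -/
def Simplex.cons {p : ℕ} (b : Simplex S p) (h : SrcFibre S (b.vert 0)) {x : Ob}
    (hx : S.tgt h.1 = x) : Simplex S (p + 1) where
  vert := Fin.cons x b.vert
  arr := Fin.cons h.1 b.arr
  tgt_arr i := by
    refine Fin.cases ?_ (fun j => ?_) i
    · simpa using hx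
    · simpa [← Fin.succ_castSucc] using b.tgt_arr j
  src_arr i := by
    refine Fin.cases ?_ (fun j => ?_) i
    · simpa using h.2
    · simpa using b.src_arr j

/-- The degeneracy `s₀(g₁, …, g_p) = (1_{t(g₁)}, g₁, …, g_p)`. -/
def Simplex.deg {p : ℕ} (b : Simplex S p) : Simplex S (p + 1) :=
  b.cons (SrcFibre.one S (b.vert 0)) (S.tgt_unit _)

/-- Some arrow of the simplex is a unit, i.e. it lies in the image of a degeneracy map. -/
def Simplex.IsDegenerate {p : ℕ} (b : Simplex S p) : Prop :=
  ∃ i : Fin p, b.arr i = S.unit (b.vert i.succ)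

/-! ### The Van Est map of a groupoid with a smooth structure -/

variable [dOb : DiffeologicalSpace Ob] [dAr : DiffeologicalSpace Ar]

instance (S : UnitalGraph Ob Ar) (x : Ob) : DiffeologicalSpace (SrcFibre S x) :=
  pullDiffeology Subtype.val dAr

instance Simplex.diffeology (S : UnitalGraph Ob Ar) (p : ℕ) : DiffeologicalSpace (Simplex S p) :=
  (⨅ i, pullDiffeology (fun b => b.vert i) dOb) ⊓ (⨅ i, pullDiffeology (fun b => b.arr i) dAr)

lemma Simplex.isPlot_iff {p n : ℕ} {b : EuclideanSpace ℝ (Fin n) → Simplex S p} :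
    IsPlot b ↔ (∀ i, IsPlot fun y => (b y).vert i) ∧ ∀ i, IsPlot fun y => (b y).arr i := by
  refine DiffeologicalSpace.isPlot_inf_iff.trans (and_congr ?_ ?_)
  · exact DiffeologicalSpace.isPlot_iInf_iff
  · exact DiffeologicalSpace.isPlot_iInf_iff

lemma Simplex.isPlot_cons (ht : DSmooth S.tgt) {p n : ℕ}
    {b : EuclideanSpace ℝ (Fin n) → Simplex S p} (hb : IsPlot b)
    {h : ∀ y, SrcFibre S ((b y).vert 0)} (hh : IsPlot fun y => (h y).1) :
    IsPlot fun y => (b y).cons (h y) rfl := by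
  rw [Simplex.isPlot_iff] at hb ⊢
  refine ⟨fun i => ?_, fun i => ?_⟩
  · refine Fin.cases ?_ (fun j => ?_) i
    · exact ht n _ hh
    · exact hb.1 j
  · refine Fin.cases ?_ (fun j => ?_) i
    · exact hh
    · exact hb.2 j

/-- The fibre at `x` of the Lie algebroid: the tangent space at `1_x` of the source fibre, made of
the velocities at `0` of smooth curves, acting as derivations on functions of the fibre. -/
def algFibre (S : UnitalGraph Ob Ar) (x : Ob) :
    Submodule ℝ (smoothFun (SrcFibre S x) →ₗ[ℝ] ℝ) :=
  Submodule.span ℝ {D | ∃ c : ℝ → SrcFibre S x, DSmooth c ∧ c 0 = SrcFibre.one S x ∧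
    ∀ F : smoothFun (SrcFibre S x), D F = deriv (fun ε => F.1 (c ε)) 0}

/-- The pull-back of `s` along a family of objects: all `(y, h)` with `s(h) = x(y)`. -/
abbrev SrcFamily (S : UnitalGraph Ob Ar) {n : ℕ} (x : EuclideanSpace ℝ (Fin n) → Ob) :=
  {z : EuclideanSpace ℝ (Fin n) × Ar // S.src z.2 = x z.1}

instance (S : UnitalGraph Ob Ar) {n : ℕ} (x : EuclideanSpace ℝ (Fin n) → Ob) :
    DiffeologicalSpace (SrcFamily S x) :=
  pullDiffeology (fun z => z.1.1) inferInstance ⊓ pullDiffeology (fun z => z.1.2) dAr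

lemma srcFamily_isPlot_iff {n : ℕ} {x : EuclideanSpace ℝ (Fin n) → Ob} {m : ℕ}
    {z : EuclideanSpace ℝ (Fin m) → SrcFamily S x} :
    IsPlot z ↔ (IsPlot fun w => (z w).1.1) ∧ IsPlot fun w => (z w).1.2 :=
  DiffeologicalSpace.isPlot_inf_iff

/-- Restriction of a function of `(y, h)` to the source fibre at `x(y)`. -/
def SrcFamily.restrict {n : ℕ} {x : EuclideanSpace ℝ (Fin n) → Ob}
    (F : smoothFun (SrcFamily S x)) (y : EuclideanSpace ℝ (Fin n)) :
    smoothFun (SrcFibre S (x y)) :=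
  ⟨fun h => F.1 ⟨(y, h.1), h.2⟩, fun m p hp => F.2 m (fun w => ⟨(y, (p w).1), (p w).2⟩)
    (srcFamily_isPlot_iff.2 ⟨isPlot_const, hp⟩)⟩

/-- Smooth sections of the Lie algebroid, as a module over the smooth functions of the base:
`x ↦ χ_x` is smooth if it takes smooth families of functions on the source fibres to smooth
functions of the parameter. -/
def Sec (S : UnitalGraph Ob Ar) : Submodule (smoothFun Ob) (∀ x, algFibre S x) where
  carrier := {χ | ∀ (n : ℕ) (x : EuclideanSpace ℝ (Fin n) → Ob), IsPlot x →
    ∀ F : smoothFun (SrcFamily S x),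
      ContDiff ℝ ∞ fun y => (χ (x y)).1 (SrcFamily.restrict F y)}
  add_mem' ha hb n x hx F := (ha n x hx F).add (hb n x hx F)
  zero_mem' _ _ _ _ := contDiff_const
  smul_mem' a _ hb n x hx F := (a.2 n x hx).mul (hb n x hx F)

/-- A unital graph in smooth spaces (only the smoothness used below is recorded). -/
structure SmoothGraph (Ob Ar : Type*) [DiffeologicalSpace Ob] [DiffeologicalSpace Ar]
    extends UnitalGraph Ob Ar where
  tgt_smooth : DSmooth tgt
  unit_smooth : DSmooth unit

variable (K : SmoothGraph Ob Ar)

/-- The function `h ↦ f(h, g₁, …, g_p)` on the source fibre at `t(g₁)`. -/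
def restrictFirst {p : ℕ} (f : smoothFun (Simplex K.toUnitalGraph (p + 1)))
    (b : Simplex K.toUnitalGraph p) : smoothFun (SrcFibre K.toUnitalGraph (b.vert 0)) :=
  ⟨fun h => f.1 (b.cons h rfl), fun n _ hh => f.2 n _
    (Simplex.isPlot_cons K.tgt_smooth (b := fun _ => b) isPlot_const hh)⟩

/-- The operator `R_χ = s₀^* ∘ L_{B_p χ}`: at `(g₁, …, g_p)` it is the derivative of
`f(·, g₁, …, g_p)` at the unit `1_{t(g₁)}` in the direction of the right-invariant vector field of
`χ`, whose value at that unit is `χ_{t(g₁)}`. -/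
def R {p : ℕ} (χ : Sec K.toUnitalGraph) (f : smoothFun (Simplex K.toUnitalGraph (p + 1))) :
    smoothFun (Simplex K.toUnitalGraph p) :=
  ⟨fun b => (χ.1 (b.vert 0)).1 (restrictFirst K f b), fun n b hb => by
    have hx : IsPlot fun y => (b y).vert 0 := (Simplex.isPlot_iff.1 hb).1 0
    let Φ : smoothFun (SrcFamily K.toUnitalGraph fun y => (b y).vert 0) :=
      ⟨fun z => f.1 ((b z.1.1).cons ⟨z.1.2, z.2⟩ rfl), fun m z hz => by
        rw [srcFamily_isPlot_iff] at hz
        have hb' : IsPlot fun w => b (z w).1.1 :=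
          DiffeologicalSpace.plot_reparam hb (isPlot_iff_contDiff.1 hz.1)
        exact f.2 m _ (Simplex.isPlot_cons K.tgt_smooth hb'
          (h := fun w => ⟨(z w).1.2, (z w).2⟩) hz.2)⟩
    exact χ.2 n _ hx Φ⟩

/-- `R_{χ₁} ⋯ R_{χ_p} f`. -/
def iterR : ∀ {p : ℕ}, (Fin p → Sec K.toUnitalGraph) → smoothFun (Simplex K.toUnitalGraph p) →
    smoothFun (Simplex K.toUnitalGraph 0)
  | 0, _, f => f
  | p + 1, χ, f => iterR (fun i => χ i.castSucc) (R K (χ (Fin.last p)) f)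

/-- A function on `B₀`, as a function on the space of objects. -/
def onObjects (f : smoothFun (Simplex K.toUnitalGraph 0)) : smoothFun Ob :=
  ⟨fun x => f.1 (Simplex.pt _ x), fun n x hx => f.2 n _
    (Simplex.isPlot_iff.2 ⟨fun _ => hx, fun i => i.elim0⟩)⟩

/-- The Van Est map `VE(f)(χ₁, …, χ_p) = ∑_σ sgn(σ) R_{χ_{σ(1)}} ⋯ R_{χ_{σ(p)}} f`. -/
def VE {p : ℕ} (f : smoothFun (Simplex K.toUnitalGraph p))
    (χ : Fin p → Sec K.toUnitalGraph) : smoothFun Ob :=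
  ∑ σ : Equiv.Perm (Fin p), (Equiv.Perm.sign σ : ℤ) • onObjects K (iterR K (fun i => χ (σ i)) f)

/-- Normalized cochains: `s_i^* f = 0` for all degeneracies. -/
def IsNormalized {p : ℕ} (f : smoothFun (Simplex S p)) : Prop :=
  ∀ b : Simplex S p, b.IsDegenerate → f.1 b = 0

/-- Sections of `Λ^p A^*`, as alternating forms on the module of sections of `A`. -/
def IsCEForm {p : ℕ} (α : (Fin p → Sec S) → smoothFun Ob) : Prop :=
  ∃ A : (Sec S) [⋀^Fin p]→ₗ[smoothFun Ob] (smoothFun Ob), ⇑A = α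

variable {K}

/-- A smooth endomorphism. -/
structure Endo (K : SmoothGraph Ob Ar) where
  obj : Ob → Ob
  arr : Ar → Ar
  src_arr : ∀ h, K.src (arr h) = obj (K.src h)
  tgt_arr : ∀ h, K.tgt (arr h) = obj (K.tgt h)
  arr_unit : ∀ x, arr (K.unit x) = K.unit (obj x)
  obj_smooth : DSmooth obj
  arr_smooth : DSmooth arr

/-- The induced map `B_p φ`. -/
def Endo.simplex (φ : Endo K) {p : ℕ} (b : Simplex K.toUnitalGraph p) :
    Simplex K.toUnitalGraph p where
  vert i := φ.obj (b.vert i)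
  arr i := φ.arr (b.arr i)
  tgt_arr i := by rw [φ.tgt_arr, b.tgt_arr]
  src_arr i := by rw [φ.src_arr, b.src_arr]

/-- Pull-back of functions along `φ : s⁻¹(x) → s⁻¹(φ x)`. -/
def Endo.pullFibre (φ : Endo K) (x : Ob) (F : smoothFun (SrcFibre K.toUnitalGraph (φ.obj x))) :
    smoothFun (SrcFibre K.toUnitalGraph x) :=
  ⟨fun h => F.1 ⟨φ.arr h.1, by rw [φ.src_arr, h.2]⟩,
    fun n p hp => F.2 n (fun y => ⟨φ.arr (p y).1, by rw [φ.src_arr, (p y).2]⟩)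
      (φ.arr_smooth n _ hp)⟩

/-- `χ'` is `Lie(φ)`-related to `χ`: `χ'_{φ(x)} = Lie(φ)(χ_x)` for all `x`. -/
def Endo.Related (φ : Endo K) (χ χ' : Sec K.toUnitalGraph) : Prop :=
  ∀ (x : Ob) (F : smoothFun (SrcFibre K.toUnitalGraph (φ.obj x))),
    (χ'.1 (φ.obj x)).1 F = (χ.1 x).1 (φ.pullFibre x F)

/-- `Lie(φ)^* α = r α`.  The pull-back is determined by its values on tuples of sections `χ` that
are `Lie(φ)`-related to some sections `χ'`, where it is `α(χ') ∘ φ`. -/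
def Endo.PullEq (φ : Endo K) {p : ℕ} (r : ℝ)
    (α : (Fin p → Sec K.toUnitalGraph) → smoothFun Ob) : Prop :=
  ∀ χ χ' : Fin p → Sec K.toUnitalGraph, (∀ i, φ.Related (χ i) (χ' i)) →
    ∀ x, (α χ').1 (φ.obj x) = r * (α χ).1 x

open Classical in
/-- The section of the Lie algebroid whose value at each `x` is the velocity at `0` of the given
curve `c_x` in the source fibre. -/
def velocitySec (c : ∀ x, ℝ → SrcFibre S x) : Sec S :=
  if h : ∃ χ : Sec S, ∀ x (F : smoothFun (SrcFibre S x)),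
      (χ.1 x).1 F = deriv (fun ε => F.1 (c x ε)) 0
  then h.choose else 0

end Graph

/-! ### Lie groupoids and representations -/

section Lie

variable {EM M EG G F : Type*}
  [NormedAddCommGroup EM] [NormedSpace ℝ EM] [FiniteDimensional ℝ EM]
  [TopologicalSpace M] [ChartedSpace EM M] [IsManifold 𝓘(ℝ, EM) ∞ M] [T2Space M]
  [NormedAddCommGroup EG] [NormedSpace ℝ EG] [FiniteDimensional ℝ EG]
  [TopologicalSpace G] [ChartedSpace EG G] [IsManifold 𝓘(ℝ, EG) ∞ G] [T2Space G]
  [NormedAddCommGroup F] [NormedSpace ℝ F] [FiniteDimensional ℝ F]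
  {C : M → Type*} [TopologicalSpace (TotalSpace F C)]
  [∀ x, AddCommGroup (C x)] [∀ x, Module ℝ (C x)] [∀ x, TopologicalSpace (C x)]
  [FiberBundle F C] [VectorBundle ℝ F C] [ContMDiffVectorBundle ∞ F C 𝓘(ℝ, EM)]

variable (EM M EG G) in
/-- A Lie groupoid `G ⇉ M`.  The product `mul g h` is meaningful if `s(g) = t(h)`. -/
structure LieGroupoid extends UnitalGraph M G where
  inv : G → G
  mul : G → G → G
  src_mul : ∀ g h, src g = tgt h → src (mul g h) = src h
  tgt_mul : ∀ g h, src g = tgt h → tgt (mul g h) = tgt g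
  mul_assoc : ∀ g h k, src g = tgt h → src h = tgt k → mul (mul g h) k = mul g (mul h k)
  unit_mul : ∀ g, mul (unit (tgt g)) g = g
  mul_unit : ∀ g, mul g (unit (src g)) = g
  src_inv : ∀ g, src (inv g) = tgt g
  tgt_inv : ∀ g, tgt (inv g) = src g
  inv_mul : ∀ g, mul (inv g) g = unit (src g)
  mul_inv : ∀ g, mul g (inv g) = unit (tgt g)
  src_submersion : Manifold.IsSubmersion 𝓘(ℝ, EG) 𝓘(ℝ, EM) ∞ src
  tgt_submersion : Manifold.IsSubmersion 𝓘(ℝ, EG) 𝓘(ℝ, EM) ∞ tgt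
  unit_smooth : ContMDiff 𝓘(ℝ, EM) 𝓘(ℝ, EG) ∞ unit
  inv_smooth : ContMDiff 𝓘(ℝ, EG) 𝓘(ℝ, EG) ∞ inv
  mul_smooth : ContMDiffOn (𝓘(ℝ, EG).prod 𝓘(ℝ, EG)) 𝓘(ℝ, EG) ∞
    (fun z : G × G => mul z.1 z.2) {z | src z.1 = tgt z.2}

variable (𝒢 : LieGroupoid EM M EG G)

variable (F C) in
/-- A representation of `𝒢` on the vector bundle `C`: `act g` is `Δ_g : C_{s(g)} → C_{t(g)}`, where
the end points `x = s(g)` and `y = t(g)` are named.  It is smooth: `(g, c) ↦ Δ_g c` takes smooth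
families in `s^*C` to smooth families in `C`. -/
structure Representation where
  act : ∀ (g : G) {x y : M}, 𝒢.src g = x → 𝒢.tgt g = y → (C x →L[ℝ] C y)
  act_unit : ∀ (x : M) (c : C x), act (𝒢.unit x) (𝒢.src_unit x) (𝒢.tgt_unit x) c = c
  act_mul : ∀ (g h : G) {x y z : M} (hx : 𝒢.src h = x) (hy : 𝒢.tgt h = y) (hy' : 𝒢.src g = y)
    (hz : 𝒢.tgt g = z) (c : C x),
    act (𝒢.mul g h) ((𝒢.src_mul g h (hy'.trans hy.symm)).trans hx)
      ((𝒢.tgt_mul g h (hy'.trans hy.symm)).trans hz) c = act g hy' hz (act h hx hy c)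
  act_smooth : ∀ (n : ℕ) (g : EuclideanSpace ℝ (Fin n) → G) (c : ∀ y, C (𝒢.src (g y))),
    ContMDiff (𝓡 n) 𝓘(ℝ, EG) ∞ g →
    ContMDiff (𝓡 n) (𝓘(ℝ, EM).prod 𝓘(ℝ, F)) ∞ (fun y => (⟨𝒢.src (g y), c y⟩ : TotalSpace F C)) →
    ContMDiff (𝓡 n) (𝓘(ℝ, EM).prod 𝓘(ℝ, F)) ∞
      (fun y => (⟨𝒢.tgt (g y), act (g y) rfl rfl (c y)⟩ : TotalSpace F C))

lemma LieGroupoid.src_smooth : ContMDiff 𝓘(ℝ, EG) 𝓘(ℝ, EM) ∞ 𝒢.src :=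
  𝒢.src_submersion.contMDiff

lemma LieGroupoid.tgt_smooth : ContMDiff 𝓘(ℝ, EG) 𝓘(ℝ, EM) ∞ 𝒢.tgt :=
  𝒢.tgt_submersion.contMDiff

/-! Tangent vectors.  Mathlib's `TangentSpace 𝓘(ℝ, E) x` is the model space `E`, read in the
preferred chart at `x`; below, tangent vectors at a given point are written as elements of `E`. -/

/-- The tangent vector `v` at `x`, as a point of the tangent bundle. -/
def tvec {E N : Type*} [NormedAddCommGroup E] [NormedSpace ℝ E] [TopologicalSpace N]
    [ChartedSpace E N] [IsManifold 𝓘(ℝ, E) ∞ N] (x : N) (v : E) : TangentBundle 𝓘(ℝ, E) N := ⟨x, v⟩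

variable (F) in
/-- A covector of `C` at `x`, as a point of the dual bundle `C^*`. -/
def dvec (x : M) (ξ : C x →L[ℝ] ℝ) :
    TotalSpace (F →L[ℝ] ℝ) (fun x => C x →L[ℝ] Bundle.Trivial M ℝ x) := ⟨x, ξ⟩

/-- `Ts` at `g`. -/
def LieGroupoid.dsrc (g : G) : EG →L[ℝ] EM := mfderiv 𝓘(ℝ, EG) 𝓘(ℝ, EM) 𝒢.src g
/-- `Tt` at `g`. -/
def LieGroupoid.dtgt (g : G) : EG →L[ℝ] EM := mfderiv 𝓘(ℝ, EG) 𝓘(ℝ, EM) 𝒢.tgt g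
/-- `T1` at `x`. -/
def LieGroupoid.dunit (x : M) : EM →L[ℝ] EG := mfderiv 𝓘(ℝ, EM) 𝓘(ℝ, EG) 𝒢.unit x

lemma comp_mfderiv_of_section {r : M → G} {f : G → M} {x : M}
    (hr : ContMDiff 𝓘(ℝ, EM) 𝓘(ℝ, EG) ∞ r) (hf : ContMDiff 𝓘(ℝ, EG) 𝓘(ℝ, EM) ∞ f)
    (h : ∀ x, f (r x) = x) (v : EM) :
    (mfderiv 𝓘(ℝ, EG) 𝓘(ℝ, EM) f (r x) : EG →L[ℝ] EM)
      ((mfderiv 𝓘(ℝ, EM) 𝓘(ℝ, EG) r x : EM →L[ℝ] EG) v) = v := by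
  have h1 := mfderiv_comp x (hf.mdifferentiableAt (x := r x) (by simp))
    (hr.mdifferentiableAt (x := x) (by simp))
  have h2 : f ∘ r = id := funext h
  rw [h2, mfderiv_id] at h1
  exact (congrArg (fun T : EM →L[ℝ] EM => T v) h1).symm

lemma LieGroupoid.dsrc_dunit (x : M) (v : EM) : 𝒢.dsrc (𝒢.unit x) (𝒢.dunit x v) = v :=
  comp_mfderiv_of_section 𝒢.unit_smooth 𝒢.src_smooth 𝒢.src_unit v

lemma LieGroupoid.dtgt_dunit (x : M) (v : EM) : 𝒢.dtgt (𝒢.unit x) (𝒢.dunit x v) = v :=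
  comp_mfderiv_of_section 𝒢.unit_smooth 𝒢.tgt_smooth 𝒢.tgt_unit v

section Fibrewise

/-- Fibrewise multiplication by a smooth function and addition of smooth families in a vector
bundle give smooth families. -/
lemma contMDiff_smul_add {EB B EN N Fb : Type*} [NormedAddCommGroup EB] [NormedSpace ℝ EB]
    [TopologicalSpace B] [ChartedSpace EB B] [NormedAddCommGroup EN] [NormedSpace ℝ EN]
    [TopologicalSpace N] [ChartedSpace EN N] [NormedAddCommGroup Fb] [NormedSpace ℝ Fb]
    {V : B → Type*} [TopologicalSpace (TotalSpace Fb V)] [∀ x, AddCommGroup (V x)]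
    [∀ x, Module ℝ (V x)] [∀ x, TopologicalSpace (V x)] [FiberBundle Fb V] [VectorBundle ℝ Fb V]
    {f : N → B} {v w : ∀ y, V (f y)} {a : N → ℝ}
    (ha : ContMDiff 𝓘(ℝ, EN) 𝓘(ℝ, ℝ) ∞ a)
    (hv : ContMDiff 𝓘(ℝ, EN) (𝓘(ℝ, EB).prod 𝓘(ℝ, Fb)) ∞ fun y => (⟨f y, v y⟩ : TotalSpace Fb V))
    (hw : ContMDiff 𝓘(ℝ, EN) (𝓘(ℝ, EB).prod 𝓘(ℝ, Fb)) ∞ fun y => (⟨f y, w y⟩ : TotalSpace Fb V)) :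
    ContMDiff 𝓘(ℝ, EN) (𝓘(ℝ, EB).prod 𝓘(ℝ, Fb)) ∞
      fun y => (⟨f y, a y • v y + w y⟩ : TotalSpace Fb V) := by
  intro y
  obtain ⟨hf, hv'⟩ := (Bundle.contMDiffAt_totalSpace ..).1 (hv y)
  obtain ⟨-, hw'⟩ := (Bundle.contMDiffAt_totalSpace ..).1 (hw y)
  refine (Bundle.contMDiffAt_totalSpace ..).2 ⟨hf, ?_⟩
  have h1 := ((ha y).smul hv').add hw'
  refine h1.congr_of_eventuallyEq ?_
  have hb := hf.continuousAt.preimage_mem_nhds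
    ((trivializationAt Fb V (f y)).open_baseSet.mem_nhds (mem_baseSet_trivializationAt Fb V (f y)))
  filter_upwards [hb] with z hz
  have hl := (trivializationAt Fb V (f y)).linear ℝ hz
  simp only [hl.map_add, hl.map_smul, Pi.add_apply, Pi.smul_apply']

lemma contMDiff_tvec_smul_add {E N EN N' : Type*} [NormedAddCommGroup E] [NormedSpace ℝ E]
    [TopologicalSpace N] [ChartedSpace E N] [IsManifold 𝓘(ℝ, E) ∞ N]
    [NormedAddCommGroup EN] [NormedSpace ℝ EN] [TopologicalSpace N'] [ChartedSpace EN N']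
    {f : N' → N} {v w : N' → E} {a : N' → ℝ} (ha : ContMDiff 𝓘(ℝ, EN) 𝓘(ℝ, ℝ) ∞ a)
    (hv : ContMDiff 𝓘(ℝ, EN) 𝓘(ℝ, E).tangent ∞ fun y => tvec (f y) (v y))
    (hw : ContMDiff 𝓘(ℝ, EN) 𝓘(ℝ, E).tangent ∞ fun y => tvec (f y) (w y)) :
    ContMDiff 𝓘(ℝ, EN) 𝓘(ℝ, E).tangent ∞ fun y => tvec (f y) (a y • v y + w y) :=
  contMDiff_smul_add (V := (TangentSpace 𝓘(ℝ, E) : N → Type _)) (f := f) ha hv hw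

lemma contMDiff_tvec_zero {E N EN N' : Type*} [NormedAddCommGroup E] [NormedSpace ℝ E]
    [TopologicalSpace N] [ChartedSpace E N] [IsManifold 𝓘(ℝ, E) ∞ N]
    [NormedAddCommGroup EN] [NormedSpace ℝ EN] [TopologicalSpace N'] [ChartedSpace EN N']
    {f : N' → N} (hf : ContMDiff 𝓘(ℝ, EN) 𝓘(ℝ, E) ∞ f) :
    ContMDiff 𝓘(ℝ, EN) 𝓘(ℝ, E).tangent ∞ fun y => tvec (f y) (0 : E) :=
  (Bundle.contMDiff_zeroSection ℝ (TangentSpace 𝓘(ℝ, E) : N → Type _)).comp hf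

end Fibrewise

variable (EM M) in
/-- Smooth functions on the manifold `M`. -/
def smoothFunM : Subalgebra ℝ (M → ℝ) where
  carrier := {f | ContMDiff 𝓘(ℝ, EM) 𝓘(ℝ, ℝ) ∞ f}
  mul_mem' hf hg := hf.mul hg
  add_mem' hf hg := hf.add hg
  algebraMap_mem' r := contMDiff_const (c := r)

/-- `Γ(𝔤)`: smooth sections `u`, `u(x) ∈ T_{1_x}G` with `Ts(u(x)) = 0`, of the Lie algebroid. -/
def Alg : Submodule (smoothFunM EM M) (M → EG) where
  carrier := {u | ContMDiff 𝓘(ℝ, EM) 𝓘(ℝ, EG).tangent ∞ (fun x => tvec (𝒢.unit x) (u x)) ∧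
    ∀ x, 𝒢.dsrc (𝒢.unit x) (u x) = 0}
  add_mem' {u w} hu hw := by
    refine ⟨?_, fun x => by simp [hu.2 x, hw.2 x]⟩
    simpa using contMDiff_tvec_smul_add (a := fun _ => 1) contMDiff_const hu.1 hw.1
  zero_mem' := ⟨contMDiff_tvec_zero 𝒢.unit_smooth, fun x => by simp⟩
  smul_mem' a u hu := by
    refine ⟨?_, fun x => ?_⟩
    · have h := contMDiff_tvec_smul_add a.2 hu.1 (contMDiff_tvec_zero 𝒢.unit_smooth)
      simp only [add_zero] at h
      exact h
    · change 𝒢.dsrc (𝒢.unit x) (a.1 x • u x) = 0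
      rw [map_smul, hu.2 x, smul_zero]

instance : AddCommGroup (Alg 𝒢) := Submodule.addCommGroup _
instance : Module (smoothFunM EM M) (Alg 𝒢) := Submodule.module _
instance : SMul (smoothFunM EM M) (Alg 𝒢) := Module.toDistribMulAction.toSMul
instance : IsScalarTower ℝ (smoothFunM EM M) (M → EG) :=
  ⟨fun r a u => funext fun x => mul_smul r (a.1 x) (u x)⟩
instance : Module ℝ (Alg 𝒢) := Submodule.module' _

/-! ### Flows

The derivative at `ε = 0` along the flow `φ_ε^u` of the right-invariant vector field of `u` is
computed with the maps `Φ_ε = φ_ε^u ∘ 1 : M → G`, which are sections of `s`; then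
`φ_ε^u(g) = Φ_ε(t(g)) g`.  As the flow need not be complete, it is cut off away from a given point.
Only the velocity of `Φ` at `ε = 0`, near that point, enters. -/

/-- A smooth one-parameter family of sections of the source map starting at the units. -/
structure SrcFlow where
  toFun : ℝ → M → G
  smooth : ContMDiff (𝓘(ℝ, ℝ).prod 𝓘(ℝ, EM)) 𝓘(ℝ, EG) ∞ (fun z : ℝ × M => toFun z.1 z.2)
  src_eq : ∀ ε x, 𝒢.src (toFun ε x) = x
  zero_eq : ∀ x, toFun 0 x = 𝒢.unit x

variable {𝒢}

/-- The family has velocity `u` at `ε = 0`, near the point `m`. -/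
def SrcFlow.HasVelocity (Φ : SrcFlow 𝒢) (u : Alg 𝒢) (m : M) : Prop :=
  ∀ᶠ x in 𝓝 m, (mfderiv 𝓘(ℝ, ℝ) 𝓘(ℝ, EG) (fun ε => Φ.toFun ε x) 0 : ℝ →L[ℝ] EG) 1 = u.1 x

/-- The constant family. -/
def SrcFlow.const (𝒢 : LieGroupoid EM M EG G) : SrcFlow 𝒢 :=
  ⟨fun _ => 𝒢.unit, 𝒢.unit_smooth.comp contMDiff_snd, fun _ => 𝒢.src_unit, fun _ => rfl⟩

open Classical in
/-- The maps `φ_ε^u ∘ 1` near `m`. -/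
def flow (u : Alg 𝒢) (m : M) : SrcFlow 𝒢 :=
  if h : ∃ Φ : SrcFlow 𝒢, Φ.HasVelocity u m then h.choose else SrcFlow.const 𝒢

/-- The differential of `Φ_ε` at `x`. -/
def SrcFlow.d (Φ : SrcFlow 𝒢) (ε : ℝ) (x : M) : EM →L[ℝ] EG :=
  mfderiv 𝓘(ℝ, EM) 𝓘(ℝ, EG) (Φ.toFun ε) x

lemma SrcFlow.dsrc_d (Φ : SrcFlow 𝒢) (ε : ℝ) (x : M) (v : EM) :
    𝒢.dsrc (Φ.toFun ε x) (Φ.d ε x v) = v :=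
  comp_mfderiv_of_section (r := Φ.toFun ε)
    (Φ.smooth.comp (contMDiff_const.prodMk contMDiff_id)) 𝒢.src_smooth (Φ.src_eq ε) v

/-- `Φ_ε(x)` in the source fibre at `x`. -/
def SrcFlow.at (Φ : SrcFlow 𝒢) (x : M) (ε : ℝ) : SrcFibre 𝒢.toUnitalGraph x :=
  ⟨Φ.toFun ε x, Φ.src_eq ε x⟩

/-! ### Differential forms on the nerve with coefficients in `C` -/

variable (𝒢) in
/-- `B_p 𝒢`. -/
abbrev B (p : ℕ) := Simplex 𝒢.toUnitalGraph p

/-- The tangent space `T_b(B_p 𝒢)`: compatible tangent vectors at the vertices and arrows. -/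
def Tan {p : ℕ} (b : B 𝒢 p) : Submodule ℝ ((Fin (p + 1) → EM) × (Fin p → EG)) where
  carrier := {w | (∀ i, 𝒢.dtgt (b.arr i) (w.2 i) = w.1 i.castSucc) ∧
    ∀ i, 𝒢.dsrc (b.arr i) (w.2 i) = w.1 i.succ}
  add_mem' hv hw := ⟨fun i => by simp [hv.1 i, hw.1 i], fun i => by simp [hv.2 i, hw.2 i]⟩
  zero_mem' := ⟨fun i => by simp, fun i => by simp⟩
  smul_mem' a v hv := ⟨fun i => by simp [hv.1 i], fun i => by simp [hv.2 i]⟩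

/-- The tangent vector `(V, w₁, …, w_p)` at `(h, g₁, …, g_p)`, for `Ts(V) = Tt(w₁)`. -/
def Tan.cons {p : ℕ} {b : B 𝒢 p} (h : SrcFibre 𝒢.toUnitalGraph (b.vert 0)) {x : M}
    (hx : 𝒢.tgt h.1 = x) (w : Tan b) (V : EG) (hV : 𝒢.dsrc h.1 V = w.1.1 0) : Tan (b.cons h hx) :=
  ⟨(Fin.cons (𝒢.dtgt h.1 V) w.1.1, Fin.cons V w.1.2), by
    refine ⟨fun i => ?_, fun i => ?_⟩
    · refine Fin.cases ?_ (fun j => ?_) i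
      · simp [Simplex.cons]
      · simpa [Simplex.cons, ← Fin.succ_castSucc] using w.2.1 j
    · refine Fin.cases ?_ (fun j => ?_) i
      · simpa [Simplex.cons] using hV
      · simpa [Simplex.cons] using w.2.2 j⟩

variable (C) in
/-- Families of `C_{t(g₁)}`-valued functions of `n` tangent vectors at the points of `B_p 𝒢`. -/
abbrev PreForm (𝒢 : LieGroupoid EM M EG G) (p n : ℕ) :=
  ∀ b : B 𝒢 p, (Fin n → Tan b) → C (b.vert 0)

/-- A smooth family of `n`-tuples of tangent vectors of `B_p 𝒢`. -/
def IsSmoothFamily {p n N : ℕ} (b : EuclideanSpace ℝ (Fin N) → B 𝒢 p)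
    (w : ∀ y, Fin n → Tan (b y)) : Prop :=
  (∀ i, ContMDiff (𝓡 N) 𝓘(ℝ, EM) ∞ fun y => (b y).vert i) ∧
  (∀ i, ContMDiff (𝓡 N) 𝓘(ℝ, EG) ∞ fun y => (b y).arr i) ∧
  (∀ j i, ContMDiff (𝓡 N) 𝓘(ℝ, EM).tangent ∞ fun y => tvec ((b y).vert i) ((w y j).1.1 i)) ∧
  ∀ j i, ContMDiff (𝓡 N) 𝓘(ℝ, EG).tangent ∞ fun y => tvec ((b y).arr i) ((w y j).1.2 i)

variable (F) in
/-- `θ ∈ Ω^n(B_p 𝒢, t^*C)`: alternating multilinear at each point, and smooth, i.e. smooth on smooth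
families of tangent vectors. -/
def IsForm {p n : ℕ} (θ : PreForm C 𝒢 p n) : Prop :=
  (∀ b, ∃ A : (Tan b) [⋀^Fin n]→ₗ[ℝ] C (b.vert 0), ⇑A = θ b) ∧
  ∀ (N : ℕ) (b : EuclideanSpace ℝ (Fin N) → B 𝒢 p) (w : ∀ y, Fin n → Tan (b y)),
    IsSmoothFamily b w → ContMDiff (𝓡 N) (𝓘(ℝ, EM).prod 𝓘(ℝ, F)) ∞
      fun y => (⟨(b y).vert 0, θ (b y) (w y)⟩ : TotalSpace F C)

variable (F C 𝒢) in
/-- `Ω^n(B_p 𝒢, t^*C)`; for `p = 0` this is `Ω^n(M, C)`. -/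
abbrev Form (p n : ℕ) := {θ : PreForm C 𝒢 p n // IsForm F θ}

/-- Normalized forms: `s_i^* θ = 0` for all degeneracies.  The tangent vectors in the image of
`Ts_i` are those at a simplex with `g_{i+1}` a unit whose component there is tangent to the units. -/
def PreForm.IsNormalized {p n : ℕ} (θ : PreForm C 𝒢 p n) : Prop :=
  ∀ (b : B 𝒢 p) (w : Fin n → Tan b) (i : Fin p), b.arr i = 𝒢.unit (b.vert i.succ) →
    (∀ j, (w j).1.2 i = 𝒢.dunit (b.vert i.succ) ((w j).1.1 i.succ)) → θ b w = 0

/-! ### The operators `R_u` and `J_u` on forms -/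

/-- The tangent vector `(u(t(g₁)), 0, …, 0)` at `(1_{t(g₁)}, g₁, …, g_p)`, i.e. the value of the
vector field `B_p u` there. -/
def insertVec (u : Alg 𝒢) {p : ℕ} (b : B 𝒢 p) :
    Tan b.deg :=
  Tan.cons _ _ 0 (u.1 (b.vert 0)) (u.2.2 (b.vert 0))

/-- The differential of the degeneracy `s₀`. -/
def degVec {p : ℕ} {b : B 𝒢 p} (w : Tan b) :
    Tan b.deg :=
  Tan.cons _ _ w (𝒢.dunit (b.vert 0) (w.1.1 0)) (𝒢.dsrc_dunit _ _)

/-- `J_u θ = s₀^* i_{B_p u} θ`. -/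
def J (u : Alg 𝒢) {p n : ℕ} (θ : PreForm C 𝒢 (p + 1) (n + 1)) : PreForm C 𝒢 p n :=
  fun b w => θ b.deg (Fin.cons (insertVec u b) fun j => degVec (w j))

variable (F) in
/-- The derivative at `0` of a curve in a fibre of `C`. -/
def fibreDeriv {x : M} (c : ℝ → C x) : C x :=
  let e := (trivializationAt F C x).continuousLinearEquivAt ℝ x (mem_baseSet_trivializationAt F C x)
  e.symm (deriv (fun ε => e (c ε)) 0)

/-- `R_u θ = s₀^* (d/dε at 0, Δ_{φ_ε^u(t(g₁))⁻¹} ∘ (ψ_ε^u)^* θ)`, where `ψ_ε^u ∘ s₀` is the map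
`(g₁, …, g_p) ↦ (Φ_ε(t(g₁)), g₁, …, g_p)`. -/
def RForm (ρ : Representation F C 𝒢) (u : Alg 𝒢) {p n : ℕ} (θ : PreForm C 𝒢 (p + 1) n) :
    PreForm C 𝒢 p n :=
  fun b w => fibreDeriv F fun ε =>
    let Φ := flow u (b.vert 0)
    ρ.act (𝒢.inv (Φ.toFun ε (b.vert 0))) (𝒢.src_inv _) ((𝒢.tgt_inv _).trans (Φ.src_eq _ _))
      (θ (b.cons (Φ.at (b.vert 0) ε) rfl) fun j =>
        Tan.cons (Φ.at (b.vert 0) ε) rfl (w j) (Φ.d ε (b.vert 0) ((w j).1.1 0)) (Φ.dsrc_d _ _ _))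

variable (C 𝒢) in
/-- Forms of all degrees at once. -/
abbrev TotForm (p : ℕ) := ∀ n, PreForm C 𝒢 p n

/-- The form `θ` of degree `q`, with zero components in the other degrees. -/
def TotForm.single {p q : ℕ} (θ : PreForm C 𝒢 p q) : TotForm C 𝒢 p :=
  fun n => if h : n = q then h ▸ θ else 0

/-- The operators `R_u` in all degrees. -/
def TotForm.R (ρ : Representation F C 𝒢) (u : Alg 𝒢) {p : ℕ} (θ : TotForm C 𝒢 (p + 1)) :
    TotForm C 𝒢 p := fun n => RForm ρ u (θ n)

/-- The operators `J_u` in all degrees. -/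
def TotForm.J (u : Alg 𝒢) {p : ℕ} (θ : TotForm C 𝒢 (p + 1)) : TotForm C 𝒢 p :=
  fun n => VanEst.J u (θ (n + 1))

/-- `D₁ ⋯ D_p θ` for operators that lower `p` by one. -/
def iterD : ∀ {p : ℕ}, (Fin p → ∀ m, TotForm C 𝒢 (m + 1) → TotForm C 𝒢 m) →
    TotForm C 𝒢 p → TotForm C 𝒢 0
  | 0, _, θ => θ
  | p + 1, D, θ => iterD (fun i => D i.castSucc) (D (Fin.last p) p θ)

/-! ### The Weil complex and the explicit Van Est map -/

variable (C 𝒢) in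
/-- Sequences `c = (c₀, c₁, …)`, `c_k(u₁, …, u_l | v₁, …, v_k) ∈ Ω^r(M, C)` with `l = p - k` and
`r = q - k`; forms of negative degree are zero, so `k ≤ q`. -/
abbrev WeilSeq (p q : ℕ) :=
  ∀ k l r : ℕ, k + l = p → k + r = q → (Fin l → Alg 𝒢) → (Fin k → Alg 𝒢) → PreForm C 𝒢 0 r

/-- `f η` for a function `f` on `M`. -/
def fsmul (f : M → ℝ) {r : ℕ} (η : PreForm C 𝒢 0 r) : PreForm C 𝒢 0 r :=
  fun b w => f (b.vert 0) • η b w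

/-- `df` at `x`. -/
def dfun (f : M → ℝ) (x : M) : EM →L[ℝ] ℝ := mfderiv 𝓘(ℝ, EM) 𝓘(ℝ, ℝ) f x

/-- `df ∧ η`, for a function `f` on `M`. -/
def dwedge (f : M → ℝ) {r : ℕ} (η : PreForm C 𝒢 0 r) : PreForm C 𝒢 0 (r + 1) :=
  fun b w => ∑ j : Fin (r + 1), ((-1 : ℝ) ^ (j : ℕ) * dfun f (b.vert 0) ((w j).1.1 0)) •
      η b fun i => w (j.succAbove i)

variable (F) in
/-- `c ∈ W^{p,q}(𝔤, C)`.  An element of `Ω^r(M, S^k 𝔤^* ⊗ C)` is a symmetric `C^∞(M)`-multilinear map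
from `Γ(𝔤)^k` to `Ω^r(M, C)`. -/
structure IsWeil {p q : ℕ} (c : WeilSeq C 𝒢 p q) : Prop where
  isForm : ∀ k l r hp hq u v, IsForm F (c k l r hp hq u v)
  alternating : ∀ k l r hp hq v,
    ∃ A : (Alg 𝒢) [⋀^Fin l]→ₗ[ℝ] PreForm C 𝒢 0 r, ⇑A = fun u => c k l r hp hq u v
  symmetric : ∀ k l r hp hq u v (σ : Equiv.Perm (Fin k)),
    c k l r hp hq u (v ∘ σ) = c k l r hp hq u v
  add_right : ∀ k l r hp hq u v i (a b : Alg 𝒢),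
    c k l r hp hq u (Function.update v i (a + b)) =
      c k l r hp hq u (Function.update v i a) + c k l r hp hq u (Function.update v i b)
  smul_right : ∀ k l r hp hq u v i (f : smoothFunM EM M) (a : Alg 𝒢),
    c k l r hp hq u (Function.update v i (f • a)) =
      fsmul f.1 (c k l r hp hq u (Function.update v i a))
  leibniz : ∀ k l r (hp : k + (l + 1) = p) (hq : k + (r + 1) = q) (f : smoothFunM EM M) u₁
    (u : Fin l → Alg 𝒢) v,
    c k (l + 1) (r + 1) hp hq (Fin.cons (f • u₁) u) v =
      fsmul f.1 (c k (l + 1) (r + 1) hp hq (Fin.cons u₁ u) v) +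
        dwedge f.1 (c (k + 1) l r (by omega) (by omega) u (Fin.cons u₁ v))
  leibniz_zero : ∀ k l (hp : k + (l + 1) = p) (hq : k + 0 = q) (f : smoothFunM EM M) u₁
    (u : Fin l → Alg 𝒢) v,
    c k (l + 1) 0 hp hq (Fin.cons (f • u₁) u) v =
      fsmul f.1 (c k (l + 1) 0 hp hq (Fin.cons u₁ u) v)

/-- `ε(σ, k)`: the number of pairs `i < j ≤ k` with `σ⁻¹(i) > σ⁻¹(j)`. -/
def eps {p : ℕ} (σ : Equiv.Perm (Fin p)) (k : ℕ) : ℕ :=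
  (Finset.univ.filter fun z : Fin p × Fin p =>
    z.1 < z.2 ∧ (z.2 : ℕ) < k ∧ σ⁻¹ z.2 < σ⁻¹ z.1).card

/-- `D_j = J_{v_j}` for `j ≤ k` and `D_j = R_{u_{j-k}}` for `j > k`. -/
def Dop (ρ : Representation F C 𝒢) {k l p : ℕ} (hp : k + l = p) (u : Fin l → Alg 𝒢)
    (v : Fin k → Alg 𝒢) (j : Fin p) : ∀ m, TotForm C 𝒢 (m + 1) → TotForm C 𝒢 m :=
  Fin.addCases (motive := fun _ => ∀ m, TotForm C 𝒢 (m + 1) → TotForm C 𝒢 m)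
    (fun i _ θ => TotForm.J (v i) θ) (fun i _ θ => TotForm.R ρ (u i) θ) (Fin.cast hp.symm j)

/-- The explicit Van Est map `VE_Ω(θ) = (c₀(θ), c₁(θ), …)`. -/
def VEΩ (ρ : Representation F C 𝒢) {p q : ℕ} (θ : PreForm C 𝒢 p q) : WeilSeq C 𝒢 p q :=
  fun k l r hp _ u v =>
    ((-1 : ℝ) ^ (k * (k - 1) / 2)) • ∑ σ : Equiv.Perm (Fin p),
      (((Equiv.Perm.sign σ : ℤ) : ℝ) * (-1) ^ eps σ k) •
        iterD (fun i => Dop ρ hp u v (σ i)) (TotForm.single θ) r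

/-! ### The groupoid `𝔾_q = TG ×_G ⋯ ×_G TG ×_G t^*C^*` over `𝕄_q = TM ×_M ⋯ ×_M TM ×_M C^*` -/

/-- Points of `𝕄_q`: a point, `q` tangent vectors and a covector of `C` at that point.  (`F` is the
model fibre of `C`.) -/
structure BigObj (F EM : Type*) {M : Type*} (C : M → Type*) [∀ x, AddCommGroup (C x)]
    [∀ x, Module ℝ (C x)] [∀ x, TopologicalSpace (C x)] (q : ℕ) where
  pt : M
  vec : Fin q → EM
  cov : C pt →L[ℝ] ℝ

/-- Points of `𝔾_q`: an arrow `g`, `q` tangent vectors at `g`, and a covector of `C` at the point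
`base = t(g)`. -/
structure BigArr (F : Type*) {M G : Type*} (C : M → Type*) [∀ x, AddCommGroup (C x)]
    [∀ x, Module ℝ (C x)] [∀ x, TopologicalSpace (C x)] (EG : Type*) (tgt : G → M) (q : ℕ) where
  arr : G
  vec : Fin q → EG
  base : M
  tgt_eq : tgt arr = base
  cov : C base →L[ℝ] ℝ

variable {q : ℕ}

/-- A family in `𝕄_q` is smooth iff its components in `M`, `TM` and `C^*` are. -/
instance BigObj.diffeology : DiffeologicalSpace (BigObj F EM C q) :=
  pullDiffeology BigObj.pt (manifoldDiffeology 𝓘(ℝ, EM) M) ⊓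
  ((⨅ j, pullDiffeology (fun x => tvec x.pt (x.vec j))
    (manifoldDiffeology 𝓘(ℝ, EM).tangent (TangentBundle 𝓘(ℝ, EM) M))) ⊓
  pullDiffeology (fun x => dvec F x.pt x.cov)
    (manifoldDiffeology (𝓘(ℝ, EM).prod 𝓘(ℝ, F →L[ℝ] ℝ)) _))

/-- A family in `𝔾_q` is smooth iff its components in `G`, `TG` and `C^*` are. -/
instance BigArr.diffeology : DiffeologicalSpace (BigArr F C EG 𝒢.tgt q) :=
  pullDiffeology BigArr.arr (manifoldDiffeology 𝓘(ℝ, EG) G) ⊓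
  ((⨅ j, pullDiffeology (fun a => tvec a.arr (a.vec j))
    (manifoldDiffeology 𝓘(ℝ, EG).tangent (TangentBundle 𝓘(ℝ, EG) G))) ⊓
  pullDiffeology (fun a => dvec F a.base a.cov)
    (manifoldDiffeology (𝓘(ℝ, EM).prod 𝓘(ℝ, F →L[ℝ] ℝ)) _))

lemma BigObj.isPlot_iff {n : ℕ} {x : EuclideanSpace ℝ (Fin n) → BigObj F EM C q} :
    IsPlot x ↔
      ContMDiff (𝓡 n) 𝓘(ℝ, EM) ∞ (fun y => (x y).pt) ∧
      (∀ j, ContMDiff (𝓡 n) 𝓘(ℝ, EM).tangent ∞ fun y => tvec (x y).pt ((x y).vec j)) ∧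
      ContMDiff (𝓡 n) (𝓘(ℝ, EM).prod 𝓘(ℝ, F →L[ℝ] ℝ)) ∞ fun y => dvec F (x y).pt (x y).cov :=
  DiffeologicalSpace.isPlot_inf_iff.trans (and_congr Iff.rfl
    (DiffeologicalSpace.isPlot_inf_iff.trans
      (and_congr DiffeologicalSpace.isPlot_iInf_iff Iff.rfl)))

lemma BigArr.isPlot_iff {n : ℕ} {a : EuclideanSpace ℝ (Fin n) → BigArr F C EG 𝒢.tgt q} :
    IsPlot a ↔
      ContMDiff (𝓡 n) 𝓘(ℝ, EG) ∞ (fun y => (a y).arr) ∧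
      (∀ j, ContMDiff (𝓡 n) 𝓘(ℝ, EG).tangent ∞ fun y => tvec (a y).arr ((a y).vec j)) ∧
      ContMDiff (𝓡 n) (𝓘(ℝ, EM).prod 𝓘(ℝ, F →L[ℝ] ℝ)) ∞
        fun y => dvec F (a y).base (a y).cov :=
  DiffeologicalSpace.isPlot_inf_iff.trans (and_congr Iff.rfl
    (DiffeologicalSpace.isPlot_inf_iff.trans
      (and_congr DiffeologicalSpace.isPlot_iInf_iff Iff.rfl)))

lemma contMDiff_tvec_map {E N E' N' : Type*} [NormedAddCommGroup E] [NormedSpace ℝ E]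
    [TopologicalSpace N] [ChartedSpace E N] [IsManifold 𝓘(ℝ, E) ∞ N]
    [NormedAddCommGroup E'] [NormedSpace ℝ E'] [TopologicalSpace N'] [ChartedSpace E' N']
    [IsManifold 𝓘(ℝ, E') ∞ N'] {f : N → N'} (hf : ContMDiff 𝓘(ℝ, E) 𝓘(ℝ, E') ∞ f)
    {n : ℕ} {x : EuclideanSpace ℝ (Fin n) → N} {v : EuclideanSpace ℝ (Fin n) → E}
    (h : ContMDiff (𝓡 n) 𝓘(ℝ, E).tangent ∞ fun y => tvec (x y) (v y)) :
    ContMDiff (𝓡 n) 𝓘(ℝ, E').tangent ∞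
      fun y => tvec (f (x y)) ((mfderiv 𝓘(ℝ, E) 𝓘(ℝ, E') f (x y) : E →L[ℝ] E') (v y)) :=
  haveI : IsManifold 𝓘(ℝ, E) 1 N := IsManifold.of_le (n := ∞) (by simp)
  haveI : IsManifold 𝓘(ℝ, E') 1 N' := IsManifold.of_le (n := ∞) (by simp)
  (hf.contMDiff_tangentMap (m := ∞) (by simp)).comp h

lemma Representation.act_inv_act (ρ : Representation F C 𝒢) (g : G) {x y : M}
    (hx : 𝒢.src g = x) (hy : 𝒢.tgt g = y) (c : C x) :
    ρ.act (𝒢.inv g) ((𝒢.src_inv g).trans hy) ((𝒢.tgt_inv g).trans hx) (ρ.act g hx hy c) = c := by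
  rw [← ρ.act_mul]
  have key : ∀ (k : G) (h1 : 𝒢.src k = x) (h2 : 𝒢.tgt k = x), k = 𝒢.unit x →
      ρ.act k h1 h2 c = c := by
    rintro k h1 h2 rfl
    exact ρ.act_unit x c
  exact key _ _ _ ((𝒢.inv_mul g).trans (by rw [hx]))

/-- The source map of `𝔾_q`. -/
def bigSrc (ρ : Representation F C 𝒢) (a : BigArr F C EG 𝒢.tgt q) : BigObj F EM C q :=
  ⟨𝒢.src a.arr, fun j => 𝒢.dsrc a.arr (a.vec j), a.cov.comp (ρ.act a.arr rfl a.tgt_eq)⟩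

lemma bigSrc_eq (ρ : Representation F C 𝒢) {a : BigArr F C EG 𝒢.tgt q} {x : BigObj F EM C q}
    (h : 𝒢.src a.arr = x.pt) (hv : ∀ j, 𝒢.dsrc a.arr (a.vec j) = x.vec j)
    (hc : ∀ c, a.cov (ρ.act a.arr h a.tgt_eq c) = x.cov c) : bigSrc ρ a = x := by
  obtain ⟨m, v, ξ⟩ := x
  dsimp only at h
  subst h
  obtain rfl : (fun j => 𝒢.dsrc a.arr (a.vec j)) = v := funext hv
  obtain rfl : a.cov.comp (ρ.act a.arr rfl a.tgt_eq) = ξ := ContinuousLinearMap.ext hc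
  rfl

variable (q) in
/-- The groupoid `𝔾_q ⇉ 𝕄_q` with componentwise structure: that of the tangent groupoid `TG ⇉ TM` on
the tangent vectors, and that of the action groupoid `t^*C^* ⇉ C^*` on the covectors,
`s(g, ξ) = Δ_g^* ξ`, `t(g, ξ) = ξ`, `1_ξ = (1, ξ)`. -/
def big (ρ : Representation F C 𝒢) : SmoothGraph (BigObj F EM C q) (BigArr F C EG 𝒢.tgt q) where
  src := bigSrc ρ
  tgt a := ⟨a.base, fun j => 𝒢.dtgt a.arr (a.vec j), a.cov⟩
  unit x := ⟨𝒢.unit x.pt, fun j => 𝒢.dunit x.pt (x.vec j), x.pt, 𝒢.tgt_unit x.pt, x.cov⟩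
  src_unit x := bigSrc_eq ρ (𝒢.src_unit x.pt) (fun _ => 𝒢.dsrc_dunit _ _)
    (fun c => congrArg x.cov (ρ.act_unit x.pt c))
  tgt_unit x := by
    have h1 : (fun j => 𝒢.dtgt (𝒢.unit x.pt) (𝒢.dunit x.pt (x.vec j))) = x.vec :=
      funext fun j => 𝒢.dtgt_dunit _ _
    simp only [h1]
  tgt_smooth n a ha := by
    rw [BigArr.isPlot_iff] at ha
    refine BigObj.isPlot_iff.2 ⟨?_, fun j => ?_, ha.2.2⟩
    · simpa [Function.comp_def, (a _).tgt_eq] using 𝒢.tgt_smooth.comp ha.1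
    · have h := contMDiff_tvec_map 𝒢.tgt_smooth (ha.2.1 j)
      simp only [(a _).tgt_eq] at h
      exact h
  unit_smooth n x hx := by
    rw [BigObj.isPlot_iff] at hx
    exact BigArr.isPlot_iff.2 ⟨𝒢.unit_smooth.comp hx.1,
      fun j => contMDiff_tvec_map 𝒢.unit_smooth (hx.2.1 j), hx.2.2⟩

/-- The endomorphism `(v₁, …, v_q, ξ) ↦ (a₁ v_{τ(1)}, …, a_q v_{τ(q)}, b ξ)` of `𝔾_q`. -/
def fibrewise (ρ : Representation F C 𝒢) (a : Fin q → ℝ) (τ : Fin q → Fin q) (b : ℝ) :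
    Endo (big q ρ) where
  obj x := ⟨x.pt, fun j => a j • x.vec (τ j), b • x.cov⟩
  arr h := ⟨h.arr, fun j => a j • h.vec (τ j), h.base, h.tgt_eq, b • h.cov⟩
  src_arr h := bigSrc_eq ρ rfl (fun j => map_smul _ _ _) (fun _ => rfl)
  tgt_arr h := by
    simp only [big, map_smul]
    rfl
  arr_unit x := by
    simp only [big, map_smul]
    rfl
  obj_smooth n x hx := by
    rw [BigObj.isPlot_iff] at hx
    refine BigObj.isPlot_iff.2 ⟨hx.1, fun j => ?_, ?_⟩
    · simpa using contMDiff_tvec_smul_add (a := fun _ => a j) contMDiff_const (hx.2.1 (τ j))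
        (contMDiff_tvec_zero hx.1)
    · have h := contMDiff_smul_add (V := fun x => C x →L[ℝ] Bundle.Trivial M ℝ x)
        (a := fun _ => b - 1) contMDiff_const hx.2.2 hx.2.2
      have e : ∀ y, (b - 1) • (x y).cov + (x y).cov = b • (x y).cov := fun y =>
        ContinuousLinearMap.ext fun c => by
          change (b - 1) * (x y).cov c + (x y).cov c = b * (x y).cov c
          ring
      exact (funext fun y => congrArg (dvec F (x y).pt) (e y)) ▸ h
  arr_smooth n x hx := by
    rw [BigArr.isPlot_iff] at hx
    refine BigArr.isPlot_iff.2 ⟨hx.1, fun j => ?_, ?_⟩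
    · simpa using contMDiff_tvec_smul_add (a := fun _ => a j) contMDiff_const (hx.2.1 (τ j))
        (contMDiff_tvec_zero hx.1)
    · have h := contMDiff_smul_add (V := fun x => C x →L[ℝ] Bundle.Trivial M ℝ x)
        (a := fun _ => b - 1) contMDiff_const hx.2.2 hx.2.2
      have e : ∀ y, (b - 1) • (x y).cov + (x y).cov = b • (x y).cov := fun y =>
        ContinuousLinearMap.ext fun c => by
          change (b - 1) * (x y).cov c + (x y).cov c = b * (x y).cov c
          ring
      exact (funext fun y => congrArg (dvec F (x y).base) (e y)) ▸ h

/-- The homogeneous structure `h_λ`. -/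
def hom (ρ : Representation F C 𝒢) (r : ℝ) : Endo (big q ρ) := fibrewise ρ (fun _ => r) id r

/-- The permutation of the `q` tangent vectors. -/
def perm (ρ : Representation F C 𝒢) (σ : Equiv.Perm (Fin q)) : Endo (big q ρ) :=
  fibrewise ρ (fun _ => 1) σ 1

/-- The map `0_i ∘ pr_i` that puts zero in the `i`-th slot; `none` is the last slot, that of the
covector.  As `pr_i` is a surjective submersion with section `0_i`, pulling back by it gives zero
iff pulling back by the zero map `0_i` does. -/
def zeroSlot (ρ : Representation F C 𝒢) : Option (Fin q) → Endo (big q ρ)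
  | some i => fibrewise ρ (fun j => if j = i then 0 else 1) id 1
  | none => fibrewise ρ (fun _ => 1) id 0

/-- `C^∞_ext(B_p 𝔾_q)`: skew-symmetric, simple, `(q+1)`-homogeneous functions. -/
def IsExtFun (ρ : Representation F C 𝒢) {p : ℕ}
    (f : smoothFun (Simplex (big q ρ).toUnitalGraph p)) : Prop :=
  (∀ r : ℝ, 0 ≤ r → ∀ b, f.1 ((hom ρ r).simplex b) = r ^ (q + 1) * f.1 b) ∧
  (∀ (σ : Equiv.Perm (Fin q)) b,
    f.1 ((perm ρ σ).simplex b) = ((Equiv.Perm.sign σ : ℤ) : ℝ) * f.1 b) ∧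
  ∀ i b, f.1 ((zeroSlot ρ i).simplex b) = 0

/-- `Γ_ext(𝕄_q, Λ^p 𝔸_q^*)`: skew-symmetric multilinear `p`-forms on the Lie algebroid `𝔸_q` of
`𝔾_q`. -/
def IsExtForm (ρ : Representation F C 𝒢) {p : ℕ}
    (α : (Fin p → Sec (big q ρ).toUnitalGraph) → smoothFun (BigObj F EM C q)) : Prop :=
  IsCEForm α ∧
  (∀ r : ℝ, 0 ≤ r → (hom ρ r).PullEq (r ^ (q + 1)) α) ∧
  (∀ σ : Equiv.Perm (Fin q), (perm ρ σ).PullEq ((Equiv.Perm.sign σ : ℤ) : ℝ) α) ∧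
  ∀ i, (zeroSlot ρ i).PullEq 0 α

/-! ### Forms as functions -/

/-- The projection `B_p 𝔾_q → B_p 𝒢`. -/
def baseSimplex {ρ : Representation F C 𝒢} {p : ℕ} (b : Simplex (big q ρ).toUnitalGraph p) :
    B 𝒢 p where
  vert i := (b.vert i).pt
  arr i := (b.arr i).arr
  tgt_arr i := (b.arr i).tgt_eq.trans (congrArg BigObj.pt (b.tgt_arr i))
  src_arr i := congrArg BigObj.pt (b.src_arr i)

/-- The `j`-th tangent vector of a point of `B_p 𝔾_q = TB_p 𝒢 × ⋯ × TB_p 𝒢 × t^*C^*` (fibre product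
over `B_p 𝒢`). -/
def tanVec {ρ : Representation F C 𝒢} {p : ℕ} (b : Simplex (big q ρ).toUnitalGraph p)
    (j : Fin q) : Tan (baseSimplex b) :=
  ⟨(fun i => (b.vert i).vec j, fun i => (b.arr i).vec j),
    fun i => congrArg (fun x => x.vec j) (b.tgt_arr i),
    fun i => congrArg (fun x => x.vec j) (b.src_arr i)⟩

/-- `𝔉_θ(U₁, …, U_q, ξ) = ⟨ξ, θ(U₁, …, U_q)⟩`. -/
def frakFun (ρ : Representation F C 𝒢) {p : ℕ} (θ : PreForm C 𝒢 p q)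
    (b : Simplex (big q ρ).toUnitalGraph p) : ℝ :=
  (b.vert 0).cov (θ (baseSimplex b) (tanVec b))

/-- `𝔉 : Ω^q(B_p 𝒢, t^*C) → C^∞(B_p 𝔾_q)`. -/
def frak (ρ : Representation F C 𝒢) {p : ℕ} (θ : Form F C 𝒢 p q) :
    smoothFun (Simplex (big q ρ).toUnitalGraph p) :=
  ⟨frakFun ρ θ.1, fun n b hb => by
    have hb' := Simplex.isPlot_iff.1 hb
    have hv := fun i => BigObj.isPlot_iff.1 (hb'.1 i)
    have ha := fun i => BigArr.isPlot_iff.1 (hb'.2 i)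
    have hθ := θ.2.2 n (fun y => baseSimplex (b y)) (fun y => tanVec (b y))
      ⟨fun i => (hv i).1, fun i => (ha i).1, fun j i => (hv i).2.1 j, fun j i => (ha i).2.1 j⟩
    rw [← contMDiff_iff_contDiff]
    have h := ContMDiff.clm_bundle_apply (IB := 𝓘(ℝ, EM)) (F₁ := F) (F₂ := ℝ) (E₁ := C)
      (E₂ := Bundle.Trivial M ℝ) (b := fun y => ((b y).vert 0).pt)
      (ϕ := fun y => ((b y).vert 0).cov) (hv 0).2.2 hθ
    intro y
    exact ((Bundle.contMDiffAt_totalSpace ..).1 (h y)).2⟩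

/-! ### The sections `𝒯u`, `𝒵_i u` of `𝔸_q` and the evaluation map -/

/-- The curve `ε ↦ (TΦ_ε(x₁), …, TΦ_ε(x_q), Δ^*_{Φ_ε(m)⁻¹} ξ)`, `Φ_ε = φ_ε^u ∘ 1`, in the source fibre
at `(x₁, …, x_q, ξ)`. -/
def tangentCurve (ρ : Representation F C 𝒢) (u : Alg 𝒢) (x : BigObj F EM C q) (ε : ℝ) :
    SrcFibre (big q ρ).toUnitalGraph x :=
  let Φ := flow u x.pt
  ⟨⟨Φ.toFun ε x.pt, fun j => Φ.d ε x.pt (x.vec j), 𝒢.tgt (Φ.toFun ε x.pt), rfl,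
    x.cov.comp (ρ.act (𝒢.inv (Φ.toFun ε x.pt)) (𝒢.src_inv _)
      ((𝒢.tgt_inv _).trans (Φ.src_eq _ _)))⟩,
    bigSrc_eq ρ (Φ.src_eq ε x.pt) (fun j => Φ.dsrc_d ε x.pt (x.vec j))
      (fun c => congrArg x.cov (ρ.act_inv_act (Φ.toFun ε x.pt) (Φ.src_eq ε x.pt) rfl c))⟩

/-- The linear section `𝒯u = (Tu, …, Tu, χ_u)`; its right-invariant vector field is the tangent lift
of that of `u` on each `TG`, together with the lift to `t^*C^*` by the action. -/
def tangentSec (ρ : Representation F C 𝒢) (u : Alg 𝒢) : Sec (big q ρ).toUnitalGraph :=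
  velocitySec (tangentCurve ρ u)

/-- The curve `ε ↦ (T1(x₁), …, T1(x_i) + ε u(m), …, T1(x_q), ξ)` in the source fibre at
`(x₁, …, x_q, ξ)`. -/
def coreCurve (ρ : Representation F C 𝒢) (i : Fin q) (u : Alg 𝒢) (x : BigObj F EM C q) (ε : ℝ) :
    SrcFibre (big q ρ).toUnitalGraph x :=
  ⟨⟨𝒢.unit x.pt, fun j => 𝒢.dunit x.pt (x.vec j) + (if j = i then ε else 0) • u.1 x.pt,
    x.pt, 𝒢.tgt_unit x.pt, x.cov⟩,
    bigSrc_eq ρ (𝒢.src_unit x.pt) (fun j => by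
      simp only [map_add, map_smul, 𝒢.dsrc_dunit, u.2.2 x.pt, smul_zero, add_zero])
      (fun c => congrArg x.cov (ρ.act_unit x.pt c))⟩

/-- The core section `𝒵_i u`; its right-invariant vector field is the vertical lift of that of `u` on
the `i`-th `TG`, and zero in the other components. -/
def coreSec (ρ : Representation F C 𝒢) (i : Fin q) (u : Alg 𝒢) : Sec (big q ρ).toUnitalGraph :=
  velocitySec (coreCurve ρ i u)

/-- `𝒵₁v₁, …, 𝒵_k v_k, 𝒯u₁, …, 𝒯u_{p-k}`. -/
def evArgs (ρ : Representation F C 𝒢) {p k l r : ℕ} (hp : k + l = p) (hq : k + r = q)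
    (u : Fin l → Alg 𝒢) (v : Fin k → Alg 𝒢) (j : Fin p) : Sec (big q ρ).toUnitalGraph :=
  Fin.addCases (motive := fun _ => Sec (big q ρ).toUnitalGraph)
    (fun i => coreSec ρ (Fin.cast hq (Fin.castAdd r i)) (v i)) (fun i => tangentSec ρ (u i))
    (Fin.cast hp.symm j)

/-- `pr_{[1,k]} : 𝕄_q → 𝕄_{q-k}` forgets the first `k` tangent vectors. -/
def forget {k r : ℕ} (hq : k + r = q) (x : BigObj F EM C q) : BigObj F EM C r :=
  ⟨x.pt, fun j => x.vec (Fin.cast hq (Fin.natAdd k j)), x.cov⟩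

/-- `c = ev(α)`: `c_k(u|v)` is the form in `Ω^{q-k}(M, C)` with
`α(𝒵₁v₁, …, 𝒵_k v_k, 𝒯u₁, …, 𝒯u_{p-k}) = 𝔉_{c_k(u|v)} ∘ pr_{[1,k]}`. -/
def HasEv (ρ : Representation F C 𝒢) {p : ℕ}
    (α : (Fin p → Sec (big q ρ).toUnitalGraph) → smoothFun (BigObj F EM C q))
    (c : WeilSeq C 𝒢 p q) : Prop :=
  ∀ k l r (hp : k + l = p) (hq : k + r = q) (u : Fin l → Alg 𝒢) (v : Fin k → Alg 𝒢),
    IsForm F (c k l r hp hq u v) ∧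
    ∀ x, (α (evArgs ρ hp hq u v)).1 x =
      frakFun ρ (c k l r hp hq u v) (Simplex.pt (big r ρ).toUnitalGraph (forget hq x))

open Classical in
/-- The evaluation map `ev`. -/
def ev (ρ : Representation F C 𝒢) {p : ℕ}
    (α : (Fin p → Sec (big q ρ).toUnitalGraph) → smoothFun (BigObj F EM C q)) :
    WeilSeq C 𝒢 p q :=
  if h : ∃ c, HasEv ρ α c then h.choose else fun _ _ _ _ _ _ _ => 0

end Lie

end VanEst

end

set_option linter.unusedSectionVars false

noncomputable section

namespace VanEst

/-! The square commutes because the operators `R` on functions on the nerve of `𝔾_q` restrict to the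
operators `R_u` and `J_v` on functions that come from forms. For a form η and a choice `e` of slots,
let `frakOn` be the function ⟨ξ, η(U_{e(1)}, …, U_{e(n)})⟩. The curve defining `𝒯u` consists of the
tangent maps of the flow together with the dual action on covectors, so differentiating along it
gives ⟨ξ, R_u η⟩ (`R_tangentSec_frakOn`). The curve defining `𝒵_i v` is affine in slot i alone, so
differentiating along it contracts η with v there; this gives J_v η up to the sign (-1)^j, j being
the position of slot i in `e` (`R_coreSec_frakOn`), and zero if slot i does not occur.

Iterating (`iterR_frakOn`), the sign exponent contributed by `𝒵_m v_m` is the number of slots below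
m not yet consumed. Since D_{σ(p)} acts first, these are the m' < m with σ⁻¹(m') < σ⁻¹(m). Summed
over m they are the non-inversions of σ⁻¹ among the first k indices, k(k-1)/2 - ε(σ, k) in number
(`sum_slotCount_add_eps`). Hence each summand of `VE(𝔉_θ)` on the arguments of `ev` equals the
corresponding summand of `VE_Ω(θ)`, signs included. Covectors separate points, so the evaluation is
unique and `ev` returns `VE_Ω(θ)`. Normalization plays no role up to here.

For normalized θ, the Leibniz term in R_χ((a ∘ t) f) vanishes because f is zero on degenerate
simplices. So `VE(𝔉_θ)` is alternating and linear over functions (`VEAlt`). Its homogeneity,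
skew-symmetry and vanishing on zero slots follow from the naturality of R under endomorphisms of
`𝔾_q` (`Endo.pullEq_VE`).

The Weil relations follow from those of the arguments: `𝒵_i` is linear over functions, and `𝒯(fu) =
f 𝒯u + ∑_j df(x_j) 𝒵_j u` (`tangentSec_smul`). On inserting this sum, the terms with j ≤ k use a
slot twice and vanish (`VE_frak_update_coreSec`). In the others the new core section is moved to the
front and its slot to the first place; the signs of these two moves combine to those of df ∧ c_{k+1}
(`VE_frak_update_coreSec_natAdd`). Symmetry in the v_j holds because permuting arguments and slots
together produces the sign twice.

The analytic input is that flows exist locally (`exists_srcFlow`) and that derivatives along the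
curves of `𝒯u` and `𝒵_i u` are values of one linear functional on the 1-jet of u
(`SrcChart.exists_jet_functional`). So the choice of flow is immaterial, the sections are smooth,
and both are additive in u. -/

/-! ### Smooth functions along families with finite-dimensional parameters -/

section Plots

/-- A family parametrized by a finite-dimensional space is smooth if its reparametrizations are
plots. -/
def IsFamily {E X : Type*} [NormedAddCommGroup E] [NormedSpace ℝ E] [DiffeologicalSpace X]
    (p : E → X) : Prop :=
  ∀ (n : ℕ) (f : EuclideanSpace ℝ (Fin n) → E), ContDiff ℝ ∞ f → IsPlot (p ∘ f)

/-- Plots are parametrized by the standard Euclidean spaces only. A linear isomorphism with such a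
space extends smoothness along plots to parameters in ℝ, in products with ℝ and in chart spaces. -/
lemma contDiff_comp_family {E X : Type*} [NormedAddCommGroup E] [NormedSpace ℝ E]
    [FiniteDimensional ℝ E] [DiffeologicalSpace X] (F : smoothFun X) {p : E → X}
    (hp : IsFamily p) : ContDiff ℝ ∞ fun y => F.1 (p y) := by
  have h := F.2 _ _ (hp _ (toEuclidean (E := E)).symm (toEuclidean (E := E)).symm.contDiff)
  have h2 := h.comp (toEuclidean (E := E)).contDiff
  simpa [Function.comp_def] using h2

lemma contDiff_curve {X : Type*} [DiffeologicalSpace X] (F : smoothFun X) {c : ℝ → X}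
    (hc : DSmooth c) : ContDiff ℝ ∞ fun ε => F.1 (c ε) :=
  contDiff_comp_family F fun n f hf => hc n f (isPlot_iff_contDiff.2 hf)

lemma differentiableAt_curve {X : Type*} [DiffeologicalSpace X] (F : smoothFun X)
    {c : ℝ → X} (hc : DSmooth c) (ε : ℝ) : DifferentiableAt ℝ (fun ε => F.1 (c ε)) ε :=
  (contDiff_curve F hc).differentiable (by simp) ε

end Plots

/-! ### Derivation property and algebra of the operators R_χ -/

section Graph

variable {Ob Ar : Type*} [dOb : DiffeologicalSpace Ob] [dAr : DiffeologicalSpace Ar]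

instance (S : UnitalGraph Ob Ar) : Module (smoothFun Ob) (Sec S) := Submodule.module _
instance (S : UnitalGraph Ob Ar) : SMul (smoothFun Ob) (Sec S) := Module.toDistribMulAction.toSMul

/-- Elements of the Lie algebroid are derivations at the unit. -/
lemma algFibre_mul {S : UnitalGraph Ob Ar} {x : Ob} (D : algFibre S x)
    (f g : smoothFun (SrcFibre S x)) :
    D.1 (f * g) = f.1 (SrcFibre.one S x) * D.1 g + g.1 (SrcFibre.one S x) * D.1 f := by
  obtain ⟨D, hD⟩ := D
  -- Both sides are linear in D, so only velocities of curves need checking, and for them the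
  -- identity is the product rule at ε = 0.
  induction hD using Submodule.span_induction with
  | mem D h =>
    obtain ⟨c, hc, h0, h⟩ := h
    simp only [h]
    rw [← h0]
    have := deriv_mul (differentiableAt_curve f hc 0) (differentiableAt_curve g hc 0)
    refine Eq.trans this ?_
    ring
  | zero => simp
  | add D D' _ _ h h' =>
    simp only [LinearMap.add_apply] at *
    rw [h, h']; ring
  | smul a D _ h =>
    simp only [LinearMap.smul_apply, smul_eq_mul] at *
    rw [h]; ring

variable (K : SmoothGraph Ob Ar)

/-- The function `a ∘ t` on `B_p`. -/
def tgtPull (p : ℕ) (a : smoothFun Ob) : smoothFun (Simplex K.toUnitalGraph p) :=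
  ⟨fun b => a.1 (b.vert 0), fun n _ hb => a.2 n _ ((Simplex.isPlot_iff.1 hb).1 0)⟩

lemma R_add_left {p : ℕ} (χ χ' : Sec K.toUnitalGraph)
    (f : smoothFun (Simplex K.toUnitalGraph (p + 1))) : R K (χ + χ') f = R K χ f + R K χ' f := rfl

lemma R_smul_left {p : ℕ} (a : smoothFun Ob) (χ : Sec K.toUnitalGraph)
    (f : smoothFun (Simplex K.toUnitalGraph (p + 1))) :
    R K (a • χ) f = tgtPull K p a * R K χ f := rfl

lemma R_add_right {p : ℕ} (χ : Sec K.toUnitalGraph)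
    (f g : smoothFun (Simplex K.toUnitalGraph (p + 1))) : R K χ (f + g) = R K χ f + R K χ g :=
  Subtype.ext <| funext fun b => map_add (χ.1 (b.vert 0)).1 (restrictFirst K f b)
    (restrictFirst K g b)

lemma R_smul_right {p : ℕ} (χ : Sec K.toUnitalGraph) (r : ℝ)
    (f : smoothFun (Simplex K.toUnitalGraph (p + 1))) : R K χ (r • f) = r • R K χ f :=
  Subtype.ext <| funext fun b => map_smul (χ.1 (b.vert 0)).1 r (restrictFirst K f b)

variable {K}

lemma Simplex.isDegenerate_deg {S : UnitalGraph Ob Ar} {p : ℕ} (b : Simplex S p) :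
    b.deg.IsDegenerate :=
  ⟨0, by simp [Simplex.deg, Simplex.cons, SrcFibre.one]⟩

lemma Simplex.IsDegenerate.cons {S : UnitalGraph Ob Ar} {p : ℕ} {b : Simplex S p}
    (hb : b.IsDegenerate) (h : SrcFibre S (b.vert 0)) {x : Ob} (hx : S.tgt h.1 = x) :
    (b.cons h hx).IsDegenerate := by
  obtain ⟨i, hi⟩ := hb
  exact ⟨i.succ, by simpa [Simplex.cons] using hi⟩

/-- Prefixing an arrow keeps a degenerate simplex degenerate, so the function being differentiated
is identically zero. Normalization therefore survives iteration of R. -/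
lemma IsNormalized.R {p : ℕ} {f : smoothFun (Simplex K.toUnitalGraph (p + 1))}
    (hf : IsNormalized f) (χ : Sec K.toUnitalGraph) : IsNormalized (R K χ f) := by
  intro b hb
  have : restrictFirst K f b = 0 := Subtype.ext <| funext fun h => hf _ (hb.cons h rfl)
  change (χ.1 (b.vert 0)).1 (restrictFirst K f b) = 0
  rw [this, map_zero]

/-- The two sides name the leading vertex differently, as t(1_x) and as x; these are equal but not
by definition. -/
lemma Simplex.cons_one {S : UnitalGraph Ob Ar} {p : ℕ} (b : Simplex S p) :
    b.cons (SrcFibre.one S (b.vert 0)) rfl = b.deg := by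
  have key : ∀ x (hx : S.tgt (SrcFibre.one S (b.vert 0)).1 = x),
      b.cons (SrcFibre.one S (b.vert 0)) rfl = b.cons (SrcFibre.one S (b.vert 0)) hx := by
    rintro _ rfl; rfl
  exact key _ _

/-- By the Leibniz rule the error term is the derivative of a ∘ t times the value of f at (1, g₁, …,
g_p), and the latter vanishes for normalized f. This is where normalization makes `VE` linear over
functions. -/
lemma R_tgtPull_mul {p : ℕ} {f : smoothFun (Simplex K.toUnitalGraph (p + 1))}
    (hf : IsNormalized f) (χ : Sec K.toUnitalGraph) (a : smoothFun Ob) :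
    R K χ (tgtPull K (p + 1) a * f) = tgtPull K p a * R K χ f := by
  refine Subtype.ext <| funext fun b => ?_
  have h := algFibre_mul (χ.1 (b.vert 0)) (restrictFirst K (tgtPull K (p + 1) a) b)
    (restrictFirst K f b)
  have h0 : (restrictFirst K f b).1 (SrcFibre.one K.toUnitalGraph (b.vert 0)) = 0 := by
    change f.1 (b.cons (SrcFibre.one K.toUnitalGraph (b.vert 0)) rfl) = 0
    rw [Simplex.cons_one]
    exact hf _ b.isDegenerate_deg
  rw [h0, zero_mul, add_zero] at h
  refine Eq.trans h ?_
  have h1 : (restrictFirst K (tgtPull K (p + 1) a) b).1 (SrcFibre.one K.toUnitalGraph (b.vert 0))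
      = a.1 (b.vert 0) := congrArg a.1 (K.tgt_unit _)
  rw [h1]
  rfl

/-! ### Multilinearity of the Van Est map -/

lemma iterR_add_right {p : ℕ} (χ : Fin p → Sec K.toUnitalGraph)
    (f g : smoothFun (Simplex K.toUnitalGraph p)) :
    iterR K χ (f + g) = iterR K χ f + iterR K χ g := by
  induction p with
  | zero => rfl
  | succ p ih => simp only [iterR]; rw [R_add_right, ih]

lemma iterR_smul_right {p : ℕ} (χ : Fin p → Sec K.toUnitalGraph) (r : ℝ)
    (f : smoothFun (Simplex K.toUnitalGraph p)) : iterR K χ (r • f) = r • iterR K χ f := by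
  induction p with
  | zero => rfl
  | succ p ih => simp only [iterR]; rw [R_smul_right, ih]

lemma iterR_zero_right {p : ℕ} (χ : Fin p → Sec K.toUnitalGraph) : iterR K χ 0 = 0 := by
  simpa using iterR_smul_right χ 0 0

lemma iterR_tgtPull_mul {p : ℕ} (χ : Fin p → Sec K.toUnitalGraph) (a : smoothFun Ob)
    {f : smoothFun (Simplex K.toUnitalGraph p)} (hf : IsNormalized f) :
    iterR K χ (tgtPull K p a * f) = tgtPull K 0 a * iterR K χ f := by
  induction p with
  | zero => rfl
  | succ p ih => simp only [iterR]; rw [R_tgtPull_mul hf, ih _ (hf.R _)]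

lemma iterR_update_add {p : ℕ} (χ : Fin p → Sec K.toUnitalGraph) (i : Fin p)
    (a b : Sec K.toUnitalGraph) (f : smoothFun (Simplex K.toUnitalGraph p)) :
    iterR K (Function.update χ i (a + b)) f =
      iterR K (Function.update χ i a) f + iterR K (Function.update χ i b) f := by
  induction p with
  | zero => exact i.elim0
  | succ p ih =>
    induction i using Fin.lastCases with
    | last =>
      simp only [iterR, Function.update_self]
      have h : ∀ c, (fun i : Fin p => Function.update χ (Fin.last p) c i.castSucc) =
          fun i => χ i.castSucc := fun c => Fin.init_update_last (q := χ) (z := c)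
      rw [h, h, h, R_add_left, iterR_add_right]
    | cast i =>
      have h : ∀ c, (fun j : Fin p => Function.update χ i.castSucc c j.castSucc) =
          Function.update (fun j : Fin p => χ j.castSucc) i c :=
        fun c => Fin.init_update_castSucc (q := χ) (i := i) (y := c)
      simp only [iterR, Function.update_of_ne (Fin.castSucc_lt_last i).ne']
      rw [h, h, h, ih]

/-- The coefficient leaves the operator of its own position as a factor a ∘ t, then passes every
operator to the left of it, since the functions these act on are still normalized. -/
lemma iterR_update_smul {p : ℕ} (χ : Fin p → Sec K.toUnitalGraph) (i : Fin p)
    (a : smoothFun Ob) (b : Sec K.toUnitalGraph) {f : smoothFun (Simplex K.toUnitalGraph p)}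
    (hf : IsNormalized f) :
    iterR K (Function.update χ i (a • b)) f =
      tgtPull K 0 a * iterR K (Function.update χ i b) f := by
  induction p with
  | zero => exact i.elim0
  | succ p ih =>
    induction i using Fin.lastCases with
    | last =>
      simp only [iterR, Function.update_self]
      have h : ∀ c, (fun i : Fin p => Function.update χ (Fin.last p) c i.castSucc) =
          fun i => χ i.castSucc := fun c => Fin.init_update_last (q := χ) (z := c)
      rw [h, h, R_smul_left, iterR_tgtPull_mul _ _ (hf.R _)]
    | cast i =>
      have h : ∀ c, (fun j : Fin p => Function.update χ i.castSucc c j.castSucc) =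
          Function.update (fun j : Fin p => χ j.castSucc) i c :=
        fun c => Fin.init_update_castSucc (q := χ) (i := i) (y := c)
      simp only [iterR, Function.update_of_ne (Fin.castSucc_lt_last i).ne']
      rw [h, h, ih _ _ (hf.R _)]

/-- `(χ₁, …, χ_p) ↦ R_{χ₁} ⋯ R_{χ_p} f` as a multilinear map, for normalized `f`. -/
def iterRMultilinear {p : ℕ} (f : smoothFun (Simplex K.toUnitalGraph p)) (hf : IsNormalized f) :
    MultilinearMap (smoothFun Ob) (fun _ : Fin p => Sec K.toUnitalGraph) (smoothFun Ob) where
  toFun χ := onObjects K (iterR K χ f)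
  map_update_add' {inst} χ i a b := by
    rw [Subsingleton.elim inst fun a b => instDecidableEqFin p a b, iterR_update_add]; rfl
  map_update_smul' {inst} χ i a b := by
    rw [Subsingleton.elim inst fun a b => instDecidableEqFin p a b, iterR_update_smul _ _ _ _ hf]
    rfl

/-- The Van Est map of a normalized function as an alternating map. -/
def VEAlt {p : ℕ} (f : smoothFun (Simplex K.toUnitalGraph p)) (hf : IsNormalized f) :
    (Sec K.toUnitalGraph) [⋀^Fin p]→ₗ[smoothFun Ob] (smoothFun Ob) :=
  MultilinearMap.alternatization (iterRMultilinear f hf)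

lemma coe_VEAlt {p : ℕ} (f : smoothFun (Simplex K.toUnitalGraph p)) (hf : IsNormalized f) :
    ⇑(VEAlt f hf) = VE K f := by
  funext χ
  rw [VEAlt, MultilinearMap.alternatization_apply, VE]
  rfl

lemma isCEForm_VE {p : ℕ} {f : smoothFun (Simplex K.toUnitalGraph p)} (hf : IsNormalized f) :
    IsCEForm (VE K f) := ⟨VEAlt f hf, coe_VEAlt f hf⟩

/-! ### Equivariance of the Van Est map -/

/-- The pull-back of functions by `B_p φ`. -/
def Endo.pull (φ : Endo K) {p : ℕ} (f : smoothFun (Simplex K.toUnitalGraph p)) :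
    smoothFun (Simplex K.toUnitalGraph p) :=
  ⟨fun b => f.1 (φ.simplex b), fun n b hb => by
    rw [Simplex.isPlot_iff] at hb
    exact f.2 n (fun y => φ.simplex (b y)) (Simplex.isPlot_iff.2
      ⟨fun i => φ.obj_smooth n _ (hb.1 i), fun i => φ.arr_smooth n _ (hb.2 i)⟩)⟩

lemma Endo.simplex_cons (φ : Endo K) {p : ℕ} (b : Simplex K.toUnitalGraph p)
    (h : SrcFibre K.toUnitalGraph (b.vert 0)) :
    φ.simplex (b.cons h rfl) = (φ.simplex b).cons
      ⟨φ.arr h.1, by rw [φ.src_arr, h.2]; rfl⟩ rfl := by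
  have hv : (φ.simplex (b.cons h rfl)).vert = ((φ.simplex b).cons
      ⟨φ.arr h.1, by rw [φ.src_arr, h.2]; rfl⟩ rfl).vert := by
    funext i
    refine Fin.cases ?_ (fun j => ?_) i
    · simp [Endo.simplex, Simplex.cons, φ.tgt_arr]
    · simp [Endo.simplex, Simplex.cons]
  have ha : (φ.simplex (b.cons h rfl)).arr = ((φ.simplex b).cons
      ⟨φ.arr h.1, by rw [φ.src_arr, h.2]; rfl⟩ rfl).arr := by
    funext i
    refine Fin.cases ?_ (fun j => ?_) i
    · simp [Endo.simplex, Simplex.cons]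
    · simp [Endo.simplex, Simplex.cons]
  -- With the vertices and arrows identified, only propositional fields remain; generalizing both
  -- simplices removes the dependence on how they were built.
  generalize φ.simplex (b.cons h rfl) = s at hv ha
  generalize (φ.simplex b).cons ⟨φ.arr h.1, by rw [φ.src_arr, h.2]; rfl⟩ rfl = s' at hv ha
  cases s; cases s'
  dsimp only at hv ha
  subst hv ha
  rfl

/-- Naturality of R: B_pφ commutes with prefixing an arrow, so relatedness transfers the derivative
from the source fibre at φ(x) to the one at x. -/
lemma Endo.Related.pull_R {φ : Endo K} {χ χ' : Sec K.toUnitalGraph} (h : φ.Related χ χ') {p : ℕ}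
    (f : smoothFun (Simplex K.toUnitalGraph (p + 1))) :
    φ.pull (R K χ' f) = R K χ (φ.pull f) := by
  refine Subtype.ext <| funext fun b => ?_
  refine (h (b.vert 0) (restrictFirst K f (φ.simplex b))).trans ?_
  refine congrArg (χ.1 (b.vert 0)).1 (Subtype.ext <| funext fun k => ?_)
  exact congrArg f.1 (φ.simplex_cons b k).symm

lemma Endo.pull_iterR {φ : Endo K} {p : ℕ} {χ χ' : Fin p → Sec K.toUnitalGraph}
    (h : ∀ i, φ.Related (χ i) (χ' i)) (f : smoothFun (Simplex K.toUnitalGraph p)) :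
    φ.pull (iterR K χ' f) = iterR K χ (φ.pull f) := by
  induction p with
  | zero => rfl
  | succ p ih =>
    simp only [iterR]
    rw [ih fun i => h i.castSucc, (h (Fin.last p)).pull_R]

lemma coe_VE {p : ℕ} (f : smoothFun (Simplex K.toUnitalGraph p)) (χ : Fin p → Sec K.toUnitalGraph)
    (x : Ob) : (VE K f χ).1 x = ∑ σ : Equiv.Perm (Fin p),
      ((Equiv.Perm.sign σ : ℤ) : ℝ) * (iterR K (fun i => χ (σ i)) f).1 (Simplex.pt _ x) := by
  have h : ∀ (s : Finset (Equiv.Perm (Fin p))) (g : Equiv.Perm (Fin p) → smoothFun Ob),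
      (∑ σ ∈ s, (Equiv.Perm.sign σ : ℤ) • g σ).1 x =
        ∑ σ ∈ s, ((Equiv.Perm.sign σ : ℤ) : ℝ) * (g σ).1 x := fun s g => by
    rw [AddSubmonoidClass.coe_finsetSum, Finset.sum_apply]
    refine Finset.sum_congr rfl fun σ _ => ?_
    change ((Equiv.Perm.sign σ : ℤ) • (g σ).1 x) = _
    rw [zsmul_eq_mul]
  exact h _ _

/-- Naturality replaces the χ' by the χ and f by its pull-back r f, and r leaves by linearity.
Taking r = λ^{q+1}, sgn(σ) and 0 gives the three conditions on exterior forms. -/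
lemma Endo.pullEq_VE {φ : Endo K} {p : ℕ} {r : ℝ} {f : smoothFun (Simplex K.toUnitalGraph p)}
    (hf : ∀ b, f.1 (φ.simplex b) = r * f.1 b) : φ.PullEq r (VE K f) := by
  intro χ χ' h x
  rw [coe_VE, coe_VE, Finset.mul_sum]
  refine Finset.sum_congr rfl fun σ _ => ?_
  have h1 := Endo.pull_iterR (fun i => h (σ i)) f
  have h2 : φ.pull f = r • f := Subtype.ext <| funext hf
  rw [h2, iterR_smul_right] at h1
  have h3 := congrArg (fun g => g.1 (Simplex.pt _ x)) h1
  have h4 : φ.simplex (Simplex.pt K.toUnitalGraph x) = Simplex.pt K.toUnitalGraph (φ.obj x) := by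
    simp only [Endo.simplex, Simplex.pt, Simplex.mk.injEq, true_and]
    funext i; exact i.elim0
  change (iterR K (fun i => χ' (σ i)) f).1 (φ.simplex (Simplex.pt _ x)) =
    r * (iterR K (fun i => χ (σ i)) f).1 (Simplex.pt _ x) at h3
  rw [h4] at h3
  rw [h3]; ring

end Graph

variable {EM M EG G F : Type*}
  [NormedAddCommGroup EM] [NormedSpace ℝ EM] [FiniteDimensional ℝ EM]
  [TopologicalSpace M] [ChartedSpace EM M] [IsManifold 𝓘(ℝ, EM) ∞ M] [T2Space M]
  [NormedAddCommGroup EG] [NormedSpace ℝ EG] [FiniteDimensional ℝ EG]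
  [TopologicalSpace G] [ChartedSpace EG G] [IsManifold 𝓘(ℝ, EG) ∞ G] [T2Space G]
  [NormedAddCommGroup F] [NormedSpace ℝ F] [FiniteDimensional ℝ F]
  {C : M → Type*} [TopologicalSpace (TotalSpace F C)]
  [∀ x, AddCommGroup (C x)] [∀ x, Module ℝ (C x)] [∀ x, TopologicalSpace (C x)]
  [FiberBundle F C] [VectorBundle ℝ F C] [ContMDiffVectorBundle ∞ F C 𝓘(ℝ, EM)]
  {𝒢 : LieGroupoid EM M EG G} {q : ℕ}

/-! ### The functions `𝔉_θ` -/

/-- Scalings, permutations and zero slots are all `fibrewise` maps over the identity of the nerve of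
`𝒢`, so one application of multilinearity of θ treats them together. -/
lemma frakFun_fibrewise (ρ : Representation F C 𝒢) {p : ℕ} (θ : Form F C 𝒢 p q)
    (a : Fin q → ℝ) (τ : Fin q → Fin q) (c : ℝ) (b : Simplex (big q ρ).toUnitalGraph p) :
    frakFun ρ θ.1 ((fibrewise ρ a τ c).simplex b) =
      c * (∏ j, a j) * (b.vert 0).cov (θ.1 (baseSimplex b) fun j => tanVec b (τ j)) := by
  have h1 : frakFun ρ θ.1 ((fibrewise ρ a τ c).simplex b) =
      c * (b.vert 0).cov (θ.1 (baseSimplex b) fun j => a j • tanVec b (τ j)) := rfl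
  obtain ⟨A, hA⟩ := θ.2.1 (baseSimplex b)
  rw [h1, ← hA, A.map_smul_univ, mul_assoc]
  congr 1
  exact map_smul (b.vert 0).cov _ _

lemma isExtFun_frak (ρ : Representation F C 𝒢) {p : ℕ} (θ : Form F C 𝒢 p q) :
    IsExtFun ρ (frak ρ θ) := by
  refine ⟨fun r _ b => ?_, fun σ b => ?_, fun i b => ?_⟩
  · refine (frakFun_fibrewise ρ θ _ _ _ b).trans ?_
    simp only [Finset.prod_const, Finset.card_univ, Fintype.card_fin, id]
    rw [pow_succ']
    rfl
  · refine (frakFun_fibrewise ρ θ _ _ _ b).trans ?_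
    obtain ⟨A, hA⟩ := θ.2.1 (baseSimplex b)
    have h := A.map_perm (tanVec b) σ
    simp only [Finset.prod_const_one, mul_one, one_mul]
    rw [← hA]
    refine (congrArg (b.vert 0).cov h).trans ?_
    have h2 : ((Equiv.Perm.sign σ) • A (tanVec b)) =
        ((Equiv.Perm.sign σ : ℤ) : ℝ) • A (tanVec b) := by
      rw [Units.smul_def, ← Int.cast_smul_eq_zsmul ℝ]
    rw [h2]
    refine (map_smul (b.vert 0).cov _ _).trans ?_
    rw [hA]
    rfl
  · cases i with
    | none =>
      refine (frakFun_fibrewise ρ θ _ _ _ b).trans ?_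
      simp
    | some i =>
      refine (frakFun_fibrewise ρ θ _ _ _ b).trans ?_
      rw [Finset.prod_eq_zero (Finset.mem_univ i) (by simp)]
      simp

/-- A unit of `𝔾_q` lies over a unit of `𝒢` and its tangent vectors are images under T1, which are
the two conditions describing the image of the tangent map of a degeneracy. -/
lemma isNormalized_frak (ρ : Representation F C 𝒢) {p : ℕ} {θ : Form F C 𝒢 p q}
    (hθ : θ.1.IsNormalized) : IsNormalized (frak ρ θ) := by
  rintro b ⟨i, hi⟩
  have h := hθ (baseSimplex b) (tanVec b) i (congrArg BigArr.arr hi) fun j => by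
    exact congrFun (eq_of_heq (by rw [hi] : HEq (b.arr i).vec
      ((big q ρ).unit (b.vert i.succ)).vec)) j
  change (b.vert 0).cov (θ.1 (baseSimplex b) (tanVec b)) = 0
  rw [h]
  exact map_zero _

lemma isExtForm_VE_frak (ρ : Representation F C 𝒢) {p : ℕ} {θ : Form F C 𝒢 p q}
    (hθ : θ.1.IsNormalized) : IsExtForm ρ (VE (big q ρ) (frak ρ θ)) := by
  have h := isExtFun_frak ρ θ
  exact ⟨isCEForm_VE (isNormalized_frak ρ hθ), fun r hr => Endo.pullEq_VE (h.1 r hr),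
    fun σ => Endo.pullEq_VE (h.2.1 σ),
    fun i => Endo.pullEq_VE fun b => (h.2.2 i b).trans (zero_mul _).symm⟩

/-! ### Localization of smooth families -/

/-- Near a given point, the identity extends to a smooth map into a given neighbourhood. -/
lemma exists_cutoff {E : Type*} [NormedAddCommGroup E] [NormedSpace ℝ E] [FiniteDimensional ℝ E]
    {y₀ : E} {U : Set E} (hU : U ∈ 𝓝 y₀) :
    ∃ β : E → E, ContDiff ℝ ∞ β ∧ (∀ y, β y ∈ U) ∧ ∀ᶠ y in 𝓝 y₀, β y = y := by
  obtain ⟨r, hr, hrU⟩ := Metric.mem_nhds_iff.1 hU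
  -- For β(y) = y₀ + f(y)(y - y₀), the bound |f| ≤ 1 gives |β(y) - y₀| < r/2 on the ball of radius
  -- r/2, outside which f = 0 and β = y₀; near y₀ one has f = 1 and β(y) = y.
  let f : ContDiffBump y₀ := ⟨r / 4, r / 2, by positivity, by linarith⟩
  refine ⟨fun y => y₀ + f y • (y - y₀), ?_, fun y => hrU ?_, ?_⟩
  · exact contDiff_const.add (f.contDiff.smul (contDiff_id.sub contDiff_const))
  · rw [Metric.mem_ball, dist_eq_norm, add_sub_cancel_left, norm_smul]
    by_cases hy : y ∈ Metric.ball y₀ (r / 2)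
    · have h1 : ‖f y‖ ≤ 1 := by
        rw [Real.norm_of_nonneg f.nonneg]; exact f.le_one
      rw [Metric.mem_ball, dist_eq_norm] at hy
      nlinarith [norm_nonneg (y - y₀), norm_nonneg (f y)]
    · rw [f.zero_of_le_dist (by simpa using hy)]
      simpa using hr
  · filter_upwards [f.eventuallyEq_one] with y hy
    simp only [hy, Pi.one_apply, one_smul, add_sub_cancel]

lemma ContMDiff.comp_contDiff {E H N : Type*} [NormedAddCommGroup E] [NormedSpace ℝ E]
    [TopologicalSpace H] {I : ModelWithCorners ℝ E H} [TopologicalSpace N] [ChartedSpace H N]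
    {E₁ E₂ : Type*} [NormedAddCommGroup E₁] [NormedSpace ℝ E₁] [NormedAddCommGroup E₂]
    [NormedSpace ℝ E₂] {f : E₁ → N} (hf : ContMDiff 𝓘(ℝ, E₁) I ∞ f) {g : E₂ → E₁}
    (hg : ContDiff ℝ ∞ g) : ContMDiff 𝓘(ℝ, E₂) I ∞ fun y => f (g y) :=
  ContMDiff.comp hf hg.contMDiff

lemma Representation.act_smooth_family (ρ : Representation F C 𝒢) {n : ℕ}
    {k : EuclideanSpace ℝ (Fin n) → G} {a b : EuclideanSpace ℝ (Fin n) → M}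
    (ha : ∀ y, 𝒢.src (k y) = a y) (hb : ∀ y, 𝒢.tgt (k y) = b y) {c : ∀ y, C (a y)}
    (hk : ContMDiff (𝓡 n) 𝓘(ℝ, EG) ∞ k)
    (hc : ContMDiff (𝓡 n) (𝓘(ℝ, EM).prod 𝓘(ℝ, F)) ∞ fun y => (⟨a y, c y⟩ : TotalSpace F C)) :
    ContMDiff (𝓡 n) (𝓘(ℝ, EM).prod 𝓘(ℝ, F)) ∞
      fun y => (⟨b y, ρ.act (k y) (ha y) (hb y) (c y)⟩ : TotalSpace F C) := by
  obtain rfl : (fun y => 𝒢.src (k y)) = a := funext ha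
  obtain rfl : (fun y => 𝒢.tgt (k y)) = b := funext hb
  exact ρ.act_smooth n k c hk hc

/-- Evaluation of a smooth family of covectors on a smooth family of vectors. -/
lemma contDiff_dvec_apply {n : ℕ} {b : EuclideanSpace ℝ (Fin n) → M} {η : ∀ y, C (b y) →L[ℝ] ℝ}
    {c : ∀ y, C (b y)}
    (hη : ContMDiff (𝓡 n) (𝓘(ℝ, EM).prod 𝓘(ℝ, F →L[ℝ] ℝ)) ∞ fun y => dvec F (b y) (η y))
    (hc : ContMDiff (𝓡 n) (𝓘(ℝ, EM).prod 𝓘(ℝ, F)) ∞ fun y => (⟨b y, c y⟩ : TotalSpace F C)) :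
    ContDiff ℝ ∞ fun y => η y (c y) := by
  rw [← contMDiff_iff_contDiff]
  have h := ContMDiff.clm_bundle_apply (IB := 𝓘(ℝ, EM)) (F₁ := F) (F₂ := ℝ) (E₁ := C)
    (E₂ := Bundle.Trivial M ℝ) (b := b) (ϕ := η) hη hc
  intro y
  exact ((Bundle.contMDiffAt_totalSpace ..).1 (h y)).2

/-- A family of covectors is smooth if it is smooth on smooth families of vectors. -/
lemma contMDiff_dvec_of_apply {n : ℕ} {a : EuclideanSpace ℝ (Fin n) → M}
    {η : ∀ y, C (a y) →L[ℝ] ℝ} (ha : ContMDiff (𝓡 n) 𝓘(ℝ, EM) ∞ a)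
    (h : ∀ (β : EuclideanSpace ℝ (Fin n) → EuclideanSpace ℝ (Fin n)) (c : ∀ y, C (a (β y))),
      ContDiff ℝ ∞ β →
      ContMDiff (𝓡 n) (𝓘(ℝ, EM).prod 𝓘(ℝ, F)) ∞ (fun y => (⟨a (β y), c y⟩ : TotalSpace F C)) →
      ContDiff ℝ ∞ fun y => η (β y) (c y)) :
    ContMDiff (𝓡 n) (𝓘(ℝ, EM).prod 𝓘(ℝ, F →L[ℝ] ℝ)) ∞ fun y => dvec F (a y) (η y) := by
  intro y₀
  refine (contMDiffAt_hom_bundle (F₁ := F) (E₁ := C) (F₂ := ℝ) (E₂ := Bundle.Trivial M ℝ)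
    (IB := 𝓘(ℝ, EM)) (fun y => dvec F (a y) (η y))).2 ⟨ha y₀, ?_⟩
  let e := trivializationAt F C (a y₀)
  have hU : a ⁻¹' e.baseSet ∈ 𝓝 y₀ := ha.continuous.continuousAt.preimage_mem_nhds
    (e.open_baseSet.mem_nhds (mem_baseSet_trivializationAt F C (a y₀)))
  -- Coordinates of η are its values on the local frame of the trivialization at a(y₀), which is
  -- smooth only over the base set. Composing with β keeps the parameters there and changes nothing
  -- near y₀.
  obtain ⟨β, hβ, hβU, hβe⟩ := exists_cutoff hU
  have key : ContDiff ℝ ∞ fun y => ContinuousLinearMap.inCoordinates F C ℝ (Bundle.Trivial M ℝ)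
      (a y₀) (a (β y)) (a y₀) (a (β y)) (η (β y)) := by
    rw [contDiff_clm_apply_iff]
    intro v
    have h1 := h β (fun y => e.symm (a (β y)) v) hβ (by
      have h2 : ContMDiff (𝓡 n) (𝓘(ℝ, EM).prod 𝓘(ℝ, F)) ∞ fun y => (a (β y), v) :=
        (ContMDiff.comp_contDiff ha hβ).prodMk contMDiff_const
      have h3 := (Trivialization.contMDiffOn_symm (n := ∞) (IB := 𝓘(ℝ, EM)) e).comp_contMDiff h2
        fun y => by rw [e.mem_target]; exact hβU y
      refine h3.congr fun y => ?_
      exact (e.mk_symm (hβU y) v))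
    convert h1 using 2 with y
    simp [ContinuousLinearMap.inCoordinates, e, Trivialization.symmL_apply _ (hβU y)]
  refine (key.contMDiff.contMDiffAt).congr_of_eventuallyEq ?_
  filter_upwards [hβe] with y hy
  change ContinuousLinearMap.inCoordinates F C ℝ (Bundle.Trivial M ℝ)
      (a y₀) (a y) (a y₀) (a y) (η y) = _
  rw [hy]

/-- The action on covectors is smooth. -/
lemma Representation.contMDiff_dvec_act (ρ : Representation F C 𝒢) {n : ℕ}
    {k : EuclideanSpace ℝ (Fin n) → G} {a b : EuclideanSpace ℝ (Fin n) → M}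
    (ha : ∀ y, 𝒢.src (k y) = a y) (hb : ∀ y, 𝒢.tgt (k y) = b y) {η : ∀ y, C (b y) →L[ℝ] ℝ}
    (hk : ContMDiff (𝓡 n) 𝓘(ℝ, EG) ∞ k)
    (hη : ContMDiff (𝓡 n) (𝓘(ℝ, EM).prod 𝓘(ℝ, F →L[ℝ] ℝ)) ∞ fun y => dvec F (b y) (η y)) :
    ContMDiff (𝓡 n) (𝓘(ℝ, EM).prod 𝓘(ℝ, F →L[ℝ] ℝ)) ∞
      fun y => dvec F (a y) ((η y).comp (ρ.act (k y) (ha y) (hb y))) := by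
  have has : ContMDiff (𝓡 n) 𝓘(ℝ, EM) ∞ a := by
    obtain rfl : (fun y => 𝒢.src (k y)) = a := funext ha
    exact 𝒢.src_smooth.comp hk
  refine contMDiff_dvec_of_apply has fun β c hβ hc => ?_
  exact contDiff_dvec_apply (b := fun y => b (β y)) (η := fun y => η (β y))
    (ContMDiff.comp_contDiff hη hβ) (ρ.act_smooth_family (fun y => ha (β y)) (fun y => hb (β y))
      (ContMDiff.comp_contDiff hk hβ) hc)

/-- The tangent map of a smooth map on an open set. -/
lemma contMDiff_tvec_map_of_isOpen {E N E' N' : Type*} [NormedAddCommGroup E] [NormedSpace ℝ E]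
    [TopologicalSpace N] [ChartedSpace E N] [IsManifold 𝓘(ℝ, E) ∞ N]
    [NormedAddCommGroup E'] [NormedSpace ℝ E'] [TopologicalSpace N'] [ChartedSpace E' N']
    [IsManifold 𝓘(ℝ, E') ∞ N'] {f : N → N'} {U : Set N} (hU : IsOpen U)
    (hf : ContMDiffOn 𝓘(ℝ, E) 𝓘(ℝ, E') ∞ f U)
    {E₁ H₁ N₁ : Type*} [NormedAddCommGroup E₁] [NormedSpace ℝ E₁] [TopologicalSpace H₁]
    {I₁ : ModelWithCorners ℝ E₁ H₁} [TopologicalSpace N₁] [ChartedSpace H₁ N₁]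
    {x : N₁ → N} {v : N₁ → E} {s : Set N₁}
    (h : ContMDiffOn I₁ 𝓘(ℝ, E).tangent ∞ (fun y => tvec (x y) (v y)) s)
    (hx : ∀ y ∈ s, x y ∈ U) :
    ContMDiffOn I₁ 𝓘(ℝ, E').tangent ∞
      (fun y => tvec (f (x y)) ((mfderiv 𝓘(ℝ, E) 𝓘(ℝ, E') f (x y) : E →L[ℝ] E') (v y))) s := by
  have : IsManifold 𝓘(ℝ, E) 1 N := IsManifold.of_le (n := ∞) (by simp)
  have : IsManifold 𝓘(ℝ, E') 1 N' := IsManifold.of_le (n := ∞) (by simp)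
  have h1 := (hf.contMDiffOn_tangentMapWithin (m := ∞) (by simp) hU.uniqueMDiffOn).comp h
    (fun y hy => hx y hy)
  refine h1.congr fun y hy => ?_
  have h2 := tangentMapWithin_eq_tangentMap (I := 𝓘(ℝ, E)) (I' := 𝓘(ℝ, E')) (f := f)
    (p := tvec (x y) (v y)) (hU.uniqueMDiffOn _ (hx y hy))
    ((hf.contMDiffAt (hU.mem_nhds (hx y hy))).mdifferentiableAt (by simp))
  exact h2.symm

/-- A tangent vector of a product. -/
lemma contMDiff_tvec_prodMk {E N E' N' : Type*} [NormedAddCommGroup E] [NormedSpace ℝ E]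
    [TopologicalSpace N] [ChartedSpace E N] [IsManifold 𝓘(ℝ, E) ∞ N]
    [NormedAddCommGroup E'] [NormedSpace ℝ E'] [TopologicalSpace N'] [ChartedSpace E' N']
    [IsManifold 𝓘(ℝ, E') ∞ N']
    {E₁ H₁ N₁ : Type*} [NormedAddCommGroup E₁] [NormedSpace ℝ E₁] [TopologicalSpace H₁]
    {I₁ : ModelWithCorners ℝ E₁ H₁} [TopologicalSpace N₁] [ChartedSpace H₁ N₁]
    {x : N₁ → N} {v : N₁ → E} {x' : N₁ → N'} {v' : N₁ → E'}
    (h : ContMDiff I₁ 𝓘(ℝ, E).tangent ∞ fun y => tvec (x y) (v y))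
    (h' : ContMDiff I₁ 𝓘(ℝ, E').tangent ∞ fun y => tvec (x' y) (v' y)) :
    ContMDiff I₁ (𝓘(ℝ, E).prod 𝓘(ℝ, E')).tangent ∞
      fun y => (⟨(x y, x' y), (v y, v' y)⟩ : TangentBundle (𝓘(ℝ, E).prod 𝓘(ℝ, E')) (N × N')) := by
  have : IsManifold 𝓘(ℝ, E) 1 N := IsManifold.of_le (n := ∞) (by simp)
  have : IsManifold 𝓘(ℝ, E') 1 N' := IsManifold.of_le (n := ∞) (by simp)
  exact (contMDiff_equivTangentBundleProd_symm (I := 𝓘(ℝ, E)) (M := N) (I' := 𝓘(ℝ, E'))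
    (M' := N') (n := ∞)).comp (h.prodMk h')

/-- The tangent bundle of a vector space is trivialized by its identity chart, so chart expressions
of tangent vectors are smooth componentwise. -/
lemma contMDiff_tvec_vectorSpace {E : Type*} [NormedAddCommGroup E] [NormedSpace ℝ E]
    {E₁ H₁ N₁ : Type*} [NormedAddCommGroup E₁] [NormedSpace ℝ E₁] [TopologicalSpace H₁]
    {I₁ : ModelWithCorners ℝ E₁ H₁} [TopologicalSpace N₁] [ChartedSpace H₁ N₁] {x v : N₁ → E}
    {s : Set N₁} :
    ContMDiffOn I₁ 𝓘(ℝ, E).tangent ∞ (fun y => tvec (x y) (v y)) s ↔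
      ContMDiffOn I₁ 𝓘(ℝ, E) ∞ x s ∧ ContMDiffOn I₁ 𝓘(ℝ, E) ∞ v s := by
  have : ∀ y, ContMDiffWithinAt I₁ 𝓘(ℝ, E).tangent ∞ (fun y => tvec (x y) (v y)) s y ↔
      ContMDiffWithinAt I₁ 𝓘(ℝ, E) ∞ x s y ∧ ContMDiffWithinAt I₁ 𝓘(ℝ, E) ∞ v s y := fun y => by
    refine (Bundle.contMDiffWithinAt_totalSpace ..).trans ?_
    simp [tvec]
  exact ⟨fun h => ⟨fun y hy => ((this y).1 (h y hy)).1, fun y hy => ((this y).1 (h y hy)).2⟩,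
    fun h y hy => (this y).2 ⟨h.1 y hy, h.2 y hy⟩⟩

/-! ### Charts of `𝒢` adapted to the source map -/

/-- A chart `e` of `G` near `1_m`, with values in `EM × Z`, in which the source map is the first
projection with respect to a chart `c` of `M`. -/
structure SrcChart (𝒢 : LieGroupoid EM M EG G) (m : M) (Z : Type*) [NormedAddCommGroup Z]
    [NormedSpace ℝ Z] where
  e : OpenPartialHomeomorph G (EM × Z)
  c : OpenPartialHomeomorph M EM
  unit_mem : 𝒢.unit m ∈ e.source
  src_mem : ∀ g ∈ e.source, 𝒢.src g ∈ c.source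
  fst_e : ∀ g ∈ e.source, (e g).1 = c (𝒢.src g)
  e_smooth : ContMDiffOn 𝓘(ℝ, EG) 𝓘(ℝ, EM × Z) ∞ e e.source
  e_symm_smooth : ContMDiffOn 𝓘(ℝ, EM × Z) 𝓘(ℝ, EG) ∞ e.symm e.target
  c_smooth : ContMDiffOn 𝓘(ℝ, EM) 𝓘(ℝ, EM) ∞ c c.source
  c_symm_smooth : ContMDiffOn 𝓘(ℝ, EM) 𝓘(ℝ, EM) ∞ c.symm c.target

/-- This is the local normal form of the submersion s at 1_m, with the complement of EM identified
with a Euclidean space. -/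
lemma exists_srcChart (𝒢 : LieGroupoid EM M EG G) (m : M) :
    ∃ n : ℕ, Nonempty (SrcChart 𝒢 m (EuclideanSpace ℝ (Fin n))) := by
  have h := 𝒢.src_submersion.isSubmersionAt (𝒢.unit m)
  -- The complement is a quotient of EG through the splitting EG ≃ EM × complement.
  have hfin : FiniteDimensional ℝ h.complement :=
    FiniteDimensional.of_surjective
      ((LinearMap.snd ℝ EM h.complement).comp (h.equiv : EG →ₗ[ℝ] EM × h.complement))
      (Prod.snd_surjective.comp h.equiv.surjective)
  let L := h.equiv.trans
    ((ContinuousLinearEquiv.refl ℝ EM).prodCongr (toEuclidean (E := h.complement)))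
  refine ⟨Module.finrank ℝ h.complement, ⟨?_⟩⟩
  refine
    { e := h.domChart.transHomeomorph L.toHomeomorph
      c := h.codChart
      unit_mem := h.mem_domChart_source
      src_mem := fun g hg => h.source_subset_preimage_source hg
      fst_e := fun g hg => ?_
      e_smooth := ?_
      e_symm_smooth := ?_
      c_smooth := contMDiffOn_of_mem_maximalAtlas h.codChart_mem_maximalAtlas
      c_symm_smooth := contMDiffOn_symm_of_mem_maximalAtlas h.codChart_mem_maximalAtlas }
  · have h0 : h.domChart g ∈ (h.domChart.extend 𝓘(ℝ, EG)).target := by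
      simpa using h.domChart.map_source hg
    have h1 := h.writtenInCharts h0
    have h2 : h.domChart.symm (h.domChart g) = g := h.domChart.left_inv hg
    simp only [Function.comp_apply, OpenPartialHomeomorph.extend_coe, modelWithCornersSelf_coe, id,
      OpenPartialHomeomorph.extend_coe_symm, modelWithCornersSelf_coe_symm] at h1
    rw [h2] at h1
    exact h1.symm
  · exact L.contDiff.contMDiff.comp_contMDiffOn
      (contMDiffOn_of_mem_maximalAtlas h.domChart_mem_maximalAtlas)
  · refine (contMDiffOn_symm_of_mem_maximalAtlas h.domChart_mem_maximalAtlas).comp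
      L.symm.contDiff.contMDiff.contMDiffOn fun p hp => hp

namespace SrcChart

variable {m : M} {Z : Type*} [NormedAddCommGroup Z] [NormedSpace ℝ Z] (κ : SrcChart 𝒢 m Z)

/-- The differential of the chart. -/
def de (g : G) : EG →L[ℝ] EM × Z := mfderiv 𝓘(ℝ, EG) 𝓘(ℝ, EM × Z) κ.e g

/-- The differential of the inverse of the chart. -/
def deSymm (y : EM × Z) : EM × Z →L[ℝ] EG := mfderiv 𝓘(ℝ, EM × Z) 𝓘(ℝ, EG) κ.e.symm y

/-- The differential of the chart of the base. -/
def dc (x : M) : EM →L[ℝ] EM := mfderiv 𝓘(ℝ, EM) 𝓘(ℝ, EM) κ.c x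

variable {κ}

lemma hasMFDerivAt_e {g : G} (hg : g ∈ κ.e.source) :
    HasMFDerivAt 𝓘(ℝ, EG) 𝓘(ℝ, EM × Z) κ.e g (κ.de g) :=
  (((κ.e_smooth.contMDiffAt (κ.e.open_source.mem_nhds hg))).mdifferentiableAt
    (by simp)).hasMFDerivAt

lemma hasMFDerivAt_e_symm {y : EM × Z} (hy : y ∈ κ.e.target) :
    HasMFDerivAt 𝓘(ℝ, EM × Z) 𝓘(ℝ, EG) κ.e.symm y (κ.deSymm y) :=
  (((κ.e_symm_smooth.contMDiffAt (κ.e.open_target.mem_nhds hy))).mdifferentiableAt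
    (by simp)).hasMFDerivAt

lemma hasMFDerivAt_c {x : M} (hx : x ∈ κ.c.source) :
    HasMFDerivAt 𝓘(ℝ, EM) 𝓘(ℝ, EM) κ.c x (κ.dc x) :=
  (((κ.c_smooth.contMDiffAt (κ.c.open_source.mem_nhds hx))).mdifferentiableAt
    (by simp)).hasMFDerivAt

lemma hasMFDerivAt_src (g : G) : HasMFDerivAt 𝓘(ℝ, EG) 𝓘(ℝ, EM) 𝒢.src g (𝒢.dsrc g) :=
  (𝒢.src_smooth.mdifferentiableAt (by simp)).hasMFDerivAt

lemma deSymm_de {g : G} (hg : g ∈ κ.e.source) (v : EG) : κ.deSymm (κ.e g) (κ.de g v) = v := by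
  have h1 := (hasMFDerivAt_e_symm (κ.e.map_source hg)).comp g (hasMFDerivAt_e hg)
  have h2 : HasMFDerivAt 𝓘(ℝ, EG) 𝓘(ℝ, EG) (κ.e.symm ∘ κ.e) g
      (ContinuousLinearMap.id ℝ (TangentSpace 𝓘(ℝ, EG) g)) := by
    refine (hasMFDerivAt_id g).congr_of_eventuallyEq ?_
    filter_upwards [κ.e.open_source.mem_nhds hg] with z hz
    exact κ.e.left_inv hz
  exact congrArg (fun T : EG →L[ℝ] EG => T v) (hasMFDerivAt_unique h1 h2)

lemma de_deSymm {y : EM × Z} (hy : y ∈ κ.e.target) (v : EM × Z) :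
    κ.de (κ.e.symm y) (κ.deSymm y v) = v := by
  have h1 := (hasMFDerivAt_e (κ.e.map_target hy)).comp y (hasMFDerivAt_e_symm hy)
  have h2 : HasMFDerivAt 𝓘(ℝ, EM × Z) 𝓘(ℝ, EM × Z) (κ.e ∘ κ.e.symm) y
      (ContinuousLinearMap.id ℝ (TangentSpace 𝓘(ℝ, EM × Z) y)) := by
    refine (hasMFDerivAt_id y).congr_of_eventuallyEq ?_
    filter_upwards [κ.e.open_target.mem_nhds hy] with z hz
    exact κ.e.right_inv hz
  exact congrArg (fun T : EM × Z →L[ℝ] EM × Z => T v) (hasMFDerivAt_unique h1 h2)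

/-- Near g the first coordinate of the chart is c ∘ s; the identity is the derivative of this. -/
lemma fst_de {g : G} (hg : g ∈ κ.e.source) (v : EG) :
    (κ.de g v).1 = κ.dc (𝒢.src g) (𝒢.dsrc g v) := by
  have h1 := (hasMFDerivAt_c (κ.src_mem g hg)).comp g (hasMFDerivAt_src g)
  have h3 : HasMFDerivAt 𝓘(ℝ, EM × Z) 𝓘(ℝ, EM) Prod.fst (κ.e g)
      (ContinuousLinearMap.fst ℝ EM Z) := hasFDerivAt_fst.hasMFDerivAt
  have h2 := h3.comp g (hasMFDerivAt_e hg)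
  have h4 : HasMFDerivAt 𝓘(ℝ, EG) 𝓘(ℝ, EM) (Prod.fst ∘ κ.e) g
      ((κ.dc (𝒢.src g)).comp (𝒢.dsrc g)) := by
    refine h1.congr_of_eventuallyEq ?_
    filter_upwards [κ.e.open_source.mem_nhds hg] with z hz
    exact κ.fst_e z hz
  exact congrArg (fun T : EG →L[ℝ] EM => T v) (hasMFDerivAt_unique h2 h4)

lemma dc_injective {x : M} (hx : x ∈ κ.c.source) : Function.Injective (κ.dc x) := by
  have h0 : HasMFDerivAt 𝓘(ℝ, EM) 𝓘(ℝ, EM) κ.c.symm (κ.c x)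
      (mfderiv 𝓘(ℝ, EM) 𝓘(ℝ, EM) κ.c.symm (κ.c x)) :=
    (((κ.c_symm_smooth.contMDiffAt (κ.c.open_target.mem_nhds
      (κ.c.map_source hx)))).mdifferentiableAt (by simp)).hasMFDerivAt
  have h1 := h0.comp x (hasMFDerivAt_c hx)
  have h2 : HasMFDerivAt 𝓘(ℝ, EM) 𝓘(ℝ, EM) (κ.c.symm ∘ κ.c) x
      (ContinuousLinearMap.id ℝ (TangentSpace 𝓘(ℝ, EM) x)) := by
    refine (hasMFDerivAt_id x).congr_of_eventuallyEq ?_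
    filter_upwards [κ.c.open_source.mem_nhds hx] with z hz
    exact κ.c.left_inv hz
  intro v w hvw
  have h3 := hasMFDerivAt_unique h1 h2
  have h4 := fun v => congrArg (fun T : EM →L[ℝ] EM => T v) h3
  have hv : (mfderiv 𝓘(ℝ, EM) 𝓘(ℝ, EM) κ.c.symm (κ.c x) : EM →L[ℝ] EM) (κ.dc x v) = v := h4 v
  have hw : (mfderiv 𝓘(ℝ, EM) 𝓘(ℝ, EM) κ.c.symm (κ.c x) : EM →L[ℝ] EM) (κ.dc x w) = w := h4 w
  rw [← hv, ← hw, hvw]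

/-- The first coordinate determines the source because c is injective on its domain. So points and
tangent vectors of a source fibre are described by their Z-components. -/
lemma src_e_symm {y : EM × Z} (hy : y ∈ κ.e.target) {x : M} (hx : x ∈ κ.c.source)
    (h : y.1 = κ.c x) : 𝒢.src (κ.e.symm y) = x := by
  have h1 := κ.fst_e _ (κ.e.map_target hy)
  rw [κ.e.right_inv hy, h] at h1
  exact (κ.c.injOn hx (κ.src_mem _ (κ.e.map_target hy)) h1).symm

lemma dsrc_deSymm {y : EM × Z} (hy : y ∈ κ.e.target) {x : M} (hx : x ∈ κ.c.source)
    (h : y.1 = κ.c x) (v : EM) (w : Z) :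
    𝒢.dsrc (κ.e.symm y) (κ.deSymm y (κ.dc x v, w)) = v := by
  have h1 := fst_de (κ := κ) (κ.e.map_target hy) (κ.deSymm y (κ.dc x v, w))
  rw [de_deSymm hy, src_e_symm hy hx h] at h1
  exact (dc_injective hx h1).symm

variable (κ)

/-- The section `u` of the Lie algebroid in the chart. -/
def loc (u : M → EG) (x : M) : Z := (κ.de (𝒢.unit x) (u x)).2

variable {κ}

lemma isOpen_unit_preimage : IsOpen (𝒢.unit ⁻¹' κ.e.source) :=
  κ.e.open_source.preimage 𝒢.unit_smooth.continuous

lemma contMDiffOn_loc (u : Alg 𝒢) :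
    ContMDiffOn 𝓘(ℝ, EM) 𝓘(ℝ, Z) ∞ (κ.loc u.1) (𝒢.unit ⁻¹' κ.e.source) := by
  have h := contMDiff_tvec_map_of_isOpen κ.e.open_source κ.e_smooth
    (s := 𝒢.unit ⁻¹' κ.e.source) u.2.1.contMDiffOn (fun y hy => hy)
  have h2 := (contMDiff_tvec_vectorSpace.1 h).2
  exact contDiff_snd.contMDiff.comp_contMDiffOn h2

lemma de_unit_eq (u : Alg 𝒢) {x : M} (hx : 𝒢.unit x ∈ κ.e.source) :
    κ.de (𝒢.unit x) (u.1 x) = (0, κ.loc u.1 x) := by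
  refine Prod.ext ?_ rfl
  rw [fst_de hx, u.2.2 x, map_zero]

end SrcChart

/-! ### Existence of the flows -/

/-- No differential equation is solved: only the velocity at ε = 0 near m is prescribed. In a source
chart the family moves 1_x along a straight segment in the Z-direction, which keeps the source
fixed, by the amount g(ε) f(x) u(x), with f a bump function at m and g a cutoff of the identity of
ℝ. -/
lemma exists_srcFlow (u : Alg 𝒢) (m : M) : ∃ Φ : SrcFlow 𝒢, Φ.HasVelocity u m := by
  obtain ⟨n, ⟨κ⟩⟩ := exists_srcChart 𝒢 m
  set Z := EuclideanSpace ℝ (Fin n)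
  have hW₀ := κ.isOpen_unit_preimage
  have hm₀ : m ∈ 𝒢.unit ⁻¹' κ.e.source := κ.unit_mem
  -- a tube around the units contained in the chart
  have hcont : ContinuousAt (fun z : M × Z => κ.e (𝒢.unit z.1) + (0, z.2)) (m, 0) := by
    refine ContinuousAt.add ?_ (by fun_prop)
    have h1 : ContinuousAt κ.e (𝒢.unit m) := κ.e.continuousAt κ.unit_mem
    exact ContinuousAt.comp (f := fun z : M × Z => 𝒢.unit z.1) (x := (m, 0)) h1
      (𝒢.unit_smooth.continuous.comp continuous_fst).continuousAt
  have htube : ∀ᶠ z in 𝓝 ((m, 0) : M × Z), κ.e (𝒢.unit z.1) + (0, z.2) ∈ κ.e.target := by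
    refine hcont.preimage_mem_nhds (κ.e.open_target.mem_nhds ?_)
    have : κ.e (𝒢.unit m) + ((0 : EM), (0 : Z)) = κ.e (𝒢.unit m) := by
      ext <;> simp
    rw [this]
    exact κ.e.map_source κ.unit_mem
  rw [nhds_prod_eq] at htube
  obtain ⟨P, hP, Q, hQ, hPQ⟩ := Filter.eventually_prod_iff.1 htube
  -- For x near m, displacements of norm less than r stay inside the chart. On the set W below, the
  -- local expression of u has norm less than K, so |g| < r/K and |f| ≤ 1 keep every displacement
  -- below r, for all real ε.
  obtain ⟨r, hr, hrQ⟩ := Metric.eventually_nhds_iff.1 hQ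
  have hloc : ContinuousAt (κ.loc u.1) m :=
    ((SrcChart.contMDiffOn_loc (κ := κ) u).contMDiffAt (hW₀.mem_nhds hm₀)).continuousAt
  have hK : ∀ᶠ x in 𝓝 m, ‖κ.loc u.1 x‖ < ‖κ.loc u.1 m‖ + 1 :=
    hloc.norm.eventually_lt continuousAt_const (by linarith)
  obtain ⟨W, hW, hWo, hmW⟩ := eventually_nhds_iff.1 ((hP.and hK).and (hW₀.eventually_mem hm₀))
  obtain ⟨f, -, hf⟩ := (SmoothBumpFunction.nhds_basis_tsupport (I := 𝓘(ℝ, EM)) m).mem_iff.1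
    (hWo.mem_nhds hmW)
  set K := ‖κ.loc u.1 m‖ + 1 with hKdef
  have hKpos : 0 < K := by positivity
  obtain ⟨g, hg, hgU, hg0⟩ := exists_cutoff (y₀ := (0 : ℝ))
    (Metric.ball_mem_nhds (0 : ℝ) (div_pos hr hKpos))
  have hmem : ∀ x ∈ W, ∀ ε : ℝ,
      κ.e (𝒢.unit x) + (0, (g ε * f x) • κ.loc u.1 x) ∈ κ.e.target := by
    intro x hx ε
    refine hPQ (hW x hx).1.1 (hrQ ?_)
    rw [dist_zero_right, norm_smul, norm_mul]
    have h1 : ‖f x‖ ≤ 1 := by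
      rw [Real.norm_of_nonneg f.nonneg]; exact f.le_one
    have h2 : ‖g ε‖ < r / K := by simpa using hgU ε
    have h3 := (hW x hx).1.2
    have h5 : ‖g ε‖ * ‖f x‖ ≤ ‖g ε‖ := by nlinarith [norm_nonneg (g ε), norm_nonneg (f x)]
    calc ‖g ε‖ * ‖f x‖ * ‖κ.loc u.1 x‖ ≤ ‖g ε‖ * K := by
          gcongr
      _ < r / K * K := by gcongr
      _ = r := by field_simp
  classical
  let Φ : ℝ → M → G := fun ε x =>
    if x ∈ W then κ.e.symm (κ.e (𝒢.unit x) + (0, (g ε * f x) • κ.loc u.1 x)) else 𝒢.unit x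
  have hΦW : ∀ x ∈ W, ∀ ε, Φ ε x =
      κ.e.symm (κ.e (𝒢.unit x) + (0, (g ε * f x) • κ.loc u.1 x)) := fun x hx ε => if_pos hx
  have hΦ0 : ∀ x ε, g ε * f x = 0 → Φ ε x = 𝒢.unit x := by
    intro x ε h
    by_cases hx : x ∈ W
    · rw [hΦW x hx, h, zero_smul]
      have : κ.e (𝒢.unit x) + ((0 : EM), (0 : Z)) = κ.e (𝒢.unit x) := by
        ext <;> simp
      rw [this]
      exact κ.e.left_inv (hW x hx).2
    · exact if_neg hx
  have hg00 : g 0 = 0 := hg0.self_of_nhds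
  refine ⟨⟨Φ, ?_, ?_, ?_⟩, ?_⟩
  · rintro ⟨ε, x⟩
    by_cases hx : x ∈ W
    · have hWW : ContMDiffOn (𝓘(ℝ, ℝ).prod 𝓘(ℝ, EM)) 𝓘(ℝ, EG) ∞
          (fun z : ℝ × M => κ.e.symm (κ.e (𝒢.unit z.2) + (0, (g z.1 * f z.2) • κ.loc u.1 z.2)))
          (Prod.snd ⁻¹' W) := by
        refine κ.e_symm_smooth.comp (t := κ.e.target) ?_ fun z hz => hmem z.2 hz z.1
        refine ContMDiffOn.add ?_ ?_
        · exact κ.e_smooth.comp (𝒢.unit_smooth.comp contMDiff_snd).contMDiffOn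
            fun z hz => (hW z.2 hz).2
        · have h1 : ContMDiffOn (𝓘(ℝ, ℝ).prod 𝓘(ℝ, EM)) 𝓘(ℝ, Z) ∞
              (fun z : ℝ × M => (g z.1 * f z.2) • κ.loc u.1 z.2) (Prod.snd ⁻¹' W) := by
            have h2 : ContMDiffOn (𝓘(ℝ, ℝ).prod 𝓘(ℝ, EM)) 𝓘(ℝ, ℝ) ∞
                (fun z : ℝ × M => g z.1 * f z.2) (Prod.snd ⁻¹' W) :=
              ((hg.contMDiff.comp contMDiff_fst).mul (f.contMDiff.comp contMDiff_snd)).contMDiffOn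
            have h3 : ContMDiffOn (𝓘(ℝ, ℝ).prod 𝓘(ℝ, EM)) 𝓘(ℝ, Z) ∞
                (fun z : ℝ × M => κ.loc u.1 z.2) (Prod.snd ⁻¹' W) :=
              (SrcChart.contMDiffOn_loc (κ := κ) u).comp contMDiff_snd.contMDiffOn
                fun z hz => (hW z.2 hz).2
            exact h2.smul h3
          exact (ContinuousLinearMap.inr ℝ EM Z).contDiff.contMDiff.comp_contMDiffOn h1
      have hop : IsOpen (Prod.snd ⁻¹' W : Set (ℝ × M)) := hWo.preimage continuous_snd
      refine (hWW.contMDiffAt (hop.mem_nhds hx)).congr_of_eventuallyEq ?_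
      filter_upwards [hop.mem_nhds hx] with z hz
      exact hΦW _ hz _
    -- The support of f lies in W, so outside W the point is in the open complement of the support,
    -- where the family is constantly the unit.
    · have hx' : x ∈ (tsupport f)ᶜ := fun h => hx (hf h)
      have hop : IsOpen (Prod.snd ⁻¹' (tsupport f)ᶜ : Set (ℝ × M)) :=
        (isClosed_tsupport _).isOpen_compl.preimage continuous_snd
      refine ((𝒢.unit_smooth.comp contMDiff_snd).contMDiffAt).congr_of_eventuallyEq
        (f := 𝒢.unit ∘ Prod.snd) ?_
      filter_upwards [hop.mem_nhds hx'] with z hz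
      refine hΦ0 _ _ ?_
      rw [image_eq_zero_of_notMem_tsupport hz, mul_zero]
  · intro ε x
    by_cases hx : x ∈ W
    · rw [hΦW x hx]
      have hu := (hW x hx).2
      refine SrcChart.src_e_symm (hmem x hx ε) ?_ ?_
      · simpa [𝒢.src_unit] using κ.src_mem _ hu
      · simp [κ.fst_e _ hu, 𝒢.src_unit]
    · rw [show Φ ε x = 𝒢.unit x from if_neg hx, 𝒢.src_unit]
  · exact fun x => hΦ0 x 0 (by rw [hg00, zero_mul])
  · change ∀ᶠ x in 𝓝 m, _
    filter_upwards [hWo.mem_nhds hmW, f.eventuallyEq_one] with x hx hfx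
    have hu := (hW x hx).2
    have hd : HasDerivAt (fun ε : ℝ => κ.e (𝒢.unit x) + ((0 : EM), (g ε * f x) • κ.loc u.1 x))
        (0, κ.loc u.1 x) 0 := by
      have h1 : HasDerivAt g 1 0 := (hasDerivAt_id (0 : ℝ)).congr_of_eventuallyEq hg0
      have h2 : HasDerivAt (fun ε => (g ε * f x) • κ.loc u.1 x) (κ.loc u.1 x) 0 := by
        have := (h1.mul_const (f x)).smul_const (κ.loc u.1 x)
        simpa [hfx] using this
      exact ((hasDerivAt_const (0 : ℝ) (0 : EM)).prodMk h2).const_add _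
    have he : κ.e (𝒢.unit x) + ((0 : EM), (g 0 * f x) • κ.loc u.1 x) = κ.e (𝒢.unit x) := by
      ext <;> simp [hg00]
    have hs := SrcChart.hasMFDerivAt_e_symm (κ := κ) (hmem x hx 0)
    have hc := hs.comp (0 : ℝ) hd.hasFDerivAt.hasMFDerivAt
    have hc' : HasMFDerivAt 𝓘(ℝ, ℝ) 𝓘(ℝ, EG) (fun ε => Φ ε x) 0 _ :=
      hc.congr_of_eventuallyEq (Filter.Eventually.of_forall fun ε => hΦW x hx ε)
    rw [hc'.mfderiv]
    change κ.deSymm (κ.e (𝒢.unit x) + ((0 : EM), (g 0 * f x) • κ.loc u.1 x))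
      ((1 : ℝ) • ((0 : EM), κ.loc u.1 x)) = u.1 x
    rw [he, one_smul, ← SrcChart.de_unit_eq u hu, SrcChart.deSymm_de hu]

/-- The default branch of `flow` is never taken. The chosen family at m has the velocity of u on a
whole neighbourhood of m, hence also determines its first derivative there. -/
lemma flow_hasVelocity (u : Alg 𝒢) (m : M) : (flow u m).HasVelocity u m := by
  have h := exists_srcFlow u m
  rw [flow, dif_pos h]
  exact h.choose_spec

/-! ### Calculus -/

lemma contDiff_deriv_param {E V : Type*} [NormedAddCommGroup E] [NormedSpace ℝ E]
    [NormedAddCommGroup V] [NormedSpace ℝ V] {g : E × ℝ → V} (hg : ContDiff ℝ ∞ g) :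
    ContDiff ℝ ∞ fun y => deriv (fun ε => g (y, ε)) 0 := by
  have h1 : ∀ y, deriv (fun ε => g (y, ε)) 0 = fderiv ℝ g (y, 0) (0, 1) := fun y => by
    have h2 : HasDerivAt (fun ε : ℝ => (y, ε)) ((0 : E), (1 : ℝ)) 0 :=
      (hasDerivAt_const _ _).prodMk (hasDerivAt_id _)
    exact (((hg.differentiable (by simp)) (y, 0)).hasFDerivAt.comp_hasDerivAt (0 : ℝ) h2).deriv
  simp only [h1]
  exact ((hg.fderiv_right (m := ∞) (by simp)).comp
    (contDiff_id.prodMk contDiff_const)).clm_apply contDiff_const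

/-- Mixed partial derivatives commute. -/
lemma hasDerivAt_fderiv_snd {E V : Type*} [NormedAddCommGroup E] [NormedSpace ℝ E]
    [NormedAddCommGroup V] [NormedSpace ℝ V] {h : ℝ × E → V} {y₀ : E}
    (hh : ContDiffAt ℝ ∞ h (0, y₀)) (w : E) :
    HasDerivAt (fun ε => fderiv ℝ h (ε, y₀) (0, w))
      (fderiv ℝ (fun y => fderiv ℝ h (0, y) (1, 0)) y₀ w) 0 ∧
    DifferentiableAt ℝ (fun y => fderiv ℝ h (0, y) (1, 0)) y₀ := by
  have h1 : HasFDerivAt (fderiv ℝ h) (fderiv ℝ (fderiv ℝ h) (0, y₀)) (0, y₀) :=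
    ((hh.fderiv_right (m := 1) (by norm_cast)).differentiableAt (by simp)).hasFDerivAt
  have hsymm := hh.isSymmSndFDerivAt (by simp; norm_cast)
  have h2 : HasDerivAt (fun ε : ℝ => (ε, y₀)) ((1 : ℝ), (0 : E)) 0 :=
    (hasDerivAt_id _).prodMk (hasDerivAt_const _ _)
  have h3 : HasDerivAt (fun ε => fderiv ℝ h (ε, y₀) (0, w))
      (fderiv ℝ (fderiv ℝ h) (0, y₀) (1, 0) (0, w)) 0 := by
    have h4 := h1.comp_hasDerivAt (0 : ℝ) h2
    simpa using h4.clm_apply (hasDerivAt_const (0 : ℝ) ((0 : ℝ), w))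
  have h5 : HasFDerivAt (fun y : E => ((0 : ℝ), y)) (ContinuousLinearMap.inr ℝ ℝ E) y₀ :=
    (ContinuousLinearMap.inr ℝ ℝ E).hasFDerivAt
  have h6 := (HasFDerivAt.comp y₀ h1 h5).clm_apply
    (hasFDerivAt_const ((1 : ℝ), (0 : E)) y₀)
  refine ⟨?_, h6.differentiableAt⟩
  have h7 := h6.fderiv
  simp only [Function.comp_apply] at h7
  rw [h7]
  convert h3 using 1
  simpa using hsymm (0, w) (1, 0)

/-! ### Curves in the source fibres of `𝔾_q` -/

/-- The differential in x at fixed ε is a restriction of the tangent map of (ε, x) ↦ Φ_ε(x); in this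
form its smoothness jointly in ε, x and v is available. -/
lemma SrcFlow.tvec_d_eq (Φ : SrcFlow 𝒢) (ε : ℝ) (x : M) (v : EM) :
    tvec (Φ.toFun ε x) (Φ.d ε x v) =
      tangentMap (𝓘(ℝ, ℝ).prod 𝓘(ℝ, EM)) 𝓘(ℝ, EG) (fun z : ℝ × M => Φ.toFun z.1 z.2)
        ⟨(ε, x), ((0 : ℝ), v)⟩ := by
  have h1 : HasMFDerivAt (𝓘(ℝ, ℝ).prod 𝓘(ℝ, EM)) 𝓘(ℝ, EG)
      (fun z : ℝ × M => Φ.toFun z.1 z.2) (ε, x) _ :=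
    (Φ.smooth.mdifferentiableAt (by simp)).hasMFDerivAt
  have h2 : HasMFDerivAt 𝓘(ℝ, EM) (𝓘(ℝ, ℝ).prod 𝓘(ℝ, EM)) (fun y : M => (ε, y)) x _ :=
    (hasMFDerivAt_const ε x).prodMk (hasMFDerivAt_id x)
  have h3 := (h1.comp x h2).mfderiv
  have h4 : Φ.d ε x v = (mfderiv (𝓘(ℝ, ℝ).prod 𝓘(ℝ, EM)) 𝓘(ℝ, EG)
      (fun z : ℝ × M => Φ.toFun z.1 z.2) (ε, x)) ((0 : ℝ), v) :=
    congrArg (fun T : EM →L[ℝ] EG => T v) h3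
  rw [h4]
  rfl

lemma SrcFlow.contMDiff_tvec_d (Φ : SrcFlow 𝒢) {E₁ H₁ N₁ : Type*} [NormedAddCommGroup E₁]
    [NormedSpace ℝ E₁] [TopologicalSpace H₁] {I₁ : ModelWithCorners ℝ E₁ H₁} [TopologicalSpace N₁]
    [ChartedSpace H₁ N₁] {ε : N₁ → ℝ} {x : N₁ → M} {v : N₁ → EM}
    (hε : ContMDiff I₁ 𝓘(ℝ, ℝ) ∞ ε)
    (hv : ContMDiff I₁ 𝓘(ℝ, EM).tangent ∞ fun y => tvec (x y) (v y)) :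
    ContMDiff I₁ 𝓘(ℝ, EG).tangent ∞
      fun y => tvec (Φ.toFun (ε y) (x y)) (Φ.d (ε y) (x y) (v y)) := by
  have : IsManifold 𝓘(ℝ, EM) 1 M := IsManifold.of_le (n := ∞) (by simp)
  have : IsManifold 𝓘(ℝ, EG) 1 G := IsManifold.of_le (n := ∞) (by simp)
  have h0 : ContMDiff I₁ 𝓘(ℝ, ℝ).tangent ∞ fun y => tvec (ε y) (0 : ℝ) :=
    contMDiffOn_univ.1 (contMDiff_tvec_vectorSpace.2
      ⟨hε.contMDiffOn, contMDiffOn_const⟩)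
  have h1 := (Φ.smooth.contMDiff_tangentMap (m := ∞) (by simp)).comp (contMDiff_tvec_prodMk h0 hv)
  simp only [Φ.tvec_d_eq]
  exact h1

/-- The curve `ε ↦ (TΦ_ε(x₁), …, TΦ_ε(x_q), Δ^*_{Φ_ε(m)⁻¹} ξ)` for a family `Φ` of sections of the
source map. -/
def SrcFlow.curve (ρ : Representation F C 𝒢) (Φ : SrcFlow 𝒢) (x : BigObj F EM C q) (ε : ℝ) :
    SrcFibre (big q ρ).toUnitalGraph x :=
  ⟨⟨Φ.toFun ε x.pt, fun j => Φ.d ε x.pt (x.vec j), 𝒢.tgt (Φ.toFun ε x.pt), rfl,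
    x.cov.comp (ρ.act (𝒢.inv (Φ.toFun ε x.pt)) (𝒢.src_inv _)
      ((𝒢.tgt_inv _).trans (Φ.src_eq _ _)))⟩,
    bigSrc_eq ρ (Φ.src_eq ε x.pt) (fun j => Φ.dsrc_d ε x.pt (x.vec j))
      (fun c => congrArg x.cov (ρ.act_inv_act (Φ.toFun ε x.pt) (Φ.src_eq ε x.pt) rfl c))⟩

lemma SrcFlow.isPlot_curve (ρ : Representation F C 𝒢) (Φ : SrcFlow 𝒢) {n : ℕ}
    {x : EuclideanSpace ℝ (Fin n) → BigObj F EM C q} (hx : IsPlot x)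
    {ε : EuclideanSpace ℝ (Fin n) → ℝ} (hε : ContDiff ℝ ∞ ε) :
    IsPlot fun y => (Φ.curve ρ (x y) (ε y)).1 := by
  rw [BigObj.isPlot_iff] at hx
  have hg : ContMDiff (𝓡 n) 𝓘(ℝ, EG) ∞ fun y => Φ.toFun (ε y) (x y).pt :=
    Φ.smooth.comp (hε.contMDiff.prodMk hx.1)
  refine BigArr.isPlot_iff.2 ⟨hg, fun j => Φ.contMDiff_tvec_d hε.contMDiff (hx.2.1 j), ?_⟩
  exact ρ.contMDiff_dvec_act (k := fun y => 𝒢.inv (Φ.toFun (ε y) (x y).pt))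
    (fun y => 𝒢.src_inv _) (fun y => (𝒢.tgt_inv _).trans (Φ.src_eq _ _))
    (𝒢.inv_smooth.comp hg) hx.2.2

lemma isPlot_coreCurve (ρ : Representation F C 𝒢) (i : Fin q) (u : Alg 𝒢) {n : ℕ}
    {x : EuclideanSpace ℝ (Fin n) → BigObj F EM C q} (hx : IsPlot x)
    {ε : EuclideanSpace ℝ (Fin n) → ℝ} (hε : ContDiff ℝ ∞ ε) :
    IsPlot fun y => (coreCurve ρ i u (x y) (ε y)).1 := by
  rw [BigObj.isPlot_iff] at hx
  refine BigArr.isPlot_iff.2 ⟨𝒢.unit_smooth.comp hx.1, fun j => ?_, hx.2.2⟩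
  have h1 : ContMDiff (𝓡 n) 𝓘(ℝ, ℝ) ∞ fun y => if j = i then ε y else 0 := by
    by_cases h : j = i
    · simpa [h] using hε.contMDiff
    · simpa [h] using contMDiff_const
  have h2 : ContMDiff (𝓡 n) 𝓘(ℝ, EG).tangent ∞
      fun y => tvec (𝒢.unit (x y).pt) (𝒢.dunit (x y).pt ((x y).vec j)) :=
    contMDiff_tvec_map 𝒢.unit_smooth (hx.2.1 j)
  have h3 := contMDiff_tvec_smul_add h1 (u.2.1.comp hx.1) h2
  exact h3.congr fun y => congrArg (tvec _) (add_comm _ _)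

lemma dSmooth_real_iff {X : Type*} [DiffeologicalSpace X] {c : ℝ → X} :
    DSmooth c ↔ ∀ (n : ℕ) (ε : EuclideanSpace ℝ (Fin n) → ℝ), ContDiff ℝ ∞ ε →
      IsPlot fun y => c (ε y) :=
  forall_congr' fun _ => forall_congr' fun _ => imp_congr_left isPlot_iff_contDiff

lemma SrcFlow.dSmooth_curve (ρ : Representation F C 𝒢) (Φ : SrcFlow 𝒢) (x : BigObj F EM C q) :
    DSmooth (Φ.curve ρ x) :=
  dSmooth_real_iff.2 fun _ _ hε => Φ.isPlot_curve ρ (x := fun _ => x) isPlot_const hε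

lemma dSmooth_coreCurve (ρ : Representation F C 𝒢) (i : Fin q) (u : Alg 𝒢)
    (x : BigObj F EM C q) : DSmooth (coreCurve ρ i u x) :=
  dSmooth_real_iff.2 fun _ _ hε => isPlot_coreCurve ρ i u (x := fun _ => x) isPlot_const hε

/-- A point of a source fibre of `𝔾_q` is determined by its arrow and its tangent vectors. -/
lemma SrcFibre.ext_big (ρ : Representation F C 𝒢) {x : BigObj F EM C q}
    {a a' : SrcFibre (big q ρ).toUnitalGraph x} (h : a.1.arr = a'.1.arr)
    (hv : a.1.vec = a'.1.vec) : a = a' := by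
  obtain ⟨⟨g, v, y, rfl, ξ⟩, ha⟩ := a
  obtain ⟨⟨g', v', y', rfl, ξ'⟩, ha'⟩ := a'
  dsimp only at h hv
  subst h hv
  have h1 : bigSrc ρ ⟨g, v, 𝒢.tgt g, rfl, ξ⟩ = bigSrc ρ ⟨g, v, 𝒢.tgt g, rfl, ξ'⟩ :=
    Eq.trans ha ha'.symm
  have h2 : ξ.comp (ρ.act g rfl rfl) = ξ'.comp (ρ.act g rfl rfl) := by
    simpa [bigSrc] using h1
  have h3 : ξ = ξ' := by
    ext c
    -- The covectors agree after composition with Δ_g, so surjectivity of Δ_g is needed. The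
    -- left-inverse identity, applied to g⁻¹ together with (g⁻¹)⁻¹ = g, shows that Δ_{g⁻¹} is also a
    -- right inverse.
    have h4 := ρ.act_inv_act (𝒢.inv g) (𝒢.src_inv g) (𝒢.tgt_inv g) c
    have hinv : 𝒢.inv (𝒢.inv g) = g := by
      have e1 := 𝒢.mul_assoc (𝒢.inv (𝒢.inv g)) (𝒢.inv g) g
        (by rw [𝒢.src_inv]) (by rw [𝒢.src_inv])
      have e2 := 𝒢.inv_mul (𝒢.inv g)
      rw [e2, 𝒢.inv_mul, 𝒢.src_inv, 𝒢.unit_mul] at e1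
      have e3 := 𝒢.mul_unit (𝒢.inv (𝒢.inv g))
      rw [𝒢.src_inv, 𝒢.tgt_inv] at e3
      exact e3.symm.trans e1.symm
    have h5 : ∀ (k : G) (hk : 𝒢.src k = 𝒢.src g) (hk' : 𝒢.tgt k = 𝒢.tgt g) (hh : k = g)
        (d : C (𝒢.src g)), ρ.act k hk hk' d = ρ.act g rfl rfl d := by
      rintro k hk hk' rfl d; rfl
    rw [h5 _ _ _ hinv] at h4
    rw [← h4]
    exact congrArg (fun T : C (𝒢.src g) →L[ℝ] ℝ =>
      T (ρ.act (𝒢.inv g) (𝒢.src_inv g) (𝒢.tgt_inv g) c)) h2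
  subst h3
  rfl

/-! ### Coordinates on the source fibres of `𝔾_q` -/

namespace SrcChart

variable {Z : Type*} [NormedAddCommGroup Z] [NormedSpace ℝ Z]

lemma mem_c_source {m : M} (κ : SrcChart 𝒢 m Z) : m ∈ κ.c.source := by
  simpa [𝒢.src_unit] using κ.src_mem _ κ.unit_mem

/-- The fibre coordinates of a point of the source fibre of `𝔾_q` at `x`. -/
def coord (ρ : Representation F C 𝒢) {x : BigObj F EM C q} (κ : SrcChart 𝒢 x.pt Z)
    (a : SrcFibre (big q ρ).toUnitalGraph x) : Z × (Fin q → Z) :=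
  ((κ.e a.1.arr).2, fun j => (κ.de a.1.arr (a.1.vec j)).2)

/-- The point of the source fibre of `𝔾_q` at `x` with given coordinates. -/
def point (ρ : Representation F C 𝒢) {x : BigObj F EM C q} (κ : SrcChart 𝒢 x.pt Z)
    (z : Z) (w : Fin q → Z) (hz : (κ.c x.pt, z) ∈ κ.e.target) :
    SrcFibre (big q ρ).toUnitalGraph x :=
  ⟨⟨κ.e.symm (κ.c x.pt, z), fun j => κ.deSymm (κ.c x.pt, z) (κ.dc x.pt (x.vec j), w j), _, rfl,
    x.cov.comp (ρ.act (𝒢.inv (κ.e.symm (κ.c x.pt, z))) (𝒢.src_inv _)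
      ((𝒢.tgt_inv _).trans (src_e_symm hz κ.mem_c_source rfl)))⟩,
    bigSrc_eq ρ (src_e_symm hz κ.mem_c_source rfl)
      (fun _ => dsrc_deSymm hz κ.mem_c_source rfl _ _)
      (fun c => congrArg x.cov (ρ.act_inv_act _ (src_e_symm hz κ.mem_c_source rfl) rfl c))⟩

lemma e_arr (ρ : Representation F C 𝒢) {x : BigObj F EM C q} (κ : SrcChart 𝒢 x.pt Z)
    (a : SrcFibre (big q ρ).toUnitalGraph x) (ha : a.1.arr ∈ κ.e.source) :
    κ.e a.1.arr = (κ.c x.pt, (κ.coord ρ a).1) := by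
  refine Prod.ext ?_ rfl
  have h : 𝒢.src a.1.arr = x.pt := congrArg BigObj.pt a.2
  rw [κ.fst_e _ ha, h]

lemma point_coord (ρ : Representation F C 𝒢) {x : BigObj F EM C q} (κ : SrcChart 𝒢 x.pt Z)
    (a : SrcFibre (big q ρ).toUnitalGraph x) (ha : a.1.arr ∈ κ.e.source)
    (hz : (κ.c x.pt, (κ.coord ρ a).1) ∈ κ.e.target) :
    κ.point ρ (κ.coord ρ a).1 (κ.coord ρ a).2 hz = a := by
  have h := κ.e_arr ρ a ha
  refine SrcFibre.ext_big ρ ?_ ?_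
  · change κ.e.symm _ = _
    rw [← h, κ.e.left_inv ha]
  · funext j
    change κ.deSymm _ _ = _
    have h1 : 𝒢.src a.1.arr = x.pt := congrArg BigObj.pt a.2
    have h2 : 𝒢.dsrc a.1.arr (a.1.vec j) = x.vec j := congrArg (fun y => y.vec j) a.2
    have h3 : κ.de a.1.arr (a.1.vec j) =
        (κ.dc x.pt (x.vec j), (κ.de a.1.arr (a.1.vec j)).2) := by
      refine Prod.ext ?_ rfl
      rw [fst_de ha, h1, h2]
    rw [← h]
    have h4 := deSymm_de (κ := κ) ha (a.1.vec j)
    rw [h3] at h4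
    exact h4

/-- Near the unit, a smooth function on the source fibre is a smooth function of the coordinates. -/
lemma exists_coord_fun [FiniteDimensional ℝ Z] (ρ : Representation F C 𝒢) {x : BigObj F EM C q}
    (κ : SrcChart 𝒢 x.pt Z) (Θ : smoothFun (SrcFibre (big q ρ).toUnitalGraph x)) :
    ∃ f : Z × (Fin q → Z) → ℝ, ContDiff ℝ ∞ f ∧ ∃ N ∈ 𝓝 (κ.e (𝒢.unit x.pt)).2,
      ∀ a : SrcFibre (big q ρ).toUnitalGraph x, a.1.arr ∈ κ.e.source → (κ.coord ρ a).1 ∈ N →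
        Θ.1 a = f (κ.coord ρ a) := by
  have hU : {z : Z | (κ.c x.pt, z) ∈ κ.e.target} ∈ 𝓝 (κ.e (𝒢.unit x.pt)).2 := by
    refine (κ.e.open_target.preimage (by fun_prop)).mem_nhds ?_
    have h := κ.e.map_source κ.unit_mem
    have h1 : κ.e (𝒢.unit x.pt) = (κ.c x.pt, (κ.e (𝒢.unit x.pt)).2) := by
      refine Prod.ext ?_ rfl
      rw [κ.fst_e _ κ.unit_mem, 𝒢.src_unit]
    rw [h1] at h
    exact h
  -- The inverse chart exists only over its target, so the base coordinate z is cut off to make f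
  -- global. The vector coordinates enter linearly and need no cutoff; the covector is forced by the
  -- arrow.
  obtain ⟨β, hβ, hβU, hβ1⟩ := exists_cutoff hU
  refine ⟨fun z => Θ.1 (κ.point ρ (β z.1) z.2 (hβU z.1)), ?_, _, hβ1, ?_⟩
  · refine contDiff_comp_family Θ fun n g hg => ?_
    change IsPlot fun y => (κ.point ρ (β (g y).1) (g y).2 (hβU (g y).1)).1
    have hz : ContMDiff (𝓡 n) 𝓘(ℝ, EM × Z) ∞ fun y => (κ.c x.pt, β (g y).1) :=
      (contDiff_const.prodMk (hβ.comp (contDiff_fst.comp hg))).contMDiff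
    have ha : ContMDiff (𝓡 n) 𝓘(ℝ, EG) ∞ fun y => κ.e.symm (κ.c x.pt, β (g y).1) :=
      κ.e_symm_smooth.comp_contMDiff hz fun y => hβU (g y).1
    refine BigArr.isPlot_iff.2 ⟨ha, fun j => ?_, ?_⟩
    · have hw : ContMDiff (𝓡 n) 𝓘(ℝ, EM × Z) ∞ fun y => (κ.dc x.pt (x.vec j), (g y).2 j) :=
        (contDiff_const.prodMk ((contDiff_pi.1 (contDiff_snd.comp hg)) j)).contMDiff
      exact contMDiffOn_univ.1 (contMDiff_tvec_map_of_isOpen κ.e.open_target κ.e_symm_smooth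
        (contMDiff_tvec_vectorSpace.2 ⟨hz.contMDiffOn, hw.contMDiffOn⟩)
        fun y _ => hβU (g y).1)
    · exact ρ.contMDiff_dvec_act (k := fun y => 𝒢.inv (κ.e.symm (κ.c x.pt, β (g y).1)))
        (fun y => 𝒢.src_inv _)
        (fun y => (𝒢.tgt_inv _).trans (src_e_symm (hβU (g y).1) κ.mem_c_source rfl))
        (𝒢.inv_smooth.comp ha) (η := fun _ => x.cov) contMDiff_const
  · intro a ha hN
    have hN' : β (κ.coord ρ a).1 = (κ.coord ρ a).1 := hN
    have h1 : ∀ z (hz : (κ.c x.pt, z) ∈ κ.e.target), z = (κ.coord ρ a).1 →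
        κ.point ρ z (κ.coord ρ a).2 hz = a := by
      rintro z hz rfl
      exact κ.point_coord ρ a ha hz
    exact (congrArg Θ.1 (h1 _ (hβU _) hN')).symm

/-- The derivative of the section `u` in the chart. -/
def dloc {m : M} (κ : SrcChart 𝒢 m Z) (u : Alg 𝒢) : EM →L[ℝ] Z :=
  mfderiv 𝓘(ℝ, EM) 𝓘(ℝ, Z) (κ.loc u.1) m

lemma hasMFDerivAt_loc {m : M} (κ : SrcChart 𝒢 m Z) (u : Alg 𝒢) :
    HasMFDerivAt 𝓘(ℝ, EM) 𝓘(ℝ, Z) (κ.loc u.1) m (κ.dloc u) :=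
  (((contMDiffOn_loc (κ := κ) u).contMDiffAt (isOpen_unit_preimage.mem_nhds
    κ.unit_mem)).mdifferentiableAt (by simp)).hasMFDerivAt

/-- The coordinates of a family of sections of the source map have at `ε = 0` the velocity given by
the `1`-jet of the section `u`. -/
lemma hasDerivAt_coord {m : M} (κ : SrcChart 𝒢 m Z) {Φ : SrcFlow 𝒢} {u : Alg 𝒢}
    (hΦ : Φ.HasVelocity u m) :
    HasDerivAt (fun ε => (κ.e (Φ.toFun ε m)).2) (κ.loc u.1 m) 0 ∧
    ∀ v, HasDerivAt (fun ε => (κ.de (Φ.toFun ε m) (Φ.d ε m v)).2) (κ.dloc u v) 0 := by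
  have hm := κ.mem_c_source
  -- h(ε, y) is the Z-coordinate of Φ_ε in the chart of the base. The Z-component of TΦ_ε(v) is the
  -- y-derivative of h, so its velocity is a mixed partial derivative. Exchanging the order turns it
  -- into the y-derivative of ∂_ε h(0, ·), which near m is the local expression of u.
  let h : ℝ × EM → Z := fun p => (κ.e (Φ.toFun p.1 (κ.c.symm p.2))).2
  -- the set where `h` is smooth
  have hcs : ContMDiffOn 𝓘(ℝ, ℝ × EM) 𝓘(ℝ, EG) ∞
      (fun p : ℝ × EM => Φ.toFun p.1 (κ.c.symm p.2)) (Prod.snd ⁻¹' κ.c.target) := by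
    refine Φ.smooth.comp_contMDiffOn (ContMDiffOn.prodMk ?_ ?_)
    · exact contDiff_fst.contMDiff.contMDiffOn
    · exact κ.c_symm_smooth.comp contDiff_snd.contMDiff.contMDiffOn fun p hp => hp
  have hopen : IsOpen (Prod.snd ⁻¹' κ.c.target : Set (ℝ × EM)) :=
    κ.c.open_target.preimage continuous_snd
  have hS := hcs.continuousOn.isOpen_inter_preimage hopen κ.e.open_source
  set S : Set (ℝ × EM) := Prod.snd ⁻¹' κ.c.target ∩
    (fun p : ℝ × EM => Φ.toFun p.1 (κ.c.symm p.2)) ⁻¹' κ.e.source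
  have hhS : ContMDiffOn 𝓘(ℝ, ℝ × EM) 𝓘(ℝ, Z) ∞ h S :=
    contDiff_snd.contMDiff.comp_contMDiffOn
      (κ.e_smooth.comp (hcs.mono Set.inter_subset_left) fun p hp => hp.2)
  have hh : ∀ p ∈ S, ContDiffAt ℝ ∞ h p := fun p hp =>
    contMDiffAt_iff_contDiffAt.1 (hhS.contMDiffAt (hS.mem_nhds hp))
  have hd : ∀ p ∈ S, HasFDerivAt h (fderiv ℝ h p) p := fun p hp =>
    ((hh p hp).differentiableAt (by simp)).hasFDerivAt
  have h0S : (0, κ.c m) ∈ S := by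
    refine ⟨κ.c.map_source hm, ?_⟩
    change Φ.toFun 0 (κ.c.symm (κ.c m)) ∈ κ.e.source
    rw [κ.c.left_inv hm, Φ.zero_eq]
    exact κ.unit_mem
  -- the partial derivatives of `h`
  have hε : ∀ x ∈ κ.c.source, (0, κ.c x) ∈ S →
      (mfderiv 𝓘(ℝ, ℝ) 𝓘(ℝ, EG) (fun ε => Φ.toFun ε x) 0 : ℝ →L[ℝ] EG) 1 = u.1 x →
      HasDerivAt (fun ε => (κ.e (Φ.toFun ε x)).2) (κ.loc u.1 x) 0 ∧
      fderiv ℝ h (0, κ.c x) (1, 0) = κ.loc u.1 x := by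
    intro x hx hxS hux
    obtain ⟨D, hD, h1⟩ : ∃ D : ℝ →L[ℝ] EG, D 1 = u.1 x ∧
        HasMFDerivAt 𝓘(ℝ, ℝ) 𝓘(ℝ, EG) (fun ε => Φ.toFun ε x) 0 D :=
      ⟨_, hux, ((Φ.smooth.comp (contMDiff_id.prodMk contMDiff_const)).mdifferentiableAt
        (by simp)).hasMFDerivAt⟩
    have hxe : Φ.toFun 0 x ∈ κ.e.source := by
      have := hxS.2
      simpa [κ.c.left_inv hx] using this
    have h2 := (hasMFDerivAt_e (κ := κ) hxe).comp (0 : ℝ) h1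
    have h3 : HasFDerivAt (fun ε => κ.e (Φ.toFun ε x)) ((κ.de (Φ.toFun 0 x)).comp D) 0 :=
      hasMFDerivAt_iff_hasFDerivAt.1 h2
    have h4 : HasDerivAt (fun ε => (κ.e (Φ.toFun ε x)).2) (κ.loc u.1 x) 0 := by
      have h5 : HasDerivAt (fun ε => (κ.e (Φ.toFun ε x)).2) (κ.de (Φ.toFun 0 x) (D 1)).2 0 :=
        (HasFDerivAt.comp (g := Prod.snd) (g' := ContinuousLinearMap.snd ℝ EM Z) (0 : ℝ)
          hasFDerivAt_snd h3).hasDerivAt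
      rw [hD, Φ.zero_eq] at h5
      exact h5
    refine ⟨h4, ?_⟩
    have h7 : HasDerivAt (fun ε : ℝ => (ε, κ.c x)) ((1 : ℝ), (0 : EM)) 0 :=
      (hasDerivAt_id _).prodMk (hasDerivAt_const _ _)
    have h8 := (hd _ hxS).comp_hasDerivAt (0 : ℝ) h7
    refine h8.unique ?_
    have h9 : h ∘ (fun ε : ℝ => (ε, κ.c x)) = fun ε => (κ.e (Φ.toFun ε x)).2 := by
      funext ε
      simp only [h, Function.comp_apply, κ.c.left_inv hx]
    rw [h9]
    exact h4
  have hum := hΦ.self_of_nhds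
  refine ⟨(hε m hm h0S hum).1, fun v => ?_⟩
  obtain ⟨hmix, hAdiff⟩ := hasDerivAt_fderiv_snd (hh _ h0S) (κ.dc m v)
  set A : EM → Z := fun y => fderiv ℝ h (0, y) (1, 0)
  -- the velocity along the base
  have hA : fderiv ℝ A (κ.c m) (κ.dc m v) = κ.dloc u v := by
    have h1 : HasMFDerivAt 𝓘(ℝ, EM) 𝓘(ℝ, Z) (A ∘ κ.c) m _ :=
      hAdiff.hasFDerivAt.hasMFDerivAt.comp m (hasMFDerivAt_c (κ := κ) hm)
    have h2 : HasMFDerivAt 𝓘(ℝ, EM) 𝓘(ℝ, Z) (A ∘ κ.c) m (κ.dloc u) := by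
      refine (κ.hasMFDerivAt_loc u).congr_of_eventuallyEq ?_
      have hev : ∀ᶠ x in 𝓝 m, (0, κ.c x) ∈ S := by
        have hc : ContinuousAt (fun x => ((0 : ℝ), κ.c x)) m :=
          continuousAt_const.prodMk (κ.c.continuousAt hm)
        exact hc.eventually_mem (hS.mem_nhds h0S)
      filter_upwards [hΦ, hev, κ.c.open_source.mem_nhds hm] with x h1 h2 h3
      exact (hε x h3 h2 h1).2
    exact congrArg (fun T : EM →L[ℝ] Z => T v) (hasMFDerivAt_unique h1 h2)
  rw [hA] at hmix
  refine hmix.congr_of_eventuallyEq ?_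
  have hev : ∀ᶠ ε in 𝓝 (0 : ℝ), (ε, κ.c m) ∈ S := by
    have hc : ContinuousAt (fun ε : ℝ => (ε, κ.c m)) 0 := by fun_prop
    exact hc.eventually_mem (hS.mem_nhds h0S)
  filter_upwards [hev] with ε hεS
  have hεe : Φ.toFun ε m ∈ κ.e.source := by
    have := hεS.2
    simpa [κ.c.left_inv hm] using this
  have h1 : HasMFDerivAt 𝓘(ℝ, EM) 𝓘(ℝ, EG) (Φ.toFun ε) m (Φ.d ε m) :=
    ((Φ.smooth.comp (contMDiff_const.prodMk contMDiff_id)).mdifferentiableAt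
      (by simp)).hasMFDerivAt
  have hsnd : HasMFDerivAt 𝓘(ℝ, EM × Z) 𝓘(ℝ, Z) Prod.snd (κ.e (Φ.toFun ε m))
      (ContinuousLinearMap.snd ℝ EM Z) := hasFDerivAt_snd.hasMFDerivAt
  have h2 := hsnd.comp m ((hasMFDerivAt_e (κ := κ) hεe).comp m h1)
  have h3 : HasFDerivAt (fun y : EM => (ε, y)) (ContinuousLinearMap.inr ℝ ℝ EM) (κ.c m) := by
    have := (hasFDerivAt_const (𝕜 := ℝ) ε (κ.c m)).prodMk (hasFDerivAt_id (κ.c m))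
    exact this
  have h4 := ((hd _ hεS).comp (κ.c m) h3).hasMFDerivAt.comp m (hasMFDerivAt_c (κ := κ) hm)
  have h5 : HasMFDerivAt 𝓘(ℝ, EM) 𝓘(ℝ, Z) (Prod.snd ∘ κ.e ∘ Φ.toFun ε) m
      (((fderiv ℝ h (ε, κ.c m)).comp (ContinuousLinearMap.inr ℝ ℝ EM)).comp (κ.dc m)) := by
    refine h4.congr_of_eventuallyEq ?_
    filter_upwards [κ.c.open_source.mem_nhds hm] with x hx
    simp only [h, Function.comp_apply, κ.c.left_inv hx]
  exact congrArg (fun T : EM →L[ℝ] Z => T v) (hasMFDerivAt_unique h2 h5)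

/-- The derivatives of a smooth function along the curves that define `𝒯u` and `𝒵_i u`, in terms of
the `1`-jet of `u`. -/
lemma exists_jet_functional [FiniteDimensional ℝ Z] (ρ : Representation F C 𝒢)
    {x : BigObj F EM C q} (κ : SrcChart 𝒢 x.pt Z)
    (Θ : smoothFun (SrcFibre (big q ρ).toUnitalGraph x)) :
    ∃ L : Z × (Fin q → Z) →L[ℝ] ℝ,
      (∀ (u : Alg 𝒢) (Φ : SrcFlow 𝒢), Φ.HasVelocity u x.pt →
        deriv (fun ε => Θ.1 (Φ.curve ρ x ε)) 0 =
          L (κ.loc u.1 x.pt, fun j => κ.dloc u (x.vec j))) ∧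
      ∀ (i : Fin q) (u : Alg 𝒢), deriv (fun ε => Θ.1 (coreCurve ρ i u x ε)) 0 =
        L (0, Pi.single i (κ.loc u.1 x.pt)) := by
  obtain ⟨f, hf, N, hN, hfN⟩ := κ.exists_coord_fun ρ Θ
  let a₀ : Z × (Fin q → Z) :=
    ((κ.e (𝒢.unit x.pt)).2, fun j => (κ.de (𝒢.unit x.pt) (𝒢.dunit x.pt (x.vec j))).2)
  -- the chain rule along a curve through the unit
  have key : ∀ (c : ℝ → SrcFibre (big q ρ).toUnitalGraph x) (z' : Z × (Fin q → Z)),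
      (∀ᶠ ε in 𝓝 (0 : ℝ), (c ε).1.arr ∈ κ.e.source) →
      κ.coord ρ (c 0) = a₀ → HasDerivAt (fun ε => κ.coord ρ (c ε)) z' 0 →
      deriv (fun ε => Θ.1 (c ε)) 0 = fderiv ℝ f a₀ z' := by
    intro c z' hc h0 hd
    have h1 : HasFDerivAt f (fderiv ℝ f a₀) (κ.coord ρ (c 0)) := by
      rw [h0]
      exact (hf.differentiable (by simp) a₀).hasFDerivAt
    have h2 := h1.comp_hasDerivAt (0 : ℝ) hd
    have h3 : (fun ε => Θ.1 (c ε)) =ᶠ[𝓝 0] f ∘ fun ε => κ.coord ρ (c ε) := by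
      have h4 : ∀ᶠ ε in 𝓝 (0 : ℝ), (κ.coord ρ (c ε)).1 ∈ N := by
        refine (continuous_fst.continuousAt.comp hd.continuousAt).eventually_mem ?_
        change N ∈ 𝓝 (κ.coord ρ (c 0)).1
        rw [h0]
        exact hN
      filter_upwards [hc, h4] with ε h5 h6
      exact hfN _ h5 h6
    rw [h3.deriv_eq]
    exact h2.deriv
  -- All the curves pass through the unit at ε = 0, so a single differential, at the coordinates a₀
  -- of the unit, computes all the derivatives.
  refine ⟨fderiv ℝ f a₀, fun u Φ hΦ => key _ _ ?_ ?_ ?_, fun i u => key _ _ ?_ ?_ ?_⟩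
  · have hc : ContinuousAt (fun ε => Φ.toFun ε x.pt) 0 :=
      (Φ.smooth.comp (contMDiff_id.prodMk contMDiff_const)).continuous.continuousAt
    refine hc.eventually_mem (κ.e.open_source.mem_nhds ?_)
    rw [Φ.zero_eq]
    exact κ.unit_mem
  · have hd : Φ.d 0 x.pt = 𝒢.dunit x.pt := by
      have : Φ.toFun 0 = 𝒢.unit := funext Φ.zero_eq
      rw [SrcFlow.d, LieGroupoid.dunit, this]
    change ((κ.e (Φ.toFun 0 x.pt)).2,
      fun j => (κ.de (Φ.toFun 0 x.pt) (Φ.d 0 x.pt (x.vec j))).2) = a₀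
    rw [hd, Φ.zero_eq]
  · exact (κ.hasDerivAt_coord hΦ).1.prodMk (hasDerivAt_pi.2 fun j => (κ.hasDerivAt_coord hΦ).2 _)
  · exact Filter.Eventually.of_forall fun ε => κ.unit_mem
  · change ((κ.e (𝒢.unit x.pt)).2, fun j => (κ.de (𝒢.unit x.pt)
      (𝒢.dunit x.pt (x.vec j) + (if j = i then (0 : ℝ) else 0) • u.1 x.pt)).2) = a₀
    simp [a₀]
  · suffices h : HasDerivAt (fun ε : ℝ => fun j => (κ.de (𝒢.unit x.pt)
        (𝒢.dunit x.pt (x.vec j) + (if j = i then ε else 0) • u.1 x.pt)).2)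
        (Pi.single i (κ.loc u.1 x.pt)) 0 from
      (hasDerivAt_const (0 : ℝ) (κ.e (𝒢.unit x.pt)).2).prodMk h
    refine hasDerivAt_pi.2 fun j => ?_
    simp only [map_add, map_smul, Prod.snd_add, Prod.smul_snd]
    by_cases hj : j = i
    · subst hj
      simpa [loc] using ((hasDerivAt_id (0 : ℝ)).smul_const
        (κ.de (𝒢.unit x.pt) (u.1 x.pt)).2).const_add
          (κ.de (𝒢.unit x.pt) (𝒢.dunit x.pt (x.vec j))).2
    · simpa [hj] using hasDerivAt_const (0 : ℝ) (κ.de (𝒢.unit x.pt) (𝒢.dunit x.pt (x.vec j))).2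

end SrcChart

/-! ### Sections given by velocities -/

section Velocity

variable {Ob Ar : Type*} [DiffeologicalSpace Ob] [DiffeologicalSpace Ar] {S : UnitalGraph Ob Ar}

/-- The velocity at `0` of a curve in the source fibre through the unit. -/
def velocity {x : Ob} (c : ℝ → SrcFibre S x) (hc : DSmooth c) (h0 : c 0 = SrcFibre.one S x) :
    algFibre S x :=
  ⟨{ toFun := fun Θ => deriv (fun ε => Θ.1 (c ε)) 0
     map_add' := fun Θ Θ' =>
      deriv_add (differentiableAt_curve Θ hc 0) (differentiableAt_curve Θ' hc 0)
     map_smul' := fun r Θ => deriv_const_mul r (differentiableAt_curve Θ hc 0) },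
    Submodule.subset_span ⟨c, hc, h0, fun _ => rfl⟩⟩

/-- A family of curves defines a section if near each parameter of a plot it can be replaced by a
smooth family with the same velocities. -/
lemma velocitySec_apply (c : ∀ x, ℝ → SrcFibre S x) (hc : ∀ x, DSmooth (c x))
    (h0 : ∀ x, c x 0 = SrcFibre.one S x)
    (hloc : ∀ (n : ℕ) (x : EuclideanSpace ℝ (Fin n) → Ob), IsPlot x → ∀ y₀,
      ∃ c' : ∀ y, ℝ → SrcFibre S (x y),
        IsFamily (fun p : EuclideanSpace ℝ (Fin n) × ℝ =>
          (⟨(p.1, (c' p.1 p.2).1), (c' p.1 p.2).2⟩ : SrcFamily S x)) ∧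
        ∀ᶠ y in 𝓝 y₀, ∀ Θ : smoothFun (SrcFibre S (x y)),
          deriv (fun ε => Θ.1 (c (x y) ε)) 0 = deriv (fun ε => Θ.1 (c' y ε)) 0)
    (x : Ob) (Θ : smoothFun (SrcFibre S x)) :
    ((velocitySec c).1 x).1 Θ = deriv (fun ε => Θ.1 (c x ε)) 0 := by
  -- Smoothness of the pointwise velocities must be shown to exclude the default value 0 of
  -- `velocitySec`; it is local in the parameter, so the replacement c' near y₀ suffices.
  have h : ∃ χ : Sec S, ∀ x (Θ : smoothFun (SrcFibre S x)),
      (χ.1 x).1 Θ = deriv (fun ε => Θ.1 (c x ε)) 0 := by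
    refine ⟨⟨fun x => velocity (c x) (hc x) (h0 x), ?_⟩, fun _ _ => rfl⟩
    intro n x hx Θ
    refine contDiff_iff_contDiffAt.2 fun y₀ => ?_
    obtain ⟨c', hc', he⟩ := hloc n x hx y₀
    have h1 := contDiff_deriv_param (contDiff_comp_family Θ hc')
    refine h1.contDiffAt.congr_of_eventuallyEq ?_
    filter_upwards [he] with y hy
    exact hy _
  rw [velocitySec, dif_pos h]
  exact h.choose_spec x Θ

lemma Sec.ext_apply {χ χ' : Sec S} (h : ∀ x (Θ : smoothFun (SrcFibre S x)),
    (χ.1 x).1 Θ = (χ'.1 x).1 Θ) : χ = χ' :=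
  Subtype.ext <| funext fun x => Subtype.ext <| LinearMap.ext fun Θ => h x Θ

lemma Sec.add_apply (χ χ' : Sec S) (x : Ob) (Θ : smoothFun (SrcFibre S x)) :
    ((χ + χ').1 x).1 Θ = (χ.1 x).1 Θ + (χ'.1 x).1 Θ := rfl

lemma Sec.smul_apply (a : smoothFun Ob) (χ : Sec S) (x : Ob) (Θ : smoothFun (SrcFibre S x)) :
    ((a • χ).1 x).1 Θ = a.1 x * (χ.1 x).1 Θ := rfl

lemma Sec.sum_apply {ι : Type*} (s : Finset ι) (χ : ι → Sec S) (x : Ob)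
    (Θ : smoothFun (SrcFibre S x)) :
    ((∑ j ∈ s, χ j).1 x).1 Θ = ∑ j ∈ s, ((χ j).1 x).1 Θ := by
  classical
  induction s using Finset.induction_on with
  | empty => rfl
  | insert a s ha ih => rw [Finset.sum_insert ha, Finset.sum_insert ha, ← ih, Sec.add_apply]

end Velocity

lemma SrcFlow.curve_zero (ρ : Representation F C 𝒢) (Φ : SrcFlow 𝒢) (x : BigObj F EM C q) :
    Φ.curve ρ x 0 = SrcFibre.one (big q ρ).toUnitalGraph x := by
  refine SrcFibre.ext_big ρ (Φ.zero_eq _) (funext fun j => ?_)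
  have : Φ.toFun 0 = 𝒢.unit := funext Φ.zero_eq
  change Φ.d 0 x.pt (x.vec j) = 𝒢.dunit x.pt (x.vec j)
  rw [SrcFlow.d, LieGroupoid.dunit, this]

lemma coreCurve_zero (ρ : Representation F C 𝒢) (i : Fin q) (u : Alg 𝒢) (x : BigObj F EM C q) :
    coreCurve ρ i u x 0 = SrcFibre.one (big q ρ).toUnitalGraph x := by
  refine SrcFibre.ext_big ρ rfl (funext fun j => ?_)
  change 𝒢.dunit x.pt (x.vec j) + (if j = i then (0 : ℝ) else 0) • u.1 x.pt =
    𝒢.dunit x.pt (x.vec j)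
  simp

/-- The velocity of the curve of a family of sections only depends on the section `u`. -/
lemma SrcFlow.HasVelocity.deriv_eq (ρ : Representation F C 𝒢) {x : BigObj F EM C q}
    {Φ Φ' : SrcFlow 𝒢} {u : Alg 𝒢} (h : Φ.HasVelocity u x.pt) (h' : Φ'.HasVelocity u x.pt)
    (Θ : smoothFun (SrcFibre (big q ρ).toUnitalGraph x)) :
    deriv (fun ε => Θ.1 (Φ.curve ρ x ε)) 0 = deriv (fun ε => Θ.1 (Φ'.curve ρ x ε)) 0 := by
  obtain ⟨n, ⟨κ⟩⟩ := exists_srcChart 𝒢 x.pt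
  obtain ⟨L, hL, -⟩ := κ.exists_jet_functional ρ Θ
  rw [hL u Φ h, hL u Φ' h']

lemma SrcFlow.HasVelocity.eventually {Φ : SrcFlow 𝒢} {u : Alg 𝒢} {m : M}
    (h : Φ.HasVelocity u m) : ∀ᶠ x in 𝓝 m, Φ.HasVelocity u x :=
  eventually_eventually_nhds.2 h

/-- The chosen families `flow u m` need not vary smoothly with m. Near a parameter y₀ they are all
replaced by the one chosen at the point of y₀, which by `SrcFlow.HasVelocity.deriv_eq` gives the
same derivatives. -/
lemma tangentSec_apply (ρ : Representation F C 𝒢) (u : Alg 𝒢) (x : BigObj F EM C q)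
    (Θ : smoothFun (SrcFibre (big q ρ).toUnitalGraph x)) :
    ((tangentSec ρ u).1 x).1 Θ = deriv (fun ε => Θ.1 (tangentCurve ρ u x ε)) 0 := by
  refine velocitySec_apply _ (fun x => (flow u x.pt).dSmooth_curve ρ x)
    (fun x => (flow u x.pt).curve_zero ρ x) (fun n x hx y₀ => ?_) x Θ
  refine ⟨fun y ε => (flow u (x y₀).pt).curve ρ (x y) ε, fun k f hf => ?_, ?_⟩
  · have hf1 : ContDiff ℝ ∞ fun y => (f y).1 := contDiff_fst.comp hf
    refine srcFamily_isPlot_iff.2 ⟨isPlot_iff_contDiff.2 hf1, ?_⟩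
    exact (flow u (x y₀).pt).isPlot_curve ρ
      (isPlot_reparam hx hf1) (contDiff_snd.comp hf)
  · have hc : ContinuousAt (fun y => (x y).pt) y₀ :=
      (BigObj.isPlot_iff.1 hx).1.continuous.continuousAt
    filter_upwards [hc.eventually (flow_hasVelocity u (x y₀).pt).eventually] with y hy Θ
    exact (flow_hasVelocity u (x y).pt).deriv_eq ρ hy Θ

lemma coreSec_apply (ρ : Representation F C 𝒢) (i : Fin q) (u : Alg 𝒢) (x : BigObj F EM C q)
    (Θ : smoothFun (SrcFibre (big q ρ).toUnitalGraph x)) :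
    ((coreSec ρ i u).1 x).1 Θ = deriv (fun ε => Θ.1 (coreCurve ρ i u x ε)) 0 := by
  refine velocitySec_apply _ (fun x => dSmooth_coreCurve ρ i u x)
    (fun x => coreCurve_zero ρ i u x) (fun n x hx y₀ => ?_) x Θ
  refine ⟨fun y ε => coreCurve ρ i u (x y) ε, fun k f hf => ?_, .of_forall fun y Θ => rfl⟩
  have hf1 : ContDiff ℝ ∞ fun y => (f y).1 := contDiff_fst.comp hf
  refine srcFamily_isPlot_iff.2 ⟨isPlot_iff_contDiff.2 hf1, ?_⟩
  exact isPlot_coreCurve ρ i u (isPlot_reparam hx hf1) (contDiff_snd.comp hf)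

/-! ### Linearity of `𝒯` and `𝒵_i` -/

/-- A function of the base point, as a function on `𝕄_q`. -/
def ptPull (f : smoothFunM EM M) : smoothFun (BigObj F EM C q) :=
  ⟨fun x => f.1 x.pt, fun _ _ hx => by
    have h : ContMDiff 𝓘(ℝ, EM) 𝓘(ℝ, ℝ) ∞ f.1 := f.2
    exact contMDiff_iff_contDiff.1 (h.comp (BigObj.isPlot_iff.1 hx).1)⟩

/-- The function `(x₁, …, x_q, ξ) ↦ df(x_j)` on `𝕄_q`. -/
def dfunPull (f : smoothFunM EM M) (j : Fin q) : smoothFun (BigObj F EM C q) :=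
  ⟨fun x => dfun f.1 x.pt (x.vec j), fun n x hx => by
    have h := contMDiff_tvec_map (N' := ℝ) f.2 ((BigObj.isPlot_iff.1 hx).2.1 j)
    have h1 := (contMDiff_tvec_vectorSpace.1 (contMDiffOn_univ.2 h)).2
    exact contMDiff_iff_contDiff.1 (contMDiffOn_univ.1 h1)⟩

namespace SrcChart

variable {Z : Type*} [NormedAddCommGroup Z] [NormedSpace ℝ Z] {m : M} (κ : SrcChart 𝒢 m Z)

lemma loc_add (u w : Alg 𝒢) (x : M) : κ.loc (u + w).1 x = κ.loc u.1 x + κ.loc w.1 x := by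
  change (κ.de (𝒢.unit x) (u.1 x + w.1 x)).2 = _
  rw [map_add]; rfl

lemma loc_smul (f : smoothFunM EM M) (u : Alg 𝒢) (x : M) :
    κ.loc (f • u).1 x = f.1 x • κ.loc u.1 x := by
  change (κ.de (𝒢.unit x) (f.1 x • u.1 x)).2 = _
  rw [map_smul]; rfl

lemma dloc_add (u w : Alg 𝒢) : κ.dloc (u + w) = κ.dloc u + κ.dloc w := by
  have h := (κ.hasMFDerivAt_loc u).add (κ.hasMFDerivAt_loc w)
  have h1 : κ.loc (u + w).1 = κ.loc u.1 + κ.loc w.1 := funext fun x => κ.loc_add u w x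
  have h2 := κ.hasMFDerivAt_loc (u + w)
  rw [h1] at h2
  exact hasMFDerivAt_unique h2 h

/-- The product rule in the chart; its second term is the origin of every df in the Weil relations.
-/
lemma dloc_smul (f : smoothFunM EM M) (u : Alg 𝒢) (v : EM) :
    κ.dloc (f • u) v = f.1 m • κ.dloc u v + dfun f.1 m v • κ.loc u.1 m := by
  have hf : HasMFDerivAt 𝓘(ℝ, EM) 𝓘(ℝ, ℝ) f.1 m (dfun (EM := EM) f.1 m : EM →L[ℝ] ℝ) :=
    (ContMDiff.mdifferentiableAt f.2 (by simp)).hasMFDerivAt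
  have h1 : κ.loc (f • u).1 = fun x => f.1 x • κ.loc u.1 x := funext fun x => κ.loc_smul f u x
  have h2 := κ.hasMFDerivAt_loc (f • u)
  rw [h1] at h2
  have hg := κ.hasMFDerivAt_loc u
  have hg2 : HasFDerivWithinAt (𝕜 := ℝ) (E := EM) (F := Z)
      (writtenInExtChartAt 𝓘(ℝ, EM) 𝓘(ℝ, Z) m (κ.loc u.1))
    (κ.dloc u) (Set.range 𝓘(ℝ, EM)) (extChartAt 𝓘(ℝ, EM) m m) := hg.2
  have hf2 : HasFDerivWithinAt (𝕜 := ℝ) (E := EM) (F := ℝ)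
      (writtenInExtChartAt 𝓘(ℝ, EM) 𝓘(ℝ, ℝ) m f.1)
    (dfun f.1 m) (Set.range 𝓘(ℝ, EM)) (extChartAt 𝓘(ℝ, EM) m m) := hf.2
  have h3 : HasMFDerivAt 𝓘(ℝ, EM) 𝓘(ℝ, Z) (fun x => f.1 x • κ.loc u.1 x) m
      (f.1 m • κ.dloc u +
        ContinuousLinearMap.smulRight (M₁ := EM) (dfun f.1 m) (κ.loc u.1 m) : EM →L[ℝ] Z) := by
    refine ⟨hf.1.smul hg.1, ?_⟩
    have h4 := hf2.fun_smul hg2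
    have e0 : (extChartAt 𝓘(ℝ, EM) m).symm (extChartAt 𝓘(ℝ, EM) m m) = m := extChartAt_to_inv m
    simp only [writtenInExtChartAt, Function.comp_apply, e0, extChartAt_model_space_eq_id,
      PartialEquiv.refl_coe, id] at h4 ⊢
    exact h4
  exact congrArg (fun T : EM →L[ℝ] Z => T v) (hasMFDerivAt_unique h2 h3)

end SrcChart

/-- The 1-jet is additive in the section and the jet functional is linear, so no relation between
the flows of u, w and u + w is required. -/
lemma tangentSec_add (ρ : Representation F C 𝒢) (u w : Alg 𝒢) :
    tangentSec (q := q) ρ (u + w) = tangentSec ρ u + tangentSec ρ w := by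
  refine Sec.ext_apply fun x Θ => ?_
  obtain ⟨n, ⟨κ⟩⟩ := exists_srcChart 𝒢 x.pt
  obtain ⟨L, hL, -⟩ := κ.exists_jet_functional ρ Θ
  have h : ∀ u : Alg 𝒢, ((tangentSec ρ u).1 x).1 Θ =
      L (κ.loc u.1 x.pt, fun j => κ.dloc u (x.vec j)) := fun u =>
    (tangentSec_apply ρ u x Θ).trans (hL u _ (flow_hasVelocity u x.pt))
  have e : (κ.loc (u + w).1 x.pt, fun j => κ.dloc (u + w) (x.vec j)) =
      (κ.loc u.1 x.pt, fun j => κ.dloc u (x.vec j)) +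
        (κ.loc w.1 x.pt, fun j => κ.dloc w (x.vec j)) := by
    rw [κ.loc_add, κ.dloc_add]
    rfl
  refine ((h (u + w)).trans ((congrArg L e).trans (L.map_add _ _))).trans ?_
  exact (congrArg₂ (fun a b : ℝ => a + b) (h u).symm (h w).symm).trans (Sec.add_apply _ _ _ _).symm

/-- The 1-jet of fu has an extra part df(x_j) u in each slot j. In the jet functional this is
df(x_j) times the velocity of the core curve in slot j. -/
lemma tangentSec_smul_apply (ρ : Representation F C 𝒢) (f : smoothFunM EM M) (u : Alg 𝒢)
    (x : BigObj F EM C q) (Θ : smoothFun (SrcFibre (big q ρ).toUnitalGraph x)) :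
    ((tangentSec ρ (f • u)).1 x).1 Θ = f.1 x.pt * ((tangentSec ρ u).1 x).1 Θ +
      ∑ j, dfun f.1 x.pt (x.vec j) * ((coreSec ρ j u).1 x).1 Θ := by
  obtain ⟨n, ⟨κ⟩⟩ := exists_srcChart 𝒢 x.pt
  obtain ⟨L, hL, hL'⟩ := κ.exists_jet_functional ρ Θ
  have h : ∀ u : Alg 𝒢, ((tangentSec ρ u).1 x).1 Θ =
      L (κ.loc u.1 x.pt, fun j => κ.dloc u (x.vec j)) := fun u =>
    (tangentSec_apply ρ u x Θ).trans (hL u _ (flow_hasVelocity u x.pt))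
  have h' : ∀ j, ((coreSec ρ j u).1 x).1 Θ = L (0, Pi.single j (κ.loc u.1 x.pt)) := fun j =>
    (coreSec_apply ρ j u x Θ).trans (hL' j u)
  have e : (κ.loc (f • u).1 x.pt, fun j => κ.dloc (f • u) (x.vec j)) =
      f.1 x.pt • (κ.loc u.1 x.pt, fun j => κ.dloc u (x.vec j)) +
        ∑ j, dfun f.1 x.pt (x.vec j) • ((0, Pi.single j (κ.loc u.1 x.pt)) :
          EuclideanSpace ℝ (Fin n) × (Fin q → EuclideanSpace ℝ (Fin n))) := by
    refine Prod.ext ?_ (funext fun j => ?_)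
    · simpa [Prod.fst_sum] using κ.loc_smul f u x.pt
    · simp only [κ.dloc_smul]
      simp [Prod.snd_sum, Finset.sum_apply, Pi.single_apply]
  have h1 : L (κ.loc (f • u).1 x.pt, fun j => κ.dloc (f • u) (x.vec j)) =
      f.1 x.pt * L (κ.loc u.1 x.pt, fun j => κ.dloc u (x.vec j)) +
        ∑ j, dfun f.1 x.pt (x.vec j) * L (0, Pi.single j (κ.loc u.1 x.pt)) := by
    rw [e, map_add, map_smul, map_sum]
    refine congrArg₂ _ rfl (Finset.sum_congr rfl fun j _ => ?_)
    exact L.map_smul _ _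
  exact ((h (f • u)).trans h1).trans (congrArg₂ (fun a b : ℝ => a + b)
    (congrArg (f.1 x.pt * ·) (h u).symm)
    (Finset.sum_congr rfl fun j _ => congrArg (dfun f.1 x.pt (x.vec j) * ·) (h' j).symm))

attribute [local irreducible] tangentSec coreSec in
lemma tangentSec_smul (ρ : Representation F C 𝒢) (f : smoothFunM EM M) (u : Alg 𝒢) :
    tangentSec (q := q) ρ (f • u) =
      ptPull (F := F) (C := C) (q := q) f • tangentSec ρ u +
        ∑ j, dfunPull (F := F) (C := C) f j • coreSec ρ j u := by
  refine Sec.ext_apply fun x Θ => ?_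
  have h2 : ((ptPull (F := F) (C := C) (q := q) f • tangentSec ρ u).1 x).1 Θ =
      f.1 x.pt * ((tangentSec ρ u).1 x).1 Θ := Sec.smul_apply (ptPull f) (tangentSec ρ u) x Θ
  have h3 : ((∑ j, dfunPull (F := F) (C := C) f j • coreSec ρ j u).1 x).1 Θ =
      ∑ j, dfun f.1 x.pt (x.vec j) * ((coreSec ρ j u).1 x).1 Θ :=
    Sec.sum_apply _ (fun j => dfunPull f j • coreSec ρ j u) x Θ
  exact (tangentSec_smul_apply ρ f u x Θ).trans
    ((congrArg₂ (fun a b : ℝ => a + b) h2 h3).symm.trans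
      (Sec.add_apply (ptPull (F := F) (C := C) (q := q) f • tangentSec ρ u)
        (∑ j, dfunPull (F := F) (C := C) f j • coreSec ρ j u) x Θ).symm)

lemma coreSec_add (ρ : Representation F C 𝒢) (i : Fin q) (u w : Alg 𝒢) :
    coreSec ρ i (u + w) = coreSec ρ i u + coreSec ρ i w := by
  refine Sec.ext_apply fun x Θ => ?_
  obtain ⟨n, ⟨κ⟩⟩ := exists_srcChart 𝒢 x.pt
  obtain ⟨L, -, hL⟩ := κ.exists_jet_functional ρ Θ
  have h : ∀ u : Alg 𝒢, ((coreSec ρ i u).1 x).1 Θ = L (0, Pi.single i (κ.loc u.1 x.pt)) :=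
    fun u => (coreSec_apply ρ i u x Θ).trans (hL i u)
  have e : ((0, Pi.single i (κ.loc (u + w).1 x.pt)) :
      EuclideanSpace ℝ (Fin n) × (Fin q → EuclideanSpace ℝ (Fin n))) =
      (0, Pi.single i (κ.loc u.1 x.pt)) + (0, Pi.single i (κ.loc w.1 x.pt)) := by
    rw [κ.loc_add, Pi.single_add, Prod.mk_add_mk, add_zero]
  refine ((h (u + w)).trans ((congrArg L e).trans (L.map_add _ _))).trans ?_
  exact (congrArg₂ (fun a b : ℝ => a + b) (h u).symm (h w).symm).trans (Sec.add_apply _ _ _ _).symm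

lemma coreSec_smul (ρ : Representation F C 𝒢) (i : Fin q) (f : smoothFunM EM M) (u : Alg 𝒢) :
    coreSec ρ i (f • u) = ptPull (F := F) (C := C) (q := q) f • coreSec ρ i u := by
  refine Sec.ext_apply fun x Θ => ?_
  obtain ⟨n, ⟨κ⟩⟩ := exists_srcChart 𝒢 x.pt
  obtain ⟨L, -, hL⟩ := κ.exists_jet_functional ρ Θ
  have h : ∀ u : Alg 𝒢, ((coreSec ρ i u).1 x).1 Θ = L (0, Pi.single i (κ.loc u.1 x.pt)) :=
    fun u => (coreSec_apply ρ i u x Θ).trans (hL i u)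
  have e : ((0, Pi.single i (κ.loc (f • u).1 x.pt)) :
      EuclideanSpace ℝ (Fin n) × (Fin q → EuclideanSpace ℝ (Fin n))) =
      f.1 x.pt • (0, Pi.single i (κ.loc u.1 x.pt)) := by
    rw [κ.loc_smul, Prod.smul_mk, smul_zero, Pi.single_smul]
  refine ((h (f • u)).trans ((congrArg L e).trans (L.map_smul _ _))).trans ?_
  exact (congrArg (fun a : ℝ => f.1 x.pt * a) (h u).symm).trans
    (Sec.smul_apply (ptPull f) (coreSec ρ i u) x Θ).symm

/-! ### Permutations of the tangent vectors -/

lemma related_perm_tangentSec (ρ : Representation F C 𝒢) (σ : Equiv.Perm (Fin q)) (u : Alg 𝒢) :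
    (perm ρ σ).Related (tangentSec ρ u) (tangentSec ρ u) := by
  intro x Θ
  rw [tangentSec_apply, tangentSec_apply]
  refine congrArg (fun f => deriv f 0) (funext fun ε => congrArg Θ.1 ?_)
  refine SrcFibre.ext_big ρ rfl (funext fun j => ?_)
  exact map_smul ((flow u x.pt).d ε x.pt) (1 : ℝ) (x.vec (σ j))

/-- `perm ρ σ` puts the vector of slot σ(j) into slot j, so a displacement in slot σ(i) becomes one
in slot i. -/
lemma related_perm_coreSec (ρ : Representation F C 𝒢) (σ : Equiv.Perm (Fin q)) (i : Fin q)
    (u : Alg 𝒢) : (perm ρ σ).Related (coreSec ρ (σ i) u) (coreSec ρ i u) := by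
  intro x Θ
  rw [coreSec_apply, coreSec_apply]
  refine congrArg (fun f => deriv f 0) (funext fun ε => congrArg Θ.1 ?_)
  refine SrcFibre.ext_big ρ rfl (funext fun j => ?_)
  change 𝒢.dunit x.pt ((1 : ℝ) • x.vec (σ j)) + (if j = i then ε else 0) • u.1 x.pt =
    (1 : ℝ) • (𝒢.dunit x.pt (x.vec (σ j)) + (if σ j = σ i then ε else 0) • u.1 x.pt)
  simp [σ.injective.eq_iff]

/-! ### Derivatives of curves in the fibres of `C` -/

variable (F) in
/-- Differentiability at `0` of a curve in a fibre of `C`. -/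
def FibreDifferentiable {x : M} (c : ℝ → C x) : Prop :=
  DifferentiableAt ℝ (fun ε => (trivializationAt F C x).continuousLinearEquivAt ℝ x
    (mem_baseSet_trivializationAt F C x) (c ε)) 0

/-- `fibreDeriv` is computed in a linear trivialization, so linear maps on the fibre pass through
it. This converts derivatives of C-valued curves into derivatives of real functions ⟨ξ, ·⟩. -/
lemma FibreDifferentiable.hasDerivAt {x : M} {c : ℝ → C x} (hc : FibreDifferentiable F c)
    {V : Type*} [NormedAddCommGroup V] [NormedSpace ℝ V] (T : C x →L[ℝ] V) :
    HasDerivAt (fun ε => T (c ε)) (T (fibreDeriv F c)) 0 := by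
  let e := (trivializationAt F C x).continuousLinearEquivAt ℝ x
    (mem_baseSet_trivializationAt F C x)
  have h1 : HasDerivAt (fun ε => e (c ε)) (deriv (fun ε => e (c ε)) 0) 0 :=
    DifferentiableAt.hasDerivAt hc
  have h2 := (T.comp (e.symm : F →L[ℝ] C x)).hasFDerivAt.comp_hasDerivAt (0 : ℝ) h1
  have h3 : (T.comp (e.symm : F →L[ℝ] C x)) ∘ (fun ε => e (c ε)) = fun ε => T (c ε) := by
    funext ε
    simp
  rw [h3] at h2
  exact h2

variable (F C) in
/-- The fibres of `C` are isomorphic to the model fibre. -/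
def fibreEquiv (x : M) : C x ≃L[ℝ] F :=
  (trivializationAt F C x).continuousLinearEquivAt ℝ x (mem_baseSet_trivializationAt F C x)

/-- The fibres of C carry a topology but no norm, so separation by functionals is transported from
the model fibre. Identities of C-valued forms thereby reduce to identities of functions on `𝔾_q`. -/
lemma eq_of_forall_cov {V : Type*} [AddCommGroup V] [Module ℝ V] [TopologicalSpace V]
    (e : V ≃L[ℝ] F) {a b : V} (h : ∀ ξ : V →L[ℝ] ℝ, ξ a = ξ b) : a = b :=
  e.injective (SeparatingDual.eq_iff_forall_dual_eq (R := ℝ).2 fun g =>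
    h (g.comp (e : V →L[ℝ] F)))

/-! ### Smooth families of tangent vectors -/

lemma Simplex.ext_of_eq {Ob Ar : Type*} {S : UnitalGraph Ob Ar} {p : ℕ} {b b' : Simplex S p}
    (hv : b.vert = b'.vert) (ha : b.arr = b'.arr) : b = b' := by
  cases b; cases b'; cases hv; cases ha; rfl

/-- The simplices to be compared are equal but rarely by definition, while tangent vectors, values
and covectors have types depending on them. All transport is confined here: tangent vectors are
compared by their components and covectors by `HEq`. -/
lemma PreForm.apply_congr {p n : ℕ} (θ : PreForm C 𝒢 p n) {b b' : B 𝒢 p} {w : Fin n → Tan b}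
    {w' : Fin n → Tan b'} {ξ : C (b.vert 0) →L[ℝ] ℝ} {ξ' : C (b'.vert 0) →L[ℝ] ℝ}
    (hv : b.vert = b'.vert) (ha : b.arr = b'.arr) (hw : ∀ j, (w j).1 = (w' j).1)
    (hξ : HEq ξ ξ') : ξ (θ b w) = ξ' (θ b' w') := by
  obtain rfl := Simplex.ext_of_eq hv ha
  obtain rfl := eq_of_heq hξ
  obtain rfl : w = w' := funext fun j => Subtype.ext (hw j)
  rfl

lemma IsSmoothFamily.comp {p n N K : ℕ} {b : EuclideanSpace ℝ (Fin N) → B 𝒢 p}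
    {w : ∀ y, Fin n → Tan (b y)} (h : IsSmoothFamily b w)
    {f : EuclideanSpace ℝ (Fin K) → EuclideanSpace ℝ (Fin N)} (hf : ContDiff ℝ ∞ f) :
    IsSmoothFamily (fun y => b (f y)) fun y => w (f y) :=
  ⟨fun i => ContMDiff.comp_contDiff (h.1 i) hf, fun i => ContMDiff.comp_contDiff (h.2.1 i) hf,
    fun j i => ContMDiff.comp_contDiff (h.2.2.1 j i) hf,
    fun j i => ContMDiff.comp_contDiff (h.2.2.2 j i) hf⟩

lemma IsSmoothFamily.const {p n N : ℕ} (b : B 𝒢 p) (w : Fin n → Tan b) :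
    IsSmoothFamily (fun _ : EuclideanSpace ℝ (Fin N) => b) fun _ => w :=
  ⟨fun _ => contMDiff_const, fun _ => contMDiff_const, fun _ _ => contMDiff_const,
    fun _ _ => contMDiff_const⟩

lemma IsSmoothFamily.cons {p n N : ℕ} {b : EuclideanSpace ℝ (Fin N) → B 𝒢 p}
    {w : ∀ y, Fin n → Tan (b y)} (hb : IsSmoothFamily b w)
    {h : ∀ y, SrcFibre 𝒢.toUnitalGraph ((b y).vert 0)} {x : EuclideanSpace ℝ (Fin N) → M}
    (hx : ∀ y, 𝒢.tgt (h y).1 = x y) {V : ∀ _ : EuclideanSpace ℝ (Fin N), Fin n → EG}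
    (hV : ∀ y j, 𝒢.dsrc (h y).1 (V y j) = (w y j).1.1 0)
    (hh : ContMDiff (𝓡 N) 𝓘(ℝ, EG) ∞ fun y => (h y).1)
    (hVs : ∀ j, ContMDiff (𝓡 N) 𝓘(ℝ, EG).tangent ∞ fun y => tvec (h y).1 (V y j)) :
    IsSmoothFamily (fun y => (b y).cons (h y) (hx y))
      fun y j => Tan.cons (h y) (hx y) (w y j) (V y j) (hV y j) := by
  obtain rfl : (fun y => 𝒢.tgt (h y).1) = x := funext hx
  refine ⟨fun i => ?_, fun i => ?_, fun j i => ?_, fun j i => ?_⟩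
  · refine Fin.cases ?_ (fun i => ?_) i
    · exact 𝒢.tgt_smooth.comp hh
    · exact hb.1 i
  · refine Fin.cases ?_ (fun i => ?_) i
    · exact hh
    · exact hb.2.1 i
  · refine Fin.cases ?_ (fun i => ?_) i
    · exact contMDiff_tvec_map 𝒢.tgt_smooth (hVs j)
    · exact hb.2.2.1 j i
  · refine Fin.cases ?_ (fun i => ?_) i
    · exact hVs j
    · exact hb.2.2.2 j i

/-- `w ↦ (D w₀, w)`, for a linear section `D` of `Ts` at `h`. -/
def Tan.consLin {p : ℕ} {b : B 𝒢 p} (h : SrcFibre 𝒢.toUnitalGraph (b.vert 0)) {x : M}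
    (hx : 𝒢.tgt h.1 = x) (D : EM →L[ℝ] EG) (hD : ∀ v, 𝒢.dsrc h.1 (D v) = v) :
    Tan b →ₗ[ℝ] Tan (b.cons h hx) where
  toFun w := Tan.cons h hx w (D (w.1.1 0)) (hD _)
  map_add' w w' := by
    refine Subtype.ext (Prod.ext (funext fun i => ?_) (funext fun i => ?_))
    · refine Fin.cases ?_ (fun i => rfl) i
      exact (congrArg (𝒢.dtgt h.1) (map_add D _ _)).trans (map_add _ _ _)
    · refine Fin.cases ?_ (fun i => rfl) i
      exact map_add D _ _
  map_smul' r w := by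
    refine Subtype.ext (Prod.ext (funext fun i => ?_) (funext fun i => ?_))
    · refine Fin.cases ?_ (fun i => rfl) i
      exact (congrArg (𝒢.dtgt h.1) (map_smul D r _)).trans (map_smul _ _ _)
    · refine Fin.cases ?_ (fun i => rfl) i
      exact map_smul D _ _

/-! ### The curve of which `R_u θ` is the derivative -/

/-- `ε ↦ Δ_{Φ_ε(t(g₁))⁻¹} θ(TΦ_ε(w₁), …, TΦ_ε(w_n))` at `(Φ_ε(t(g₁)), g₁, …, g_p)`. -/
def SrcFlow.formCurve (ρ : Representation F C 𝒢) (Φ : SrcFlow 𝒢) {p n : ℕ}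
    (θ : PreForm C 𝒢 (p + 1) n) (b : B 𝒢 p) (w : Fin n → Tan b) (ε : ℝ) : C (b.vert 0) :=
  ρ.act (𝒢.inv (Φ.toFun ε (b.vert 0))) (𝒢.src_inv _) ((𝒢.tgt_inv _).trans (Φ.src_eq _ _))
    (θ (b.cons (Φ.at (b.vert 0) ε) rfl) fun j =>
      Tan.cons (Φ.at (b.vert 0) ε) rfl (w j) (Φ.d ε (b.vert 0) ((w j).1.1 0)) (Φ.dsrc_d _ _ _))

lemma SrcFlow.contMDiff_formCurve (ρ : Representation F C 𝒢) (Φ : SrcFlow 𝒢) {p n N : ℕ}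
    {θ : PreForm C 𝒢 (p + 1) n} (hθ : IsForm F θ) {b : EuclideanSpace ℝ (Fin N) → B 𝒢 p}
    {w : ∀ y, Fin n → Tan (b y)} (hb : IsSmoothFamily b w)
    {ε : EuclideanSpace ℝ (Fin N) → ℝ} (hε : ContDiff ℝ ∞ ε) :
    ContMDiff (𝓡 N) (𝓘(ℝ, EM).prod 𝓘(ℝ, F)) ∞
      fun y => (⟨(b y).vert 0, Φ.formCurve ρ θ (b y) (w y) (ε y)⟩ : TotalSpace F C) := by
  have hg : ContMDiff (𝓡 N) 𝓘(ℝ, EG) ∞ fun y => Φ.toFun (ε y) ((b y).vert 0) :=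
    Φ.smooth.comp (hε.contMDiff.prodMk (hb.1 0))
  refine ρ.act_smooth_family (k := fun y => 𝒢.inv (Φ.toFun (ε y) ((b y).vert 0)))
    (fun y => 𝒢.src_inv _) (fun y => (𝒢.tgt_inv _).trans (Φ.src_eq _ _))
    (𝒢.inv_smooth.comp hg) ?_
  exact hθ.2 N _ _ (hb.cons (h := fun y => Φ.at ((b y).vert 0) (ε y)) (fun _ => rfl)
    (V := fun y j => Φ.d (ε y) ((b y).vert 0) ((w y j).1.1 0)) (fun _ _ => Φ.dsrc_d _ _ _) hg
    fun j => Φ.contMDiff_tvec_d hε.contMDiff (hb.2.2.1 j 0))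

lemma SrcFlow.fibreDifferentiable_formCurve (ρ : Representation F C 𝒢) (Φ : SrcFlow 𝒢) {p n : ℕ}
    {θ : PreForm C 𝒢 (p + 1) n} (hθ : IsForm F θ) (b : B 𝒢 p) (w : Fin n → Tan b) :
    FibreDifferentiable F (Φ.formCurve ρ θ b w) := by
  let T := toEuclidean (E := ℝ)
  have h1 := Φ.contMDiff_formCurve ρ hθ (IsSmoothFamily.const b w) T.symm.contDiff
  have h2 := ((Trivialization.contMDiff_iff (n := ∞) (IB := 𝓘(ℝ, EM))
    (e := trivializationAt F C (b.vert 0)) fun y => by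
      rw [Trivialization.mem_source]
      exact mem_baseSet_trivializationAt F C (b.vert 0)).1 h1).2
  have h3 := ((contMDiff_iff_contDiff.1 h2).comp T.contDiff).differentiable (by simp) 0
  simpa [FibreDifferentiable, Function.comp_def] using h3

lemma SrcFlow.exists_alternating_formCurve (ρ : Representation F C 𝒢) (Φ : SrcFlow 𝒢) {p n : ℕ}
    {θ : PreForm C 𝒢 (p + 1) n} (hθ : IsForm F θ) (b : B 𝒢 p) :
    ∃ A : ℝ → (Tan b) [⋀^Fin n]→ₗ[ℝ] C (b.vert 0),
      ∀ w ε, Φ.formCurve ρ θ b w ε = A ε w := by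
  have h : ∀ ε, ∃ A : (Tan b) [⋀^Fin n]→ₗ[ℝ] C (b.vert 0),
      ∀ w, Φ.formCurve ρ θ b w ε = A w := fun ε => by
    obtain ⟨A, hA⟩ := hθ.1 (b.cons (Φ.at (b.vert 0) ε) rfl)
    refine ⟨(ρ.act (𝒢.inv (Φ.toFun ε (b.vert 0))) (𝒢.src_inv _)
      ((𝒢.tgt_inv _).trans (Φ.src_eq _ _))).toLinearMap.compAlternatingMap
        (A.compLinearMap (Tan.consLin (Φ.at (b.vert 0) ε) rfl (Φ.d ε (b.vert 0))
          (Φ.dsrc_d ε (b.vert 0)))), fun w => ?_⟩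
    rw [SrcFlow.formCurve, ← hA]
    rfl
  choose A hA using h
  exact ⟨A, fun w ε => hA ε w⟩

/-! ### Functions on `B_p 𝔾_q` from forms of lower degree -/

/-- `(U₁, …, U_q, ξ) ↦ ⟨ξ, η(U_{e(1)}, …, U_{e(n)})⟩`. -/
def frakFunOn (ρ : Representation F C 𝒢) {p n : ℕ} (η : PreForm C 𝒢 p n) (e : Fin n → Fin q)
    (b : Simplex (big q ρ).toUnitalGraph p) : ℝ :=
  (b.vert 0).cov (η (baseSimplex b) fun j => tanVec b (e j))

/-- `frakFunOn` as a smooth function. -/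
def frakOn (ρ : Representation F C 𝒢) {p n : ℕ} (η : PreForm C 𝒢 p n) (hη : IsForm F η)
    (e : Fin n → Fin q) : smoothFun (Simplex (big q ρ).toUnitalGraph p) :=
  ⟨frakFunOn ρ η e, fun N b hb => by
    have hb' := Simplex.isPlot_iff.1 hb
    have hv := fun i => BigObj.isPlot_iff.1 (hb'.1 i)
    have ha := fun i => BigArr.isPlot_iff.1 (hb'.2 i)
    exact contDiff_dvec_apply (hv 0).2.2 (hη.2 N (fun y => baseSimplex (b y))
      (fun y j => tanVec (b y) (e j)) ⟨fun i => (hv i).1, fun i => (ha i).1,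
        fun j i => (hv i).2.1 (e j), fun j i => (ha i).2.1 (e j)⟩)⟩

/-- `(W₁, …, W_n, ξ)` as a point of `B_p 𝔾_n`. -/
def liftSimplex (ρ : Representation F C 𝒢) {p n : ℕ} (b : B 𝒢 p) (w : Fin n → Tan b)
    (ξ : C (b.vert 0) →L[ℝ] ℝ) : Simplex (big n ρ).toUnitalGraph p :=
  -- The source map of 𝔾_n on covectors is Δ_g^*, so the covector at the first vertex forces those
  -- at all later vertices.
  let cov : ∀ i : Fin (p + 1), C (b.vert i) →L[ℝ] ℝ :=
    Fin.induction ξ fun i c => c.comp (ρ.act (b.arr i) (b.src_arr i) (b.tgt_arr i))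
  { vert := fun i => ⟨b.vert i, fun j => (w j).1.1 i, cov i⟩
    arr := fun i => ⟨b.arr i, fun j => (w j).1.2 i, b.vert i.castSucc, b.tgt_arr i,
      cov i.castSucc⟩
    tgt_arr := fun i => by
      have h : (fun j => 𝒢.dtgt (b.arr i) ((w j).1.2 i)) = fun j => (w j).1.1 i.castSucc :=
        funext fun j => (w j).2.1 i
      simp only [big, h]
    src_arr := fun i => bigSrc_eq ρ (b.src_arr i) (fun j => (w j).2.2 i) fun c => by
      simp only [cov, Fin.induction_succ]
      rfl }

/-- The covector of the curve is ξ ∘ Δ_{Φ_ε⁻¹}, so pairing it with η on the prolonged tangent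
vectors already contains the action that occurs in `R_u`. -/
lemma restrictFirst_frakOn_curve (ρ : Representation F C 𝒢) (Φ : SrcFlow 𝒢) {p n : ℕ}
    {η : PreForm C 𝒢 (p + 1) n} (hη : IsForm F η) (e : Fin n → Fin q)
    (b : Simplex (big q ρ).toUnitalGraph p) (ε : ℝ) :
    (restrictFirst (big q ρ) (frakOn ρ η hη e) b).1 (Φ.curve ρ (b.vert 0) ε) =
      (b.vert 0).cov (Φ.formCurve ρ η (baseSimplex b) (fun j => tanVec b (e j)) ε) := by
  refine PreForm.apply_congr η (b := baseSimplex (b.cons (Φ.curve ρ (b.vert 0) ε) rfl))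
    (w := fun j => tanVec (b.cons (Φ.curve ρ (b.vert 0) ε) rfl) (e j))
    (b' := (baseSimplex b).cons (Φ.at (b.vert 0).pt ε) rfl)
    (w' := fun j => Tan.cons (b := baseSimplex b) (Φ.at (b.vert 0).pt ε) rfl (tanVec b (e j))
      (Φ.d ε (b.vert 0).pt ((tanVec b (e j)).1.1 0)) (Φ.dsrc_d _ _ _))
    (ξ := (Φ.curve ρ (b.vert 0) ε).1.cov) (ξ' := (Φ.curve ρ (b.vert 0) ε).1.cov)
    (funext fun i => ?_) (funext fun i => ?_)
    (fun j => Prod.ext (funext fun i => ?_) (funext fun i => ?_)) HEq.rfl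
  · exact Fin.cases rfl (fun i => rfl) i
  · exact Fin.cases rfl (fun i => rfl) i
  · exact Fin.cases rfl (fun i => rfl) i
  · exact Fin.cases rfl (fun i => rfl) i

/-- Paired with ξ, the two derivatives are derivatives of one function along the curves of Φ and Φ'
in a source fibre of 𝔾_n. These depend on the velocity u alone, so `RForm` does not depend on the
chosen flow. -/
lemma fibreDeriv_formCurve_congr (ρ : Representation F C 𝒢) {Φ Φ' : SrcFlow 𝒢} {u : Alg 𝒢}
    {p n : ℕ} {θ : PreForm C 𝒢 (p + 1) n} (hθ : IsForm F θ) {b : B 𝒢 p}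
    (h : Φ.HasVelocity u (b.vert 0)) (h' : Φ'.HasVelocity u (b.vert 0)) (w : Fin n → Tan b) :
    fibreDeriv F (Φ.formCurve ρ θ b w) = fibreDeriv F (Φ'.formCurve ρ θ b w) := by
  refine eq_of_forall_cov (fibreEquiv F C _) fun ξ => ?_
  rw [← ((Φ.fibreDifferentiable_formCurve ρ hθ b w).hasDerivAt ξ).deriv,
    ← ((Φ'.fibreDifferentiable_formCurve ρ hθ b w).hasDerivAt ξ).deriv]
  have h1 := SrcFlow.HasVelocity.deriv_eq ρ (x := (liftSimplex ρ b w ξ).vert 0) h h'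
    (restrictFirst (big n ρ) (frakOn ρ θ hθ id) (liftSimplex ρ b w ξ))
  simp only [restrictFirst_frakOn_curve] at h1
  exact h1

/-! ### The operators `R_u` and `J_u` preserve forms -/

lemma IsSmoothFamily.finCons {p n N : ℕ} {b : EuclideanSpace ℝ (Fin N) → B 𝒢 p}
    {w : ∀ y, Fin n → Tan (b y)} {v : ∀ y, Tan (b y)} (hw : IsSmoothFamily b w)
    (hv : IsSmoothFamily b fun y (_ : Fin 1) => v y) :
    IsSmoothFamily b fun y => Fin.cons (v y) (w y) :=
  ⟨hw.1, hw.2.1, fun j i => Fin.cases (hv.2.2.1 0 i) (fun j => hw.2.2.1 j i) j,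
    fun j i => Fin.cases (hv.2.2.2 0 i) (fun j => hw.2.2.2 j i) j⟩

lemma IsSmoothFamily.degVec {p n N : ℕ} {b : EuclideanSpace ℝ (Fin N) → B 𝒢 p}
    {w : ∀ y, Fin n → Tan (b y)} (hw : IsSmoothFamily b w) :
    IsSmoothFamily (fun y => (b y).deg) fun y j => degVec (w y j) :=
  hw.cons (h := fun y => SrcFibre.one 𝒢.toUnitalGraph ((b y).vert 0)) (fun _ => 𝒢.tgt_unit _)
    (fun _ _ => 𝒢.dsrc_dunit _ _) (𝒢.unit_smooth.comp (hw.1 0))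
    fun j => contMDiff_tvec_map 𝒢.unit_smooth (hw.2.2.1 j 0)

lemma IsSmoothFamily.insertVec {p n N : ℕ} {b : EuclideanSpace ℝ (Fin N) → B 𝒢 p}
    {w : ∀ y, Fin n → Tan (b y)} (hw : IsSmoothFamily b w) (u : Alg 𝒢) :
    IsSmoothFamily (fun y => (b y).deg) fun y (_ : Fin 1) => insertVec u (b y) := by
  have h0 : IsSmoothFamily b fun y (_ : Fin 1) => (0 : Tan (b y)) :=
    ⟨hw.1, hw.2.1, fun _ i => contMDiff_tvec_zero (hw.1 i),
      fun _ i => contMDiff_tvec_zero (hw.2.1 i)⟩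
  exact h0.cons (h := fun y => SrcFibre.one 𝒢.toUnitalGraph ((b y).vert 0))
    (fun _ => 𝒢.tgt_unit _) (V := fun y _ => u.1 ((b y).vert 0)) (fun y _ => u.2.2 ((b y).vert 0))
    (𝒢.unit_smooth.comp (hw.1 0)) fun _ => u.2.1.comp (hw.1 0)

/-- `degVec` as a linear map. -/
def degVecLin {p : ℕ} (b : B 𝒢 p) : Tan b →ₗ[ℝ] Tan b.deg :=
  Tan.consLin (SrcFibre.one 𝒢.toUnitalGraph (b.vert 0)) (𝒢.tgt_unit _) (𝒢.dunit (b.vert 0))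
    (𝒢.dsrc_dunit _)

lemma isForm_J (u : Alg 𝒢) {p n : ℕ} {θ : PreForm C 𝒢 (p + 1) (n + 1)} (hθ : IsForm F θ) :
    IsForm F (J u θ) := by
  refine ⟨fun b => ?_, fun N b w hb => ?_⟩
  · obtain ⟨A, hA⟩ := hθ.1 b.deg
    refine ⟨(A.curryLeft (insertVec u b)).compLinearMap (degVecLin b), funext fun w => ?_⟩
    rw [J, ← hA]
    rfl
  · exact hθ.2 N _ _ (hb.degVec.finCons (hb.insertVec u))

/-- At a fixed point the form is a derivative of alternating maps, and the identities pass to the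
limit after pairing with covectors. Smoothness comes from differentiating a smooth family in ε. -/
lemma isForm_RForm (ρ : Representation F C 𝒢) (u : Alg 𝒢) {p n : ℕ}
    {θ : PreForm C 𝒢 (p + 1) n} (hθ : IsForm F θ) : IsForm F (RForm ρ u θ) := by
  refine ⟨fun b => ?_, fun N b w hb y₀ => ?_⟩
  · obtain ⟨A, hA⟩ := (flow u (b.vert 0)).exists_alternating_formCurve ρ hθ b
    have hA' : ∀ w (ξ : C (b.vert 0) →L[ℝ] ℝ),
        HasDerivAt (fun ε => ξ (A ε w)) (ξ (RForm ρ u θ b w)) 0 := fun w ξ => by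
      simp only [← hA]
      exact ((flow u (b.vert 0)).fibreDifferentiable_formCurve ρ hθ b w).hasDerivAt ξ
    refine ⟨{ toFun := RForm ρ u θ b
              map_update_add' := fun w i x y => ?_
              map_update_smul' := fun w i r x => ?_
              map_eq_zero_of_eq' := fun w i j h hij => ?_ }, rfl⟩
    · refine eq_of_forall_cov (fibreEquiv F C _) fun ξ => ?_
      refine (hA' _ ξ).unique ?_
      simp only [AlternatingMap.map_update_add, map_add]
      exact (hA' _ ξ).add (hA' _ ξ)
    · refine eq_of_forall_cov (fibreEquiv F C _) fun ξ => ?_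
      refine (hA' _ ξ).unique ?_
      simp only [AlternatingMap.map_update_smul, map_smul]
      exact (hA' _ ξ).const_smul r
    · refine eq_of_forall_cov (fibreEquiv F C _) fun ξ => ?_
      refine (hA' _ ξ).unique ?_
      simp only [fun ε => (A ε).map_eq_zero_of_eq w h hij, map_zero]
      exact hasDerivAt_const _ _
  -- The flow chosen at y₀ serves all nearby parameters, by independence of the flow; the cutoff β
  -- keeps the points over one trivialization of C.
  · let Φ := flow u ((b y₀).vert 0)
    let e := trivializationAt F C ((b y₀).vert 0)
    have hbc : ContinuousAt (fun y => (b y).vert 0) y₀ := (hb.1 0).continuous.continuousAt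
    have hU : ∀ᶠ y in 𝓝 y₀, (b y).vert 0 ∈ e.baseSet := hbc.eventually_mem
      (e.open_baseSet.mem_nhds (mem_baseSet_trivializationAt F C ((b y₀).vert 0)))
    obtain ⟨β, hβ, hβU, hβ1⟩ := exists_cutoff hU
    have hg : ContDiff ℝ ∞ fun z : EuclideanSpace ℝ (Fin N) × ℝ =>
        (e ⟨(b (β z.1)).vert 0, Φ.formCurve ρ θ (b (β z.1)) (w (β z.1)) z.2⟩).2 := by
      let T := toEuclidean (E := EuclideanSpace ℝ (Fin N) × ℝ)
      have h1 := Φ.contMDiff_formCurve ρ hθ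
        (hb.comp (hβ.comp (contDiff_fst.comp T.symm.contDiff)))
        (contDiff_snd.comp T.symm.contDiff)
      have h2 := ((Trivialization.contMDiff_iff (n := ∞) (IB := 𝓘(ℝ, EM)) (e := e) fun y => by
        rw [Trivialization.mem_source]
        exact hβU _).1 h1).2
      have h3 := (contMDiff_iff_contDiff.1 h2).comp T.contDiff
      have h4 : ∀ gf : EuclideanSpace ℝ (Fin N) × ℝ → F,
          ContDiff ℝ ∞ (fun z => gf (T.symm (T z))) → ContDiff ℝ ∞ gf := fun gf h => by
        simpa only [T.symm_apply_apply] using h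
      exact h4 _ h3
    refine (Bundle.contMDiffAt_totalSpace ..).2 ⟨hb.1 0 y₀, ?_⟩
    refine ((contDiff_deriv_param hg).contMDiff.contMDiffAt).congr_of_eventuallyEq ?_
    filter_upwards [hβ1, hU,
      hbc.eventually (flow_hasVelocity u ((b y₀).vert 0)).eventually] with y hy hyU hyv
    change (e ⟨(b y).vert 0, RForm ρ u θ (b y) (w y)⟩).2 = deriv (fun ε =>
      (e ⟨(b (β y)).vert 0, Φ.formCurve ρ θ (b (β y)) (w (β y)) ε⟩).2) 0
    rw [hy]
    have h1 : RForm ρ u θ (b y) (w y) = fibreDeriv F (Φ.formCurve ρ θ (b y) (w y)) :=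
      fibreDeriv_formCurve_congr ρ hθ (flow_hasVelocity u _) hyv (w y)
    rw [h1]
    have h2 := ((Φ.fibreDifferentiable_formCurve ρ hθ (b y) (w y)).hasDerivAt
      (e.continuousLinearMapAt ℝ ((b y).vert 0))).deriv
    simp only [Trivialization.continuousLinearMapAt_apply_of_mem, hyU, e] at h2
    exact h2.symm

variable (C) in
lemma isForm_zero (p n : ℕ) : IsForm F (0 : PreForm C 𝒢 p n) :=
  ⟨fun _ => ⟨0, rfl⟩, fun _ _ _ hb =>
    (Bundle.contMDiff_zeroSection ℝ C).comp (hb.1 0)⟩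

lemma IsForm.smul_add {p n : ℕ} {θ θ' : PreForm C 𝒢 p n} (hθ : IsForm F θ) (hθ' : IsForm F θ')
    (r : ℝ) : IsForm F (r • θ + θ') := by
  refine ⟨fun b => ?_, fun N b w hb => ?_⟩
  · obtain ⟨A, hA⟩ := hθ.1 b
    obtain ⟨A', hA'⟩ := hθ'.1 b
    refine ⟨r • A + A', ?_⟩
    change _ = r • θ b + θ' b
    rw [← hA, ← hA']
    rfl
  · exact contMDiff_smul_add (f := fun y => (b y).vert 0) (a := fun _ => r) contMDiff_const
      (hθ.2 N b w hb) (hθ'.2 N b w hb)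

lemma IsForm.smul {p n : ℕ} {θ : PreForm C 𝒢 p n} (hθ : IsForm F θ) (r : ℝ) :
    IsForm F (r • θ) := by
  simpa using hθ.smul_add (isForm_zero C p n) r

lemma IsForm.sum_smul {p n : ℕ} {ι : Type*} (s : Finset ι) (r : ι → ℝ) {θ : ι → PreForm C 𝒢 p n}
    (hθ : ∀ i, IsForm F (θ i)) : IsForm F (∑ i ∈ s, r i • θ i) := by
  classical
  induction s using Finset.induction_on with
  | empty => exact isForm_zero C p n
  | insert a s ha ih =>
    rw [Finset.sum_insert ha]
    exact (hθ a).smul_add ih (r a)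

variable (F) in
/-- All components are forms. -/
def TotForm.IsForm {p : ℕ} (θ : TotForm C 𝒢 p) : Prop := ∀ n, VanEst.IsForm F (θ n)

lemma TotForm.isForm_single {p q : ℕ} {θ : PreForm C 𝒢 p q} (hθ : VanEst.IsForm F θ) :
    TotForm.IsForm F (TotForm.single θ) := by
  intro n
  unfold TotForm.single
  split_ifs with h
  · subst h
    exact hθ
  · exact isForm_zero C p n

lemma TotForm.single_same {p q : ℕ} (θ : PreForm C 𝒢 p q) : TotForm.single θ q = θ := by
  simp [TotForm.single]

/-! ### The operators `R_{𝒯u}` and `R_{𝒵_i v}` on the functions `𝔉_η` -/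

/-- Both sides differentiate the same curve; the covector ξ is constant in ε and passes through the
derivative. -/
lemma R_tangentSec_frakOn (ρ : Representation F C 𝒢) (u : Alg 𝒢) {p n : ℕ}
    {η : PreForm C 𝒢 (p + 1) n} (hη : IsForm F η) (e : Fin n → Fin q) :
    R (big q ρ) (tangentSec ρ u) (frakOn ρ η hη e) =
      frakOn ρ (RForm ρ u η) (isForm_RForm ρ u hη) e := by
  refine Subtype.ext (funext fun b => ?_)
  refine (tangentSec_apply ρ u (b.vert 0) _).trans ?_
  have h := ((flow u (b.vert 0).pt).fibreDifferentiable_formCurve ρ hη (baseSimplex b)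
    fun j => tanVec b (e j)).hasDerivAt (b.vert 0).cov
  refine Eq.trans (congrArg (fun f => deriv f 0) (funext fun ε => ?_)) h.deriv
  exact restrictFirst_frakOn_curve ρ _ hη e b ε

/-- The arrow in front stays a unit along the core curve. The tangent vectors are therefore images
under the differential of s₀, and only the one in slot i acquires a multiple of B_p v. -/
lemma restrictFirst_frakOn_coreCurve (ρ : Representation F C 𝒢) (i : Fin q) (v : Alg 𝒢) {p n : ℕ}
    {η : PreForm C 𝒢 (p + 1) n} (hη : IsForm F η) (e : Fin n → Fin q)
    (b : Simplex (big q ρ).toUnitalGraph p) (ε : ℝ) :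
    (restrictFirst (big q ρ) (frakOn ρ η hη e) b).1 (coreCurve ρ i v (b.vert 0) ε) =
      (b.vert 0).cov (η (baseSimplex b).deg fun j => degVec (tanVec b (e j)) +
        (if e j = i then ε else 0) • insertVec v (baseSimplex b)) := by
  refine PreForm.apply_congr η
    (b := baseSimplex (b.cons (coreCurve ρ i v (b.vert 0) ε) rfl))
    (w := fun j => tanVec (b.cons (coreCurve ρ i v (b.vert 0) ε) rfl) (e j))
    (b' := (baseSimplex b).deg)
    (w' := fun j => degVec (tanVec b (e j)) +
        (if e j = i then ε else 0) • insertVec v (baseSimplex b))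
    (ξ := (b.vert 0).cov) (ξ' := (b.vert 0).cov)
    (funext fun i => ?_) (funext fun i => ?_)
    (fun j => Prod.ext (funext fun k => ?_) (funext fun k => ?_)) HEq.rfl
  · exact Fin.cases rfl (fun i => rfl) i
  · exact Fin.cases rfl (fun i => rfl) i
  · refine Fin.cases ?_ (fun k => ?_) k
    · exact (map_add (𝒢.dtgt _) _ _).trans (congrArg₂ _ rfl (map_smul _ _ _))
    · change ((b.vert k).vec (e j) : EM) =
        (b.vert k).vec (e j) + (if e j = i then ε else 0) • (0 : EM)
      simp
  · refine Fin.cases rfl (fun k => ?_) k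
    change ((b.arr k).vec (e j) : EG) = (b.arr k).vec (e j) + (if e j = i then ε else 0) • (0 : EG)
    simp

/-- Moving the entry at position j to the front is a cycle of sign (-1)^j. -/
lemma map_insertNth_eq {K V W : Type*} [CommRing K] [AddCommGroup V] [Module K V]
    [AddCommGroup W] [Module K W] {n : ℕ} (A : V [⋀^Fin (n + 1)]→ₗ[K] W) (j : Fin (n + 1)) (x : V)
    (g : Fin n → V) : A (j.insertNth x g) = (-1 : K) ^ (j : ℕ) • A (Fin.cons x g) := by
  have h1 : (j.insertNth x g : Fin (n + 1) → V) = (Fin.cons x g : Fin (n + 1) → V) ∘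
      j.cycleRange := by
    funext i
    simp
  rw [h1, A.map_perm, Fin.sign_cycleRange, Units.smul_def, ← Int.cast_smul_eq_zsmul K]
  simp

lemma R_coreSec_frakOn_of_notMem (ρ : Representation F C 𝒢) {i : Fin q} (v : Alg 𝒢) {p n : ℕ}
    {η : PreForm C 𝒢 (p + 1) n} (hη : IsForm F η) {e : Fin n → Fin q} (hi : ∀ j, e j ≠ i) :
    R (big q ρ) (coreSec ρ i v) (frakOn ρ η hη e) = 0 := by
  refine Subtype.ext (funext fun b => ?_)
  refine (coreSec_apply ρ i v (b.vert 0) _).trans ?_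
  refine Eq.trans (congrArg (fun f => deriv f 0) (funext fun ε =>
    restrictFirst_frakOn_coreCurve ρ i v hη e b ε)) ?_
  simp [hi]

/-- Since e is injective, only the argument at position j moves, and it does so affinely in ε. The
derivative is η with B_p v at position j; bringing it to the front, where J_v has it, costs (-1)^j.
-/
lemma R_coreSec_frakOn (ρ : Representation F C 𝒢) (v : Alg 𝒢) {p n : ℕ}
    {η : PreForm C 𝒢 (p + 1) (n + 1)} (hη : IsForm F η) {e : Fin (n + 1) → Fin q}
    (he : Function.Injective e) (j : Fin (n + 1)) :
    R (big q ρ) (coreSec ρ (e j) v) (frakOn ρ η hη e) =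
      (-1 : ℝ) ^ (j : ℕ) • frakOn ρ (J v η) (isForm_J v hη) fun i => e (j.succAbove i) := by
  refine Subtype.ext (funext fun b => ?_)
  refine (coreSec_apply ρ (e j) v (b.vert 0) _).trans ?_
  refine Eq.trans (congrArg (fun f => deriv f 0) (funext fun ε =>
    restrictFirst_frakOn_coreCurve ρ (e j) v hη e b ε)) ?_
  obtain ⟨A, hA⟩ := hη.1 (baseSimplex b).deg
  let x := insertVec v (baseSimplex b)
  let g : Fin n → Tan (baseSimplex b).deg := fun i => degVec (tanVec b (e (j.succAbove i)))
  have h1 : ∀ ε : ℝ, (fun i => degVec (tanVec b (e i)) + (if e i = e j then ε else 0) • x) =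
      Function.update (fun i => degVec (tanVec b (e i))) j
        (degVec (tanVec b (e j)) + ε • x) := fun ε => by
    funext i
    by_cases h : i = j
    · subst h; simp
    · simp [h, he.eq_iff]
  have h2 : Function.update (fun i => degVec (tanVec b (e i))) j x = j.insertNth x g := by
    funext i
    rcases Fin.eq_self_or_eq_succAbove j i with rfl | ⟨i, rfl⟩
    · simp
    · simp [g]
  have h3 : ∀ ε : ℝ, (b.vert 0).cov (η (baseSimplex b).deg fun i => degVec (tanVec b (e i)) +
      (if e i = e j then ε else 0) • x) =
      (b.vert 0).cov (A fun i => degVec (tanVec b (e i))) +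
        ε * ((-1) ^ (j : ℕ) * (b.vert 0).cov (A (Fin.cons x g))) := fun ε => by
    rw [h1, ← hA, A.map_update_add, A.map_update_smul, h2, map_insertNth_eq,
      Function.update_eq_self]
    refine (map_add (b.vert 0).cov _ _).trans (congrArg₂ _ rfl ?_)
    refine (map_smul (b.vert 0).cov _ _).trans (congrArg (ε * ·) ?_)
    exact map_smul (b.vert 0).cov _ _
  refine Eq.trans (congrArg (fun f => deriv f 0) (funext h3)) ?_
  have h4 := (((hasDerivAt_id (0 : ℝ)).mul_const
    ((-1) ^ (j : ℕ) * (b.vert 0).cov (A (Fin.cons x g)))).const_add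
      ((b.vert 0).cov (A fun i => degVec (tanVec b (e i))))).deriv
  refine h4.trans ?_
  rw [one_mul, hA]
  rfl

/-! ### Iterated operators -/

/-- The section `𝒵_i v` if the slot `i` is given, `𝒯 v` otherwise. -/
def slotSec (ρ : Representation F C 𝒢) (a : Option (Fin q) × Alg 𝒢) :
    Sec (big q ρ).toUnitalGraph :=
  a.1.elim (tangentSec ρ a.2) fun i => coreSec ρ i a.2

/-- The operator `J_v` if a slot is given, `R_v` otherwise. -/
def slotOp (ρ : Representation F C 𝒢) (a : Option (Fin q) × Alg 𝒢) (m : ℕ)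
    (θ : TotForm C 𝒢 (m + 1)) : TotForm C 𝒢 m :=
  a.1.elim (TotForm.R ρ a.2 θ) fun _ => TotForm.J a.2 θ

lemma TotForm.IsForm.slotOp (ρ : Representation F C 𝒢) (a : Option (Fin q) × Alg 𝒢) {m : ℕ}
    {θ : TotForm C 𝒢 (m + 1)} (hθ : θ.IsForm F) : (VanEst.slotOp ρ a m θ).IsForm F := by
  obtain ⟨s | s, u⟩ := a
  · exact fun n => isForm_RForm ρ u (hθ n)
  · exact fun n => isForm_J u (hθ (n + 1))

lemma TotForm.IsForm.iterD (ρ : Representation F C 𝒢) : ∀ {p : ℕ}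
    (a : Fin p → Option (Fin q) × Alg 𝒢) {θ : TotForm C 𝒢 p}, θ.IsForm F →
    (VanEst.iterD (fun i => VanEst.slotOp ρ (a i)) θ).IsForm F
  | 0, _, _, hθ => hθ
  | _ + 1, a, _, hθ => TotForm.IsForm.iterD ρ (fun i => a i.castSucc) (hθ.slotOp ρ (a (Fin.last _)))

/-- The number of entries of `e` below the slot of the `i`-th operator that are not used by the
operators applied before it. -/
def slotCount {p n : ℕ} (a : Fin p → Option (Fin q) × Alg 𝒢) (e : Fin n → Fin q) (i : Fin p) : ℕ :=
  (a i).1.elim 0 fun s =>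
    Set.ncard {s' | s' ∈ Set.range e ∧ s' < s ∧ ∀ j, i < j → (a j).1 ≠ some s'}

/-- Deleting from e the slot consumed by the last operator has the same effect as the condition at
the last index, which lies to the right of every other one. -/
lemma slotCount_castSucc {p n n' : ℕ} {a : Fin (p + 1) → Option (Fin q) × Alg 𝒢}
    {e : Fin n → Fin q} {e' : Fin n' → Fin q}
    (h : ∀ s, s ∈ Set.range e' ↔ s ∈ Set.range e ∧ (a (Fin.last p)).1 ≠ some s) (i : Fin p) :
    slotCount (fun i => a i.castSucc) e' i = slotCount a e i.castSucc := by
  unfold slotCount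
  refine congrArg (fun f => (a i.castSucc).1.elim 0 f) (funext fun s => ?_)
  congr 1
  ext s'
  simp only [Set.mem_ofPred_eq, h, Fin.forall_fin_succ', Fin.castSucc_lt_castSucc_iff,
    Fin.castSucc_lt_last, true_imp_iff]
  tauto

lemma ncard_range_lt {n : ℕ} {e : Fin n → Fin q} (he : StrictMono e) (j : Fin n) :
    Set.ncard {s | s ∈ Set.range e ∧ s < e j} = j := by
  have h : {s | s ∈ Set.range e ∧ s < e j} = e '' Set.Iio j := by
    ext s
    constructor
    · rintro ⟨⟨i, rfl⟩, hi⟩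
      exact ⟨i, he.lt_iff_lt.1 hi, rfl⟩
    · rintro ⟨i, hi, rfl⟩
      exact ⟨⟨i, rfl⟩, he hi⟩
  rw [h, Set.ncard_image_of_injective _ he.injective]
  simp [Set.ncard_eq_toFinset_card']

/-- An increasing enumeration is determined by its range, including its length. -/
lemma frakOn_congr (ρ : Representation F C 𝒢) {p n r : ℕ} {θ : TotForm C 𝒢 p} (hθ : θ.IsForm F)
    {e : Fin n → Fin q} {e' : Fin r → Fin q} (he : StrictMono e) (he' : StrictMono e')
    (h : ∀ s, s ∈ Set.range e' ↔ s ∈ Set.range e) :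
    frakOn ρ (θ n) (hθ n) e = frakOn ρ (θ r) (hθ r) e' := by
  have h1 : Set.range e' = Set.range e := Set.ext h
  obtain rfl : n = r := by
    have h2 := congrArg Set.ncard h1
    rw [← Set.image_univ, ← Set.image_univ, Set.ncard_image_of_injective _ he.injective,
      Set.ncard_image_of_injective _ he'.injective] at h2
    simpa using h2.symm
  obtain rfl := (he'.range_inj he).1 h1
  rfl

/-- The iterated operators on `𝔉_η`, in terms of those on forms. -/
lemma iterR_frakOn (ρ : Representation F C 𝒢) : ∀ {p : ℕ} (a : Fin p → Option (Fin q) × Alg 𝒢)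
    {n r : ℕ} {θ : TotForm C 𝒢 p} (hθ : θ.IsForm F) {e : Fin n → Fin q} {e' : Fin r → Fin q},
    StrictMono e → StrictMono e' →
    (∀ i j s, (a i).1 = some s → (a j).1 = some s → i = j) →
    (∀ i s, (a i).1 = some s → s ∈ Set.range e) →
    (∀ s, s ∈ Set.range e' ↔ s ∈ Set.range e ∧ ∀ i, (a i).1 ≠ some s) →
    iterR (big q ρ) (fun i => slotSec ρ (a i)) (frakOn ρ (θ n) (hθ n) e) =
      (-1 : ℝ) ^ (∑ i, slotCount a e i) •
        frakOn ρ (iterD (fun i => slotOp ρ (a i)) θ r) (hθ.iterD ρ a r) e'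
  | 0, a, n, r, θ, hθ, e, e', he, he', _, _, hr => by
    simp only [Finset.univ_eq_empty, Finset.sum_empty, pow_zero, one_smul]
    exact frakOn_congr ρ hθ he he' fun s => by simp [hr]
  | p + 1, a, n, r, θ, hθ, e, e', he, he', ha, hs, hr => by
    have hinj : ∀ (i j : Fin p) s, (a i.castSucc).1 = some s → (a j.castSucc).1 = some s → i = j :=
      fun i j s hi hj => Fin.castSucc_injective _ (ha _ _ s hi hj)
    rw [Fin.sum_univ_castSucc]
    -- The last operator acts first. A tangent section leaves the slots unchanged and contributes no
    -- sign; a core section removes its slot from e.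
    rcases hl : a (Fin.last p) with ⟨_ | s, u⟩
    · have h1 : ∀ s, s ∈ Set.range e ↔ s ∈ Set.range e ∧ (a (Fin.last p)).1 ≠ some s := by
        simp [hl]
      have h2 := iterR_frakOn ρ (fun i => a i.castSucc) (hθ.slotOp ρ (a (Fin.last p))) he he' hinj
        (fun i s h => hs i.castSucc s h)
        (fun s => by rw [hr, Fin.forall_fin_succ']; simp [hl])
      simp only [slotCount_castSucc h1] at h2
      have h3 : slotCount a e (Fin.last p) = 0 := by simp [slotCount, hl]
      rw [h3, add_zero]
      refine Eq.trans ?_ h2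
      refine congrArg (iterR (big q ρ) fun i => slotSec ρ (a i.castSucc)) ?_
      have h4 := R_tangentSec_frakOn ρ u (hθ n) e
      simp only [hl]
      exact h4
    · obtain ⟨j, rfl⟩ := hs (Fin.last p) s (by rw [hl])
      cases n with
      | zero => exact j.elim0
      | succ n =>
        have h1 : ∀ s, s ∈ Set.range (fun i => e (j.succAbove i)) ↔
            s ∈ Set.range e ∧ (a (Fin.last p)).1 ≠ some s := by
          intro s
          rw [hl]
          constructor
          · rintro ⟨i, rfl⟩
            exact ⟨⟨_, rfl⟩, fun h => Fin.succAbove_ne j i (he.injective (Option.some.inj h)).symm⟩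
          · rintro ⟨⟨i, rfl⟩, h⟩
            obtain ⟨i, rfl⟩ := Fin.exists_succAbove_eq (x := i) (y := j)
              (fun hi => h (by rw [hi]))
            exact ⟨i, rfl⟩
        have h2 := iterR_frakOn ρ (fun i => a i.castSucc) (hθ.slotOp ρ (a (Fin.last p)))
          (he.comp (Fin.strictMono_succAbove j)) he' hinj
          (fun i s h => (h1 s).2 ⟨hs i.castSucc s h, fun h' => by
            have := ha _ _ s h h'
            exact absurd this (Fin.castSucc_lt_last i).ne⟩)
          (fun s => by
            refine (hr s).trans ?_
            rw [Fin.forall_fin_succ']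
            have := h1 s
            simp only [Function.comp_def]
            tauto)
        -- Nothing has acted before the last operator, so its count is the position j of its slot in
        -- e, the exponent in `R_coreSec_frakOn`.
        have h3 : slotCount a e (Fin.last p) = j := by
          have h5 : {s' | s' ∈ Set.range e ∧ s' < e j ∧
              ∀ i, Fin.last p < i → (a i).1 ≠ some s'} = {s | s ∈ Set.range e ∧ s < e j} := by
            ext s
            simp [Fin.not_lt.2 (Fin.le_last _)]
          simp only [slotCount, hl, Option.elim_some]
          rw [h5, ncard_range_lt he]
        have h4 : R (big q ρ) (slotSec ρ (a (Fin.last p))) (frakOn ρ (θ (n + 1)) (hθ (n + 1)) e) =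
            (-1 : ℝ) ^ (j : ℕ) • frakOn ρ (slotOp ρ (a (Fin.last p)) p θ n)
              (hθ.slotOp ρ (a (Fin.last p)) n) fun i => e (j.succAbove i) := by
          simp only [hl]
          exact R_coreSec_frakOn ρ u (hθ (n + 1)) he.injective j
        simp only [slotCount_castSucc (e' := e ∘ j.succAbove) h1] at h2
        rw [h3, pow_add, mul_comm, mul_smul]
        refine Eq.trans ?_ (congrArg (fun f => (-1 : ℝ) ^ (j : ℕ) • f) h2)
        refine (congrArg (iterR (big q ρ) fun i => slotSec ρ (a i.castSucc)) h4).trans ?_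
        exact iterR_smul_right _ _ _

/-- The iterated operators vanish on `𝔉_η` if a slot is used twice or does not occur in `η`. -/
lemma iterR_frakOn_eq_zero (ρ : Representation F C 𝒢) : ∀ {p : ℕ}
    (a : Fin p → Option (Fin q) × Alg 𝒢) {n : ℕ} {θ : TotForm C 𝒢 p} (hθ : θ.IsForm F)
    {e : Fin n → Fin q}, StrictMono e →
    (∃ i s, (a i).1 = some s ∧ (s ∉ Set.range e ∨ ∃ j, i < j ∧ (a j).1 = some s)) →
    iterR (big q ρ) (fun i => slotSec ρ (a i)) (frakOn ρ (θ n) (hθ n) e) = 0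
  | 0, _, _, _, _, _, _, h => h.choose.elim0
  | p + 1, a, n, θ, hθ, e, he, ⟨i, s, his, h⟩ => by
    -- Either the operator acting first annihilates the function, or it leaves a multiple of a
    -- function of the same kind with the same defect for the remaining operators.
    suffices h1 : R (big q ρ) (slotSec ρ (a (Fin.last p))) (frakOn ρ (θ n) (hθ n) e) = 0 ∨
        ∃ (r : ℝ) (m : ℕ) (e' : Fin m → Fin q), StrictMono e' ∧
        (∃ i s, (a (Fin.castSucc i)).1 = some s ∧ (s ∉ Set.range e' ∨
          ∃ j, i < j ∧ (a (Fin.castSucc j)).1 = some s)) ∧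
        R (big q ρ) (slotSec ρ (a (Fin.last p))) (frakOn ρ (θ n) (hθ n) e) =
          r • frakOn ρ (slotOp ρ (a (Fin.last p)) p θ m) (hθ.slotOp ρ (a (Fin.last p)) m) e' by
      change iterR (big q ρ) (fun i => slotSec ρ (a i.castSucc)) (R (big q ρ) _ _) = 0
      rcases h1 with h1 | ⟨r, m, e', he', hi, h1⟩
      · rw [h1, iterR_zero_right]
      · rw [h1, iterR_smul_right, iterR_frakOn_eq_zero ρ (fun i => a i.castSucc) _ he' hi,
          smul_zero]
    rcases hl : a (Fin.last p) with ⟨_ | t, u⟩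
    · right
      refine ⟨1, n, e, he, ?_, ?_⟩
      · have hi : i ≠ Fin.last p := by
          rintro rfl
          rw [hl] at his
          cases his
        obtain ⟨i, rfl⟩ := Fin.exists_castSucc_eq.2 hi
        refine ⟨i, s, his, h.imp_right ?_⟩
        rintro ⟨j, hij, hj⟩
        have hj' : j ≠ Fin.last p := by
          rintro rfl
          rw [hl] at hj
          cases hj
        obtain ⟨j, rfl⟩ := Fin.exists_castSucc_eq.2 hj'
        exact ⟨j, hij, hj⟩
      · rw [one_smul]
        exact R_tangentSec_frakOn ρ u (hθ n) e
    · by_cases ht : t ∈ Set.range e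
      · right
        obtain ⟨j, rfl⟩ := ht
        cases n with
        | zero => exact j.elim0
        | succ n =>
          refine ⟨(-1) ^ (j : ℕ), n, fun i => e (j.succAbove i),
            he.comp (Fin.strictMono_succAbove j), ?_,
            R_coreSec_frakOn ρ u (hθ (n + 1)) he.injective j⟩
          have hsub : Set.range (fun i => e (j.succAbove i)) ⊆ Set.range e := by
            rintro _ ⟨i, rfl⟩
            exact ⟨_, rfl⟩
          have hi : i ≠ Fin.last p := by
            rintro rfl
            rw [hl] at his
            obtain rfl := Option.some.inj his
            rcases h with h | ⟨j, hj, -⟩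
            · exact h ⟨_, rfl⟩
            · exact absurd hj (Fin.not_lt.2 (Fin.le_last _))
          obtain ⟨i, rfl⟩ := Fin.exists_castSucc_eq.2 hi
          refine ⟨i, s, his, ?_⟩
          rcases h with h | ⟨k, hik, hk⟩
          · exact Or.inl fun h' => h (hsub h')
          -- If the second use of the slot is the operator just applied, the slot has now
          -- disappeared, and the repeated slot has become a missing one.
          · by_cases hk' : k = Fin.last p
            · subst hk'
              rw [hl] at hk
              obtain rfl := Option.some.inj hk
              left
              rintro ⟨i, hi⟩
              exact Fin.succAbove_ne j i (he.injective hi)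
            · obtain ⟨k, rfl⟩ := Fin.exists_castSucc_eq.2 hk'
              exact Or.inr ⟨k, hik, hk⟩
      · left
        exact R_coreSec_frakOn_of_notMem ρ u (hθ n) fun j hj => ht ⟨j, hj⟩

/-! ### The evaluation of `VE(𝔉_θ)` -/

/-- The slots and sections of `𝒵₁v₁, …, 𝒵_k v_k, 𝒯u₁, …, 𝒯u_l`. -/
def evSlot {p k l r : ℕ} (hp : k + l = p) (hq : k + r = q) (u : Fin l → Alg 𝒢)
    (v : Fin k → Alg 𝒢) (j : Fin p) : Option (Fin q) × Alg 𝒢 :=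
  Fin.addCases (motive := fun _ => Option (Fin q) × Alg 𝒢)
    (fun i => (some (Fin.cast hq (Fin.castAdd r i)), v i)) (fun i => (none, u i))
    (Fin.cast hp.symm j)

lemma slotSec_evSlot (ρ : Representation F C 𝒢) {p k l r : ℕ} (hp : k + l = p) (hq : k + r = q)
    (u : Fin l → Alg 𝒢) (v : Fin k → Alg 𝒢) (j : Fin p) :
    slotSec ρ (evSlot hp hq u v j) = evArgs ρ hp hq u v j := by
  subst hp
  refine Fin.addCases (fun i => ?_) (fun i => ?_) j <;> simp [slotSec, evSlot, evArgs]

lemma slotOp_evSlot (ρ : Representation F C 𝒢) {p k l r : ℕ} (hp : k + l = p) (hq : k + r = q)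
    (u : Fin l → Alg 𝒢) (v : Fin k → Alg 𝒢) (j : Fin p) :
    slotOp ρ (evSlot hp hq u v j) = Dop ρ hp u v j := by
  subst hp
  funext m θ
  refine Fin.addCases (fun i => ?_) (fun i => ?_) j <;> simp [slotOp, evSlot, Dop]

lemma evSlot_eq_some {p k l r : ℕ} (hp : k + l = p) (hq : k + r = q) (u : Fin l → Alg 𝒢)
    (v : Fin k → Alg 𝒢) (j : Fin p) (s : Fin q) :
    (evSlot hp hq u v j).1 = some s ↔ (j : ℕ) = s ∧ (j : ℕ) < k := by
  subst hp
  refine Fin.addCases (fun i => ?_) (fun i => ?_) j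
  · simp [evSlot, Fin.ext_iff]
  · simp [evSlot]

/-- The number of pairs `m' < m < k` with `σ⁻¹ m' < σ⁻¹ m`, for given `m`. -/
lemma slotCount_evSlot {p k l r : ℕ} (hp : k + l = p) (hq : k + r = q) (u : Fin l → Alg 𝒢)
    (v : Fin k → Alg 𝒢) (σ : Equiv.Perm (Fin p)) (m : Fin p) :
    slotCount (fun i => evSlot hp hq u v (σ i)) (id : Fin q → Fin q) (σ⁻¹ m) =
      ∑ m' : Fin p, if m' < m ∧ (m : ℕ) < k ∧ σ⁻¹ m' < σ⁻¹ m then 1 else 0 := by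
  have hσ : ∀ m, σ (σ⁻¹ m) = m := σ.apply_symm_apply
  have h0 := hσ m
  by_cases hm : (m : ℕ) < k
  · have h1 : (evSlot hp hq u v m).1 = some ⟨m, by omega⟩ := (evSlot_eq_some ..).2 ⟨rfl, hm⟩
    simp only [slotCount, h0, h1, Option.elim_some, hm, true_and]
    -- Slots lie in `Fin q` and operators in `Fin p`, so the sets are compared inside ℕ. A slot s <
    -- m is still unused when m acts exactly if its operator, which also has number s, stands
    -- further to the left.
    rw [← Finset.card_filter, ← Set.ncard_coe_finset,
      ← Set.ncard_image_of_injective _ Fin.val_injective,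
      ← Set.ncard_image_of_injective (SetLike.coe (Finset.filter _ _)) Fin.val_injective]
    congr 1
    ext i
    simp only [Set.mem_image, Set.mem_ofPred_eq, Finset.coe_filter, Finset.mem_univ, true_and,
      Set.range_id, Set.mem_univ, Fin.lt_def]
    constructor
    · rintro ⟨s, ⟨hs, h⟩, rfl⟩
      refine ⟨⟨s, by omega⟩, ⟨hs, ?_⟩, rfl⟩
      by_contra hlt
      have hne : σ⁻¹ m ≠ σ⁻¹ ⟨s, by omega⟩ := fun h' => by
        have := congrArg Fin.val (σ⁻¹.injective h')
        simp only at this hs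
        omega
      refine h (σ⁻¹ ⟨s, by omega⟩) (lt_of_le_of_ne (not_lt.1 hlt) (Fin.val_injective.ne hne)) ?_
      rw [evSlot_eq_some, hσ]
      exact ⟨rfl, lt_trans hs hm⟩
    · rintro ⟨s, ⟨hs, h⟩, rfl⟩
      refine ⟨⟨s, by omega⟩, ⟨hs, fun j hj hs' => ?_⟩, rfl⟩
      have h2 : σ j = s := Fin.ext ((evSlot_eq_some ..).1 hs').1
      have h3 : j = σ⁻¹ s := (σ.symm_apply_apply j).symm.trans (congrArg _ h2)
      subst h3
      exact absurd hj (not_lt.2 (Fin.le_def.1 (le_of_lt h)))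
  · have h1 : (evSlot hp hq u v m).1 = none := by
      rw [Option.eq_none_iff_forall_ne_some]
      intro s hs
      exact hm ((evSlot_eq_some ..).1 hs).2
    simp only [slotCount, h0, h1, Option.elim_none, hm, false_and, and_false, if_false,
      Finset.sum_const_zero]

/-- Each pair m' < m < k is counted once: by `slotCount` if σ⁻¹(m') < σ⁻¹(m), by `eps` otherwise.
The total is the number of pairs below k, which accounts for both signs in `VEΩ`. -/
lemma sum_slotCount_add_eps {p k l r : ℕ} (hp : k + l = p) (hq : k + r = q) (u : Fin l → Alg 𝒢)
    (v : Fin k → Alg 𝒢) (σ : Equiv.Perm (Fin p)) :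
    (∑ i, slotCount (fun i => evSlot hp hq u v (σ i)) (id : Fin q → Fin q) i) + eps σ k =
      k * (k - 1) / 2 := by
  rw [← Equiv.sum_comp (σ⁻¹ : Equiv.Perm (Fin p))]
  simp only [slotCount_evSlot]
  rw [eps, Finset.card_filter, Fintype.sum_prod_type_right, ← Finset.sum_add_distrib]
  have h1 : ∀ m : Fin p, ((∑ m' : Fin p, if m' < m ∧ (m : ℕ) < k ∧ σ⁻¹ m' < σ⁻¹ m then 1 else 0) +
      ∑ m' : Fin p, if m' < m ∧ (m : ℕ) < k ∧ σ⁻¹ m < σ⁻¹ m' then 1 else 0) =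
      if (m : ℕ) < k then (m : ℕ) else 0 := fun m => by
    rw [← Finset.sum_add_distrib]
    have h2 : ∀ m' : Fin p, ((if m' < m ∧ (m : ℕ) < k ∧ σ⁻¹ m' < σ⁻¹ m then 1 else 0) +
        if m' < m ∧ (m : ℕ) < k ∧ σ⁻¹ m < σ⁻¹ m' then 1 else 0) =
        if m' < m then (if (m : ℕ) < k then 1 else 0) else 0 := fun m' => by
      by_cases h : m' < m
      · have hne : σ⁻¹ m' ≠ σ⁻¹ m := fun h' => h.ne (σ⁻¹.injective h')
        rcases lt_or_gt_of_ne hne with h3 | h3 <;> simp only [h, h3, not_lt.2 h3.le, true_and,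
          and_true, and_false, if_true, if_false, add_zero, zero_add]
      · simp [h]
    simp only [h2]
    rw [← Finset.sum_filter, Finset.sum_const, Finset.filter_gt_eq_Iio, Fin.card_Iio, smul_eq_mul]
    simp
  simp only [h1]
  rw [Fin.sum_univ_eq_sum_range (fun m => if m < k then m else 0) p, ← Finset.sum_filter,
    ← Finset.sum_range_id]
  congr 1
  ext i
  simp
  omega

lemma isForm_VEΩ (ρ : Representation F C 𝒢) {p : ℕ} (θ : Form F C 𝒢 p q) {k l r : ℕ}
    (hp : k + l = p) (hq : k + r = q) (u : Fin l → Alg 𝒢) (v : Fin k → Alg 𝒢) :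
    IsForm F (VEΩ ρ θ.1 k l r hp hq u v) := by
  refine IsForm.smul (IsForm.sum_smul _ _ fun σ => ?_) _
  have h := (TotForm.isForm_single θ.2).iterD ρ (fun i => evSlot hp hq u v (σ i)) r
  simp only [slotOp_evSlot] at h
  exact h

lemma frakFunOn_pt (ρ : Representation F C 𝒢) {k r : ℕ} (hq : k + r = q) (η : PreForm C 𝒢 0 r)
    (x : BigObj F EM C q) :
    frakFunOn ρ η (fun j => Fin.cast hq (Fin.natAdd k j)) (Simplex.pt (big q ρ).toUnitalGraph x) =
      frakFun ρ η (Simplex.pt (big r ρ).toUnitalGraph (forget hq x)) :=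
  PreForm.apply_congr η
    (w := fun j => tanVec (Simplex.pt (big q ρ).toUnitalGraph x) (Fin.cast hq (Fin.natAdd k j)))
    (w' := tanVec (Simplex.pt (big r ρ).toUnitalGraph (forget hq x)))
    (ξ := x.cov) (ξ' := x.cov) rfl
    (funext fun i => i.elim0) (fun _ => Prod.ext rfl (funext fun i => i.elim0)) HEq.rfl

lemma strictMono_natAdd {k r : ℕ} (hq : k + r = q) :
    StrictMono fun j : Fin r => Fin.cast hq (Fin.natAdd k j) := by
  intro i j h
  simpa using h

lemma range_natAdd {k r : ℕ} (hq : k + r = q) (s : Fin q) :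
    s ∈ Set.range (fun j : Fin r => Fin.cast hq (Fin.natAdd k j)) ↔ k ≤ s := by
  constructor
  · rintro ⟨j, rfl⟩
    simp
  · intro h
    exact ⟨⟨s - k, by omega⟩, Fin.ext (by simp; omega)⟩

lemma iterR_evArgs (ρ : Representation F C 𝒢) {p : ℕ} (θ : Form F C 𝒢 p q) {k l r : ℕ}
    (hp : k + l = p) (hq : k + r = q) (u : Fin l → Alg 𝒢) (v : Fin k → Alg 𝒢)
    (σ : Equiv.Perm (Fin p)) (x : BigObj F EM C q) :
    (iterR (big q ρ) (fun i => evArgs ρ hp hq u v (σ i)) (frak ρ θ)).1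
      (Simplex.pt (big q ρ).toUnitalGraph x) =
    ((-1) ^ (k * (k - 1) / 2) * (-1) ^ eps σ k) *
      frakFun ρ (iterD (fun i => Dop ρ hp u v (σ i)) (TotForm.single θ.1) r)
        (Simplex.pt (big r ρ).toUnitalGraph (forget hq x)) := by
  have h := iterR_frakOn ρ (fun i => evSlot hp hq u v (σ i)) (TotForm.isForm_single θ.2)
    (e := (id : Fin q → Fin q)) (e' := fun j : Fin r => Fin.cast hq (Fin.natAdd k j))
    strictMono_id (strictMono_natAdd hq)
    (fun i j s hi hj => σ.injective (Fin.ext (((evSlot_eq_some ..).1 hi).1.trans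
      ((evSlot_eq_some ..).1 hj).1.symm))) (fun _ s _ => ⟨s, rfl⟩)
    -- Wherever σ places them, the core operators consume exactly the first k slots, so those with s
    -- ≥ k remain.
    (fun s => by
      rw [range_natAdd]
      simp only [Set.range_id, Set.mem_univ, true_and, ne_eq, evSlot_eq_some, not_and]
      constructor
      · intro h i hi
        omega
      · intro h
        by_contra hs
        have h1 := h (σ⁻¹ ⟨s, by omega⟩)
        rw [show σ (σ⁻¹ _) = _ from σ.apply_symm_apply _] at h1
        exact h1 rfl (by simpa using hs))
  have h1 : frakOn ρ (TotForm.single θ.1 q) (TotForm.isForm_single θ.2 q) id = frak ρ θ := by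
    refine Subtype.ext (funext fun b => ?_)
    change frakFunOn ρ (TotForm.single θ.1 q) id b = frakFunOn ρ θ.1 id b
    rw [TotForm.single_same]
  have h2 := sum_slotCount_add_eps hp hq u v σ
  simp only [slotSec_evSlot, slotOp_evSlot] at h
  rw [h1] at h
  have h3 := congrArg (fun f => f.1 (Simplex.pt (big q ρ).toUnitalGraph x)) h
  refine h3.trans ?_
  -- With N the sum of the slot counts, k(k-1)/2 = N + ε, and (-1)^{N+ε} (-1)^ε = (-1)^N.
  rw [← frakFunOn_pt ρ hq, ← h2, pow_add, mul_assoc ((-1 : ℝ) ^ _), ← pow_add, ← two_mul, pow_mul,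
    neg_one_sq, one_pow, mul_one]
  rfl

/-- `VE_Ω(θ)` is an evaluation of `VE(𝔉_θ)`. -/
lemma hasEv_VE_frak (ρ : Representation F C 𝒢) {p : ℕ} (θ : Form F C 𝒢 p q) :
    HasEv ρ (VE (big q ρ) (frak ρ θ)) (VEΩ ρ θ.1) := by
  refine fun k l r hp hq u v => ⟨isForm_VEΩ ρ θ hp hq u v, fun x => ?_⟩
  rw [coe_VE]
  simp only [iterR_evArgs]
  let b := Simplex.pt (big r ρ).toUnitalGraph (forget hq x)
  let T : PreForm C 𝒢 0 r →ₗ[ℝ] ℝ :=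
    { toFun := fun η => frakFun ρ η b
      map_add' := fun η η' => map_add (b.vert 0).cov _ _
      map_smul' := fun c η => map_smul (b.vert 0).cov _ _ }
  have h : frakFun ρ (VEΩ ρ θ.1 k l r hp hq u v) b = T (VEΩ ρ θ.1 k l r hp hq u v) := rfl
  rw [h, VEΩ, map_smul, map_sum, smul_eq_mul, Finset.mul_sum]
  refine Finset.sum_congr rfl fun σ _ => ?_
  rw [map_smul, smul_eq_mul]
  change _ * (_ * frakFun ρ _ b) = _ * (_ * frakFun ρ _ b)
  ring

/-! ### Uniqueness of the evaluation -/

/-- Tangent vectors and a covector at a point of `M`, as the last components of a point of `𝕄_q`. -/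
lemma exists_bigObj (ρ : Representation F C 𝒢) {k r : ℕ} (hq : k + r = q) (b : B 𝒢 0)
    (w : Fin r → Tan b) (ξ : C (b.vert 0) →L[ℝ] ℝ) :
    ∃ x : BigObj F EM C q, x.pt = b.vert 0 ∧
      (∀ j, x.vec (Fin.cast hq (Fin.natAdd k j)) = (w j).1.1 0) ∧
      ∀ (m : ℕ) (e : Fin m → Fin r) (η : PreForm C 𝒢 0 m),
        frakFunOn ρ η (fun j => Fin.cast hq (Fin.natAdd k (e j)))
          (Simplex.pt (big q ρ).toUnitalGraph x) = ξ (η b fun j => w (e j)) := by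
  -- The first k tangent vectors are invisible to functions of the last r slots; zero is an
  -- arbitrary choice.
  let x : BigObj F EM C q := ⟨b.vert 0, fun j => if h : k ≤ j then
    (w ⟨j - k, by omega⟩).1.1 0 else 0, ξ⟩
  have hx : ∀ j, x.vec (Fin.cast hq (Fin.natAdd k j)) = (w j).1.1 0 := fun j => by simp [x]
  refine ⟨x, rfl, hx, fun m e η => ?_⟩
  have h0 : ∀ i : Fin 1, i = 0 := Fin.fin_one_eq_zero
  refine PreForm.apply_congr η (b := baseSimplex (Simplex.pt (big q ρ).toUnitalGraph x))
    (w := fun j => tanVec (Simplex.pt (big q ρ).toUnitalGraph x) (Fin.cast hq (Fin.natAdd k (e j))))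
    (w' := fun j => w (e j)) (ξ := ξ) (ξ' := ξ) (funext fun i => ?_) (funext fun i => i.elim0)
    (fun j => Prod.ext (funext fun i => ?_) (funext fun i => i.elim0)) HEq.rfl
  · rw [h0 i]
    rfl
  · rw [h0 i]
    exact hx (e j)

/-- Every tuple of tangent vectors with a covector is the tail of a point of `𝕄_q`, and covectors
separate the values of the forms. The choice made in `ev` is thus forced. -/
lemma HasEv.unique {ρ : Representation F C 𝒢} {p : ℕ}
    {α : (Fin p → Sec (big q ρ).toUnitalGraph) → smoothFun (BigObj F EM C q)}
    {c c' : WeilSeq C 𝒢 p q} (h : HasEv ρ α c) (h' : HasEv ρ α c') : c = c' := by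
  funext k l r hp hq u v b w
  refine eq_of_forall_cov (fibreEquiv F C _) fun ξ => ?_
  obtain ⟨x, -, -, hx⟩ := exists_bigObj ρ hq b w ξ
  refine (hx r id _).symm.trans (Eq.trans ?_ (hx r id _))
  have h1 := ((h k l r hp hq u v).2 x).symm.trans ((h' k l r hp hq u v).2 x)
  rw [← frakFunOn_pt ρ hq, ← frakFunOn_pt ρ hq] at h1
  exact h1

lemma HasEv.ev_eq {ρ : Representation F C 𝒢} {p : ℕ}
    {α : (Fin p → Sec (big q ρ).toUnitalGraph) → smoothFun (BigObj F EM C q)}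
    {c : WeilSeq C 𝒢 p q} (h : HasEv ρ α c) : ev ρ α = c := by
  have h1 : ∃ c, HasEv ρ α c := ⟨c, h⟩
  rw [ev, dif_pos h1]
  exact h1.choose_spec.unique h

/-! ### The arguments `𝒵₁v₁, …, 𝒵_k v_k, 𝒯u₁, …, 𝒯u_l` -/

section EvArgs

variable (ρ : Representation F C 𝒢) {p k l r : ℕ} (hp : k + l = p) (hq : k + r = q)
  (u : Fin l → Alg 𝒢) (v : Fin k → Alg 𝒢)

lemma evArgs_castAdd (i : Fin k) : evArgs ρ hp hq u v (Fin.cast hp (Fin.castAdd l i)) =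
    coreSec ρ (Fin.cast hq (Fin.castAdd r i)) (v i) := by
  simp [evArgs]

lemma evArgs_natAdd (i : Fin l) : evArgs ρ hp hq u v (Fin.cast hp (Fin.natAdd k i)) =
    tangentSec ρ (u i) := by
  simp [evArgs]

lemma evArgs_of_lt (j : Fin p) (i : Fin k) (h : (j : ℕ) = i) :
    evArgs ρ hp hq u v j = coreSec ρ ⟨i, by omega⟩ (v i) := by
  obtain rfl : j = Fin.cast hp (Fin.castAdd l i) := Fin.ext h
  exact evArgs_castAdd ρ hp hq u v i

lemma evArgs_of_ge (j : Fin p) (i : Fin l) (h : (j : ℕ) = k + i) :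
    evArgs ρ hp hq u v j = tangentSec ρ (u i) := by
  obtain rfl : j = Fin.cast hp (Fin.natAdd k i) := Fin.ext h
  exact evArgs_natAdd ρ hp hq u v i

lemma fin_eq_of_add (j : Fin p) : (∃ i : Fin k, j = Fin.cast hp (Fin.castAdd l i)) ∨
    ∃ i : Fin l, j = Fin.cast hp (Fin.natAdd k i) := by
  subst hp
  exact Fin.addCases (motive := fun j => (∃ i : Fin k, j = Fin.castAdd l i) ∨
    ∃ i : Fin l, j = Fin.natAdd k i) (fun i => Or.inl ⟨i, rfl⟩) (fun i => Or.inr ⟨i, rfl⟩) j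

lemma evArgs_update_left (i : Fin l) (a : Alg 𝒢) :
    evArgs ρ hp hq (Function.update u i a) v =
      Function.update (evArgs ρ hp hq u v) (Fin.cast hp (Fin.natAdd k i)) (tangentSec ρ a) := by
  refine Function.eq_update_iff.2 ⟨?_, fun j hj => ?_⟩
  · have h1 : Function.update u i a i = a := Function.update_self i a u
    have h2 := evArgs_natAdd ρ hp hq (Function.update u i a) v i
    rw [h1] at h2
    exact h2
  · rcases fin_eq_of_add hp j with ⟨m, rfl⟩ | ⟨m, rfl⟩
    · exact (evArgs_castAdd ρ hp hq _ v m).trans (evArgs_castAdd ρ hp hq u v m).symm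
    · have h : m ≠ i := fun h => hj (by rw [h])
      have h1 : Function.update u i a m = u m := Function.update_of_ne h a u
      have h2 := evArgs_natAdd ρ hp hq (Function.update u i a) v m
      rw [h1] at h2
      exact h2.trans (evArgs_natAdd ρ hp hq u v m).symm

lemma evArgs_update_right (i : Fin k) (a : Alg 𝒢) :
    evArgs ρ hp hq u (Function.update v i a) =
      Function.update (evArgs ρ hp hq u v) (Fin.cast hp (Fin.castAdd l i))
        (coreSec ρ (Fin.cast hq (Fin.castAdd r i)) a) := by
  refine Function.eq_update_iff.2 ⟨?_, fun j hj => ?_⟩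
  · have h1 : Function.update v i a i = a := Function.update_self i a v
    have h2 := evArgs_castAdd ρ hp hq u (Function.update v i a) i
    rw [h1] at h2
    exact h2
  · rcases fin_eq_of_add hp j with ⟨m, rfl⟩ | ⟨m, rfl⟩
    · have h : m ≠ i := fun h => hj (by rw [h])
      have h1 : Function.update v i a m = v m := Function.update_of_ne h a v
      have h2 := evArgs_castAdd ρ hp hq u (Function.update v i a) m
      rw [h1] at h2
      exact h2.trans (evArgs_castAdd ρ hp hq u v m).symm
    · exact (evArgs_natAdd ρ hp hq u _ m).trans (evArgs_natAdd ρ hp hq u v m).symm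

end EvArgs

/-- `VE(𝔉_θ)` vanishes if two core sections belong to the same slot. -/
lemma VE_frak_eq_zero (ρ : Representation F C 𝒢) {p : ℕ} (θ : Form F C 𝒢 p q)
    (a : Fin p → Option (Fin q) × Alg 𝒢) {i j : Fin p} {s : Fin q} (hij : i ≠ j)
    (hi : (a i).1 = some s) (hj : (a j).1 = some s) :
    VE (big q ρ) (frak ρ θ) (fun i => slotSec ρ (a i)) = 0 := by
  refine Subtype.ext (funext fun x => ?_)
  rw [coe_VE]
  refine Finset.sum_eq_zero fun σ _ => ?_
  have h1 : frakOn ρ (TotForm.single θ.1 q) (TotForm.isForm_single θ.2 q) id = frak ρ θ := by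
    refine Subtype.ext (funext fun b => ?_)
    change frakFunOn ρ (TotForm.single θ.1 q) id b = frakFunOn ρ θ.1 id b
    rw [TotForm.single_same]
  have h2 := iterR_frakOn_eq_zero ρ (fun i => a (σ i)) (TotForm.isForm_single θ.2)
    (e := (id : Fin q → Fin q)) strictMono_id (by
      have hσ : ∀ m, σ (σ.symm m) = m := σ.apply_symm_apply
      have hne : σ.symm i ≠ σ.symm j := fun h => hij (σ.symm.injective h)
      rcases lt_or_gt_of_ne hne with h | h
      · exact ⟨σ.symm i, s, by rw [hσ, hi], Or.inr ⟨σ.symm j, h, by rw [hσ, hj]⟩⟩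
      · exact ⟨σ.symm j, s, by rw [hσ, hj], Or.inr ⟨σ.symm i, h, by rw [hσ, hi]⟩⟩)
  rw [h1] at h2
  rw [h2]
  exact mul_zero _

/-! ### Alternating forms on sections, pointwise -/

section Alternating

variable {Ob Ar : Type*} [DiffeologicalSpace Ob] [DiffeologicalSpace Ar] {S : UnitalGraph Ob Ar}

lemma alt_update_add {p : ℕ} (A : (Sec S) [⋀^Fin p]→ₗ[smoothFun Ob] (smoothFun Ob))
    (χ : Fin p → Sec S) (i : Fin p) {c c₁ c₂ : Sec S} (h : c = c₁ + c₂) (x : Ob) :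
    (A (Function.update χ i c)).1 x =
      (A (Function.update χ i c₁)).1 x + (A (Function.update χ i c₂)).1 x := by
  rw [h, A.map_update_add]
  rfl

lemma alt_update_smul {p : ℕ} (A : (Sec S) [⋀^Fin p]→ₗ[smoothFun Ob] (smoothFun Ob))
    (χ : Fin p → Sec S) (i : Fin p) {c c₁ : Sec S} {a : smoothFun Ob} (h : c = a • c₁) (x : Ob) :
    (A (Function.update χ i c)).1 x = a.1 x * (A (Function.update χ i c₁)).1 x := by
  rw [h, A.map_update_smul]
  rfl

lemma alt_update_smul_sum {p : ℕ} (A : (Sec S) [⋀^Fin p]→ₗ[smoothFun Ob] (smoothFun Ob))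
    (χ : Fin p → Sec S) (i : Fin p) {ι : Type*} [Fintype ι] {c c₁ : Sec S} {a : smoothFun Ob}
    {d : ι → smoothFun Ob} {Y : ι → Sec S} (h : c = a • c₁ + ∑ j, d j • Y j) (x : Ob) :
    (A (Function.update χ i c)).1 x = a.1 x * (A (Function.update χ i c₁)).1 x +
      ∑ j, (d j).1 x * (A (Function.update χ i (Y j))).1 x := by
  let T := A.toMultilinearMap.toLinearMap χ i
  have h1 : T c = a • T c₁ + ∑ j, d j • T (Y j) := by
    rw [h, map_add, map_smul, map_sum]
    simp only [map_smul]
  have h2 := congrArg (fun g => g.1 x) h1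
  refine h2.trans ?_
  have h3 : (∑ j, d j • T (Y j)).1 x = ∑ j, (d j • T (Y j)).1 x := by
    rw [AddSubmonoidClass.coe_finsetSum, Finset.sum_apply]
  exact congrArg (fun z => (a • T c₁).1 x + z) h3

lemma alt_perm {p : ℕ} (A : (Sec S) [⋀^Fin p]→ₗ[smoothFun Ob] (smoothFun Ob))
    (χ : Fin p → Sec S) (σ : Equiv.Perm (Fin p)) (x : Ob) :
    (A fun i => χ (σ i)).1 x = ((Equiv.Perm.sign σ : ℤ) : ℝ) * (A χ).1 x := by
  have h := A.map_perm χ σ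
  refine (congrArg (fun g => g.1 x) h).trans ?_
  rcases Int.units_eq_one_or (Equiv.Perm.sign σ) with h1 | h1 <;> simp [h1]

lemma alt_insertNth {p : ℕ} (A : (Sec S) [⋀^Fin (p + 1)]→ₗ[smoothFun Ob] (smoothFun Ob))
    (j : Fin (p + 1)) (c : Sec S) (g : Fin p → Sec S) (x : Ob) :
    (A (j.insertNth c g)).1 x =
      (-1 : ℝ) ^ (j : ℕ) * (A (Fin.cons c g : Fin (p + 1) → Sec S)).1 x := by
  have h : (j.insertNth c g : Fin (p + 1) → Sec S) =
      fun i => (Fin.cons c g : Fin (p + 1) → Sec S) (j.cycleRange i) := by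
    funext i
    rcases Fin.eq_self_or_eq_succAbove j i with rfl | ⟨m, rfl⟩
    · rw [Fin.insertNth_apply_same, Fin.cycleRange_self, Fin.cons_zero]
    · rw [Fin.insertNth_apply_succAbove, Fin.cycleRange_succAbove, Fin.cons_succ]
  rw [h, alt_perm, Fin.sign_cycleRange]
  simp

end Alternating

/-! ### The sequence `VE_Ω(θ)` of a normalized form lies in the Weil complex -/

lemma Endo.Related.congr {Ob Ar : Type*} [DiffeologicalSpace Ob] [DiffeologicalSpace Ar]
    {K : SmoothGraph Ob Ar} {φ : Endo K} {χ χ' ψ ψ' : Sec K.toUnitalGraph}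
    (h : φ.Related ψ ψ') (h1 : χ = ψ) (h2 : χ' = ψ') : φ.Related χ χ' := by
  subst h1 h2
  exact h

/-- A permutation of the v_j has to act with the same sign both on the p arguments and on the q
slots. -/
lemma exists_perm_extend {k n N : ℕ} (σ : Equiv.Perm (Fin k)) (h : k + n = N) :
    ∃ τ : Equiv.Perm (Fin N), Equiv.Perm.sign τ = Equiv.Perm.sign σ ∧
      (∀ i, τ (Fin.cast h (Fin.castAdd n i)) = Fin.cast h (Fin.castAdd n (σ i))) ∧
      ∀ i, τ (Fin.cast h (Fin.natAdd k i)) = Fin.cast h (Fin.natAdd k i) := by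
  subst h
  refine ⟨finSumFinEquiv.permCongr (Equiv.Perm.sumCongr σ 1), ?_, fun i => ?_, fun i => ?_⟩
  · simp
  · simp [Equiv.permCongr_apply]
  · simp [Equiv.permCongr_apply]

lemma VE_frak_evArgs (ρ : Representation F C 𝒢) {p : ℕ} (θ : Form F C 𝒢 p q) {k l r : ℕ}
    (hp : k + l = p) (hq : k + r = q) (u : Fin l → Alg 𝒢) (v : Fin k → Alg 𝒢)
    (x : BigObj F EM C q) :
    (VE (big q ρ) (frak ρ θ) (evArgs ρ hp hq u v)).1 x =
      frakFunOn ρ (VEΩ ρ θ.1 k l r hp hq u v) (fun j => Fin.cast hq (Fin.natAdd k j))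
        (Simplex.pt (big q ρ).toUnitalGraph x) :=
  ((hasEv_VE_frak ρ θ k l r hp hq u v).2 x).trans (frakFunOn_pt ρ hq _ x).symm

lemma frakFunOn_pt_perm (ρ : Representation F C 𝒢) {n : ℕ} (η : PreForm C 𝒢 0 n)
    (e : Fin n → Fin q) (τ : Equiv.Perm (Fin q)) (x : BigObj F EM C q) :
    frakFunOn ρ η e (Simplex.pt (big q ρ).toUnitalGraph ((perm ρ τ).obj x)) =
      frakFunOn ρ η (fun j => τ (e j)) (Simplex.pt (big q ρ).toUnitalGraph x) := by
  refine PreForm.apply_congr η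
    (b := baseSimplex (Simplex.pt (big q ρ).toUnitalGraph ((perm ρ τ).obj x)))
    (w := fun j => tanVec (Simplex.pt (big q ρ).toUnitalGraph ((perm ρ τ).obj x)) (e j))
    (b' := baseSimplex (Simplex.pt (big q ρ).toUnitalGraph x))
    (w' := fun j => tanVec (Simplex.pt (big q ρ).toUnitalGraph x) (τ (e j)))
    (ξ := (1 : ℝ) • x.cov) (ξ' := x.cov) rfl (funext fun i => i.elim0)
    (fun j => Prod.ext (funext fun i => ?_) (funext fun i => i.elim0)) (heq_of_eq (one_smul ℝ _))
  exact one_smul ℝ (x.vec (τ (e j)))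

lemma dfun_algebraMap (c : ℝ) (x : M) :
    dfun (EM := EM) (algebraMap ℝ (smoothFunM EM M) c).1 x = 0 :=
  mfderiv_const (I := 𝓘(ℝ, EM)) (I' := 𝓘(ℝ, ℝ)) (M := M) (c := c) (x := x)

/-- Slot j < k is already occupied by the core section of v_j, so it would be used twice. This
removes the terms df(x_j), j < k, from the Leibniz rule. -/
lemma VE_frak_update_coreSec (ρ : Representation F C 𝒢) {p : ℕ} (θ : Form F C 𝒢 p q)
    {k l r : ℕ} (hp : k + l = p) (hq : k + r = q) (u : Fin l → Alg 𝒢) (v : Fin k → Alg 𝒢)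
    (i : Fin l) (j : Fin k) (w : Alg 𝒢) :
    VE (big q ρ) (frak ρ θ) (Function.update (evArgs ρ hp hq u v) (Fin.cast hp (Fin.natAdd k i))
      (coreSec ρ (Fin.cast hq (Fin.castAdd r j)) w)) = 0 := by
  let s : Fin q := Fin.cast hq (Fin.castAdd r j)
  let a : Fin p → Option (Fin q) × Alg 𝒢 :=
    Function.update (evSlot hp hq u v) (Fin.cast hp (Fin.natAdd k i)) (some s, w)
  have h1 : (fun m => slotSec ρ (a m)) = Function.update (evArgs ρ hp hq u v)
      (Fin.cast hp (Fin.natAdd k i)) (coreSec ρ s w) := by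
    funext m
    by_cases hm : m = Fin.cast hp (Fin.natAdd k i)
    · subst hm
      have h2 : a (Fin.cast hp (Fin.natAdd k i)) = (some s, w) := Function.update_self ..
      refine (congrArg (slotSec ρ) h2).trans ?_
      exact (Function.update_self (Fin.cast hp (Fin.natAdd k i)) (coreSec ρ s w)
        (evArgs ρ hp hq u v)).symm
    · have h2 : a m = evSlot hp hq u v m := Function.update_of_ne hm _ _
      refine (congrArg (slotSec ρ) h2).trans ((slotSec_evSlot ρ hp hq u v m).trans ?_)
      exact (Function.update_of_ne hm (coreSec ρ s w) (evArgs ρ hp hq u v)).symm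
  have hne : Fin.cast hp (Fin.natAdd k i) ≠ Fin.cast hp (Fin.castAdd l j) := fun h => by
    have := congrArg Fin.val h
    simp at this
    omega
  rw [← h1]
  refine VE_frak_eq_zero ρ θ a hne (s := s) ?_ ?_
  · simp [a]
  · have h2 : a (Fin.cast hp (Fin.castAdd l j)) = evSlot hp hq u v _ :=
      Function.update_of_ne hne.symm _ _
    rw [h2, evSlot_eq_some]
    exact ⟨rfl, j.2⟩

/-- The inverse cycle moves 0 to k + j and otherwise enumerates the complement of k + j in order;
beyond the first k indices this is the enumeration skipping j in the last r + 1 slots. -/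
lemma cycleRange_symm_natAdd {k r : ℕ} (j : Fin (r + 1)) (h : k + 1 + r = k + (r + 1))
    (i : Fin r) :
    (Fin.cycleRange (Fin.natAdd k j : Fin (k + r + 1))).symm (Fin.cast h (Fin.natAdd (k + 1) i)) =
      Fin.natAdd k (j.succAbove i) := by
  have h4 : (Fin.cast h (Fin.natAdd (k + 1) i) : Fin (k + r + 1)) =
      Fin.succ (Fin.natAdd k i) := Fin.ext (by simp; omega)
  refine (congrArg _ h4).trans ((Fin.cycleRange_symm_succ _ _).trans ?_)
  rcases lt_or_ge i.castSucc j with h | h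
  · rw [Fin.succAbove_of_castSucc_lt _ _ h, Fin.succAbove_of_castSucc_lt _ _ (by
      have := Fin.lt_def.1 h
      rw [Fin.lt_def]
      simpa using this)]
    rfl
  · rw [Fin.succAbove_of_le_castSucc _ _ h, Fin.succAbove_of_le_castSucc _ _ (by
      have := Fin.le_def.1 h
      rw [Fin.le_def]
      simpa using this)]
    rfl

/-- Bringing slot k + j to the front shifts slots 0, …, k - 1 up by one. The core section of u₁
lands in slot 0 and those of v behind it, which is the argument list of c_{k+1}(u | u₁, v). -/
lemma related_cycleRange_evArgs (ρ : Representation F C 𝒢) {k l r : ℕ} (u₁ : Alg 𝒢)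
    (u : Fin l → Alg 𝒢) (v : Fin k → Alg 𝒢) (j : Fin (r + 1))
    (hp' : k + 1 + l = k + (l + 1)) (hq' : k + 1 + r = k + (r + 1)) (i : Fin (k + l + 1)) :
    (perm ρ (Fin.cycleRange (Fin.natAdd k j : Fin (k + r + 1))).symm).Related
      ((Fin.cons (coreSec ρ (Fin.natAdd k j : Fin (k + r + 1)) u₁) fun m : Fin (k + l) =>
          evArgs ρ (p := k + (l + 1)) (q := k + (r + 1)) rfl rfl (Fin.cons u₁ u) v
            ((Fin.natAdd k (0 : Fin (l + 1)) : Fin (k + l + 1)).succAbove m) :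
        Fin (k + l + 1) → Sec (big (k + r + 1) ρ).toUnitalGraph) i)
      (evArgs ρ hp' hq' u (Fin.cons u₁ v) i) := by
  let K : Fin (k + l + 1) := Fin.natAdd k (0 : Fin (l + 1))
  let J : Fin (k + r + 1) := Fin.natAdd k j
  let χ := evArgs ρ (p := k + (l + 1)) (q := k + (r + 1)) rfl rfl (Fin.cons u₁ u) v
  let τ : Equiv.Perm (Fin (k + r + 1)) := (Fin.cycleRange J).symm
  have hτ0 : τ 0 = J := Fin.cycleRange_symm_zero J
  have hτs : ∀ i : Fin (k + r), τ i.succ = J.succAbove i := Fin.cycleRange_symm_succ J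
  refine Fin.cases ?_ (fun m => ?_) i
  · refine (related_perm_coreSec ρ τ 0 u₁).congr ?_ ?_
    · exact congrArg (fun i => coreSec ρ i u₁) hτ0.symm
    · exact evArgs_of_lt ρ hp' hq' u (Fin.cons u₁ v) 0 0 rfl
  · rcases fin_eq_of_add rfl m with ⟨i, rfl⟩ | ⟨i, rfl⟩
    · let s : Fin (k + r) := Fin.castAdd r i
      have hs : J.succAbove s = s.castSucc :=
        Fin.succAbove_of_castSucc_lt _ _ (Fin.lt_def.2 (by
          change (i : ℕ) < k + j
          omega))
      have hK' : K.succAbove (Fin.cast rfl (Fin.castAdd l i)) =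
          Fin.castSucc (Fin.castAdd l i) :=
        Fin.succAbove_of_castSucc_lt _ _ (Fin.lt_def.2 i.2)
      refine (related_perm_coreSec ρ τ s.succ (v i)).congr ?_ ?_
      · refine (congrArg χ hK').trans ((evArgs_of_lt ρ rfl rfl _ v _ i rfl).trans ?_)
        exact congrArg (fun t => coreSec ρ t (v i)) (hs.symm.trans (hτs s).symm)
      · exact evArgs_of_lt ρ hp' hq' u (Fin.cons u₁ v) _ i.succ rfl
    · have hK' : K.succAbove (Fin.cast rfl (Fin.natAdd k i)) = Fin.succ (Fin.natAdd k i) :=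
        Fin.succAbove_of_le_castSucc _ _ (Fin.le_def.2 (by
          change k ≤ k + i
          omega))
      refine (related_perm_tangentSec ρ τ (u i)).congr ?_ ?_
      · refine (congrArg χ hK').trans ?_
        exact evArgs_of_ge ρ rfl rfl (Fin.cons u₁ u) v _ i.succ rfl
      · refine evArgs_of_ge ρ hp' hq' u (Fin.cons u₁ v) _ i ?_
        change k + i + 1 = k + 1 + i
        omega

/-- Moving the new core section from position k to the front of the arguments gives (-1)^k, and
moving its slot k + j to the front gives (-1)^{k+j}. The product (-1)^j is the sign of the j-th term
of df ∧ c_{k+1}. -/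
lemma VE_frak_update_coreSec_natAdd (ρ : Representation F C 𝒢) {k l r : ℕ}
    (θ : Form F C 𝒢 (k + (l + 1)) (k + (r + 1))) (hθ : θ.1.IsNormalized) (u₁ : Alg 𝒢)
    (u : Fin l → Alg 𝒢) (v : Fin k → Alg 𝒢) (j : Fin (r + 1)) (x : BigObj F EM C (k + (r + 1))) :
    (VE (big _ ρ) (frak ρ θ) (Function.update (evArgs ρ rfl rfl (Fin.cons u₁ u) v)
      (Fin.natAdd k 0) (coreSec ρ (Fin.natAdd k j) u₁))).1 x =
    (-1 : ℝ) ^ (j : ℕ) * frakFunOn ρ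
      (VEΩ ρ θ.1 (k + 1) l r (by omega) (by omega) u (Fin.cons u₁ v))
      (fun i => Fin.natAdd k (j.succAbove i)) (Simplex.pt (big _ ρ).toUnitalGraph x) := by
  have hp' : k + 1 + l = k + (l + 1) := by omega
  have hq' : k + 1 + r = k + (r + 1) := by omega
  let A := VEAlt (frak ρ θ) (isNormalized_frak ρ hθ)
  have hA : ⇑A = VE (big _ ρ) (frak ρ θ) := coe_VEAlt _ _
  let K : Fin (k + l + 1) := Fin.natAdd k (0 : Fin (l + 1))
  let J : Fin (k + r + 1) := Fin.natAdd k j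
  have hJ : (J : ℕ) = k + j := rfl
  let χ := evArgs ρ (p := k + (l + 1)) (q := k + (r + 1)) rfl rfl (Fin.cons u₁ u) v
  let g : Fin (k + l) → Sec (big (k + (r + 1)) ρ).toUnitalGraph := fun i => χ (K.succAbove i)
  let τ : Equiv.Perm (Fin (k + r + 1)) := (Fin.cycleRange J).symm
  have hτ : ((Equiv.Perm.sign τ : ℤ) : ℝ) = (-1) ^ (k + (j : ℕ)) := by
    simp only [τ, Equiv.Perm.sign_symm]
    rw [Fin.sign_cycleRange, hJ]
    simp
  have h1 : Function.update χ (Fin.natAdd k 0) (coreSec ρ (Fin.natAdd k j) u₁) =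
      K.insertNth (coreSec ρ J u₁) g := (Fin.insertNth_removeNth K (coreSec ρ J u₁) χ).symm
  have h2 := alt_insertNth A K (coreSec ρ J u₁) g x
  have h3 : (VE (big _ ρ) (frak ρ θ) (Fin.cons (coreSec ρ J u₁) g :
        Fin (k + l + 1) → Sec (big (k + r + 1) ρ).toUnitalGraph)).1 x =
      (-1 : ℝ) ^ (k + (j : ℕ)) * (VE (big _ ρ) (frak ρ θ)
        (evArgs ρ hp' hq' u (Fin.cons u₁ v))).1 ((perm ρ τ).obj x) := by
    have h := (isExtForm_VE_frak ρ hθ).2.2.1 τ _ _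
      (related_cycleRange_evArgs ρ u₁ u v j hp' hq') x
    have hs : (-1 : ℝ) ^ (k + (j : ℕ)) * (-1) ^ (k + (j : ℕ)) = 1 := by
      rw [← mul_pow]
      simp
    have h' := congrArg (fun y => (-1 : ℝ) ^ (k + (j : ℕ)) * y) h
    refine Eq.symm (h'.trans ?_)
    rw [hτ, ← mul_assoc, hs, one_mul]
  have h4 := (VE_frak_evArgs ρ θ hp' hq' u (Fin.cons u₁ v) ((perm ρ τ).obj x)).trans
    (frakFunOn_pt_perm ρ (VEΩ ρ θ.1 (k + 1) l r hp' hq' u (Fin.cons u₁ v)) _ τ x)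
  have he : (fun i => τ (Fin.cast hq' (Fin.natAdd (k + 1) i))) =
      fun i => Fin.natAdd k (j.succAbove i) := funext fun i => cycleRange_symm_natAdd j hq' i
  have h5 := h4.trans (congrArg (fun e => frakFunOn ρ
    (VEΩ ρ θ.1 (k + 1) l r hp' hq' u (Fin.cons u₁ v)) e (Simplex.pt (big _ ρ).toUnitalGraph x)) he)
  have h6 := congrArg (fun c => (VE (big _ ρ) (frak ρ θ) c).1 x) h1
  have h7 := h6.trans ((congrArg (fun A => (A (K.insertNth (coreSec ρ J u₁) g)).1 x) hA.symm).trans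
    (h2.trans (congrArg (fun A => (-1 : ℝ) ^ (K : ℕ) * (A (Fin.cons (coreSec ρ J u₁) g)).1 x) hA)))
  refine h7.trans ((congrArg (fun y => (-1 : ℝ) ^ (K : ℕ) * y)
    (h3.trans (congrArg (fun y => (-1 : ℝ) ^ (k + (j : ℕ)) * y) h5))).trans ?_)
  change (-1 : ℝ) ^ k * ((-1) ^ (k + (j : ℕ)) * _) = _
  rw [← mul_assoc]
  congr 1
  rw [← pow_add, show k + (k + (j : ℕ)) = j + 2 * k by ring, pow_add, pow_mul, neg_one_sq, one_pow,
    mul_one]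

/-! ### Linearity and skew-symmetry of the Van Est map at a point -/

section VanEstUpdate

variable {Ob Ar : Type*} [DiffeologicalSpace Ob] [DiffeologicalSpace Ar]
  {K : SmoothGraph Ob Ar} {p : ℕ} {f : smoothFun (Simplex K.toUnitalGraph p)}

lemma VE_update_add (hf : IsNormalized f) (χ : Fin p → Sec K.toUnitalGraph) (i : Fin p)
    {c c₁ c₂ : Sec K.toUnitalGraph} (h : c = c₁ + c₂) (x : Ob) :
    (VE K f (Function.update χ i c)).1 x =
      (VE K f (Function.update χ i c₁)).1 x + (VE K f (Function.update χ i c₂)).1 x := by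
  rw [← coe_VEAlt f hf]
  exact alt_update_add _ χ i h x

lemma VE_update_smul (hf : IsNormalized f) (χ : Fin p → Sec K.toUnitalGraph) (i : Fin p)
    {c c₁ : Sec K.toUnitalGraph} {a : smoothFun Ob} (h : c = a • c₁) (x : Ob) :
    (VE K f (Function.update χ i c)).1 x = a.1 x * (VE K f (Function.update χ i c₁)).1 x := by
  rw [← coe_VEAlt f hf]
  exact alt_update_smul _ χ i h x

lemma VE_update_smul_sum (hf : IsNormalized f) (χ : Fin p → Sec K.toUnitalGraph) (i : Fin p)
    {ι : Type*} [Fintype ι] {c c₁ : Sec K.toUnitalGraph} {a : smoothFun Ob}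
    {d : ι → smoothFun Ob} {Y : ι → Sec K.toUnitalGraph} (h : c = a • c₁ + ∑ j, d j • Y j)
    (x : Ob) :
    (VE K f (Function.update χ i c)).1 x = a.1 x * (VE K f (Function.update χ i c₁)).1 x +
      ∑ j, (d j).1 x * (VE K f (Function.update χ i (Y j))).1 x := by
  rw [← coe_VEAlt f hf]
  exact alt_update_smul_sum _ χ i h x

lemma VE_perm (hf : IsNormalized f) (χ : Fin p → Sec K.toUnitalGraph) (σ : Equiv.Perm (Fin p))
    (x : Ob) :
    (VE K f fun i => χ (σ i)).1 x = ((Equiv.Perm.sign σ : ℤ) : ℝ) * (VE K f χ).1 x := by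
  rw [← coe_VEAlt f hf]
  exact alt_perm _ χ σ x

lemma VE_eq_zero_of_eq (hf : IsNormalized f) (χ : Fin p → Sec K.toUnitalGraph) {i j : Fin p}
    (h : χ i = χ j) (hij : i ≠ j) (x : Ob) : (VE K f χ).1 x = 0 := by
  rw [← coe_VEAlt f hf]
  exact congrArg (fun g => g.1 x) ((VEAlt f hf).map_eq_zero_of_eq χ h hij)

end VanEstUpdate

/-! ### Dependence of `VE(𝔉_θ)` on the sections u and v -/

section Weil

variable (ρ : Representation F C 𝒢) {p : ℕ} {θ : Form F C 𝒢 p q} (hθ : θ.1.IsNormalized)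
  {k l r : ℕ} (hp : k + l = p) (hq : k + r = q) (u : Fin l → Alg 𝒢) (v : Fin k → Alg 𝒢)
  (x : BigObj F EM C q)

include hθ

lemma VE_evArgs_update_left_add (i : Fin l) (a b : Alg 𝒢) :
    (VE (big q ρ) (frak ρ θ) (evArgs ρ hp hq (Function.update u i (a + b)) v)).1 x =
      (VE (big q ρ) (frak ρ θ) (evArgs ρ hp hq (Function.update u i a) v)).1 x +
        (VE (big q ρ) (frak ρ θ) (evArgs ρ hp hq (Function.update u i b) v)).1 x := by
  have h := VE_update_add (isNormalized_frak ρ hθ) (evArgs ρ hp hq u v)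
    (Fin.cast hp (Fin.natAdd k i)) (tangentSec_add (q := q) ρ a b) x
  rw [evArgs_update_left ρ hp hq u v i (a + b), evArgs_update_left ρ hp hq u v i a,
    evArgs_update_left ρ hp hq u v i b]
  exact h

lemma VE_evArgs_update_left_smul (i : Fin l) (f : smoothFunM EM M) (a : Alg 𝒢) :
    (VE (big q ρ) (frak ρ θ) (evArgs ρ hp hq (Function.update u i (f • a)) v)).1 x =
      f.1 x.pt * (VE (big q ρ) (frak ρ θ) (evArgs ρ hp hq (Function.update u i a) v)).1 x +
        ∑ j : Fin q, dfun f.1 x.pt (x.vec j) * (VE (big q ρ) (frak ρ θ)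
          (Function.update (evArgs ρ hp hq u v) (Fin.cast hp (Fin.natAdd k i))
            (coreSec ρ j a))).1 x := by
  have h := VE_update_smul_sum (isNormalized_frak ρ hθ) (evArgs ρ hp hq u v)
    (Fin.cast hp (Fin.natAdd k i)) (tangentSec_smul (q := q) ρ f a) x
  rw [evArgs_update_left ρ hp hq u v i (f • a), evArgs_update_left ρ hp hq u v i a]
  exact h

lemma VE_evArgs_update_right_add (i : Fin k) (a b : Alg 𝒢) :
    (VE (big q ρ) (frak ρ θ) (evArgs ρ hp hq u (Function.update v i (a + b)))).1 x =
      (VE (big q ρ) (frak ρ θ) (evArgs ρ hp hq u (Function.update v i a))).1 x +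
        (VE (big q ρ) (frak ρ θ) (evArgs ρ hp hq u (Function.update v i b))).1 x := by
  have h := VE_update_add (isNormalized_frak ρ hθ) (evArgs ρ hp hq u v)
    (Fin.cast hp (Fin.castAdd l i)) (coreSec_add ρ (Fin.cast hq (Fin.castAdd r i)) a b) x
  rw [evArgs_update_right ρ hp hq u v i (a + b), evArgs_update_right ρ hp hq u v i a,
    evArgs_update_right ρ hp hq u v i b]
  exact h

lemma VE_evArgs_update_right_smul (i : Fin k) (f : smoothFunM EM M) (a : Alg 𝒢) :
    (VE (big q ρ) (frak ρ θ) (evArgs ρ hp hq u (Function.update v i (f • a)))).1 x =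
      f.1 x.pt * (VE (big q ρ) (frak ρ θ) (evArgs ρ hp hq u (Function.update v i a))).1 x := by
  have h := VE_update_smul (isNormalized_frak ρ hθ) (evArgs ρ hp hq u v)
    (Fin.cast hp (Fin.castAdd l i)) (coreSec_smul ρ (Fin.cast hq (Fin.castAdd r i)) f a) x
  rw [evArgs_update_right ρ hp hq u v i (f • a), evArgs_update_right ρ hp hq u v i a]
  exact h

lemma VE_evArgs_eq_zero {i j : Fin l} (h : u i = u j) (hij : i ≠ j) :
    (VE (big q ρ) (frak ρ θ) (evArgs ρ hp hq u v)).1 x = 0 := by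
  refine VE_eq_zero_of_eq (isNormalized_frak ρ hθ) (evArgs ρ hp hq u v)
    (i := Fin.cast hp (Fin.natAdd k i)) (j := Fin.cast hp (Fin.natAdd k j)) ?_ ?_ x
  · exact (evArgs_natAdd ρ hp hq u v i).trans ((congrArg (fun a => tangentSec ρ a) h).trans
      (evArgs_natAdd ρ hp hq u v j).symm)
  · intro h'
    refine hij (Fin.ext ?_)
    simpa using congrArg Fin.val h'

/-- Permuting the core arguments gives sgn(σ), and permuting the first k slots to match gives sgn(σ)
again. The signs cancel and the last r slots stay in place, whence symmetry rather than
skew-symmetry in v. -/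
lemma VE_evArgs_comp_perm (σ : Equiv.Perm (Fin k)) :
    frakFunOn ρ (VEΩ ρ θ.1 k l r hp hq u (v ∘ σ)) (fun j => Fin.cast hq (Fin.natAdd k j))
        (Simplex.pt (big q ρ).toUnitalGraph x) =
      frakFunOn ρ (VEΩ ρ θ.1 k l r hp hq u v) (fun j => Fin.cast hq (Fin.natAdd k j))
        (Simplex.pt (big q ρ).toUnitalGraph x) := by
  obtain ⟨σ', hs, hσ, hσ'⟩ := exists_perm_extend σ hp
  obtain ⟨τ, ht, hτ, hτ'⟩ := exists_perm_extend σ hq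
  have hrel : ∀ i, (perm ρ τ).Related (evArgs ρ hp hq u v (σ' i))
      (evArgs ρ hp hq u (v ∘ σ) i) := by
    intro i
    rcases fin_eq_of_add hp i with ⟨m, rfl⟩ | ⟨m, rfl⟩
    · refine (related_perm_coreSec ρ τ (Fin.cast hq (Fin.castAdd r m)) (v (σ m))).congr ?_ ?_
      · refine (congrArg (evArgs ρ hp hq u v) (hσ m)).trans ?_
        exact (evArgs_castAdd ρ hp hq u v (σ m)).trans
          (congrArg (fun i => coreSec ρ i (v (σ m))) (hτ m).symm)
      · exact evArgs_castAdd ρ hp hq u (v ∘ σ) m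
    · refine (related_perm_tangentSec ρ τ (u m)).congr ?_ ?_
      · refine (congrArg (evArgs ρ hp hq u v) (hσ' m)).trans ?_
        exact evArgs_natAdd ρ hp hq u v m
      · exact evArgs_natAdd ρ hp hq u (v ∘ σ) m
  have h1 := (isExtForm_VE_frak ρ hθ).2.2.1 τ _ _ hrel x
  have h2 := VE_perm (isNormalized_frak ρ hθ) (evArgs ρ hp hq u v) σ' x
  have h3 := h1.trans (congrArg (fun y => ((Equiv.Perm.sign τ : ℤ) : ℝ) * y) h2)
  have hsgn : ((Equiv.Perm.sign τ : ℤ) : ℝ) * ((Equiv.Perm.sign σ' : ℤ) : ℝ) = 1 := by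
    rw [hs, ht]
    rcases Int.units_eq_one_or (Equiv.Perm.sign σ) with h | h <;> simp [h]
  rw [← mul_assoc, hsgn, one_mul] at h3
  have h4 := (VE_frak_evArgs ρ θ hp hq u (v ∘ σ) ((perm ρ τ).obj x)).symm.trans
    (h3.trans (VE_frak_evArgs ρ θ hp hq u v x))
  rw [frakFunOn_pt_perm] at h4
  have he : (fun j => τ (Fin.cast hq (Fin.natAdd k j))) =
      fun j => Fin.cast hq (Fin.natAdd k j) := funext hτ'
  rw [he] at h4
  exact h4

end Weil

/-- A point of `𝕄_q` which tests the components `c_k(u | v)` of `VE_Ω(θ)` at given tangent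
vectors. -/
lemma exists_test_point (ρ : Representation F C 𝒢) {p : ℕ} (θ : Form F C 𝒢 p q) {k l r : ℕ}
    (hp : k + l = p) (hq : k + r = q) (b : B 𝒢 0) (w : Fin r → Tan b)
    (ξ : C (b.vert 0) →L[ℝ] ℝ) :
    ∃ x : BigObj F EM C q, x.pt = b.vert 0 ∧
      (∀ j, x.vec (Fin.cast hq (Fin.natAdd k j)) = (w j).1.1 0) ∧
      (∀ (m : ℕ) (e : Fin m → Fin r) (η : PreForm C 𝒢 0 m),
        frakFunOn ρ η (fun j => Fin.cast hq (Fin.natAdd k (e j)))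
          (Simplex.pt (big q ρ).toUnitalGraph x) = ξ (η b fun j => w (e j))) ∧
      ∀ (u : Fin l → Alg 𝒢) (v : Fin k → Alg 𝒢),
        ξ (VEΩ ρ θ.1 k l r hp hq u v b w) = (VE (big q ρ) (frak ρ θ) (evArgs ρ hp hq u v)).1 x := by
  obtain ⟨x, hx, hv, hη⟩ := exists_bigObj ρ hq b w ξ
  exact ⟨x, hx, hv, hη, fun u v =>
    (hη r id _).symm.trans (VE_frak_evArgs ρ θ hp hq u v x).symm⟩

/-! ### The relations of the Weil complex for `VE_Ω(θ)` -/

section Weil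

variable (ρ : Representation F C 𝒢) {p : ℕ} {θ : Form F C 𝒢 p q}
  {k l r : ℕ}

lemma VEΩ_add_left (hp : k + l = p) (hq : k + r = q) (u : Fin l → Alg 𝒢) (v : Fin k → Alg 𝒢)
    (hθ : θ.1.IsNormalized) (i : Fin l) (a b : Alg 𝒢) :
    VEΩ ρ θ.1 k l r hp hq (Function.update u i (a + b)) v =
      VEΩ ρ θ.1 k l r hp hq (Function.update u i a) v +
        VEΩ ρ θ.1 k l r hp hq (Function.update u i b) v := by
  funext c w
  refine eq_of_forall_cov (fibreEquiv F C _) fun ξ => ?_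
  obtain ⟨x, -, -, -, hx⟩ := exists_test_point ρ θ hp hq c w ξ
  refine (hx _ _).trans ((VE_evArgs_update_left_add ρ hθ hp hq u v x i a b).trans ?_)
  rw [← hx, ← hx]
  exact (map_add ξ _ _).symm

/-- A real scalar is a constant function, so its differential vanishes and the core terms of `𝒯(fu)`
drop out. -/
lemma VEΩ_smul_left (hp : k + l = p) (hq : k + r = q) (u : Fin l → Alg 𝒢) (v : Fin k → Alg 𝒢)
    (hθ : θ.1.IsNormalized) (i : Fin l) (t : ℝ) (a : Alg 𝒢) :
    VEΩ ρ θ.1 k l r hp hq (Function.update u i (t • a)) v =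
      t • VEΩ ρ θ.1 k l r hp hq (Function.update u i a) v := by
  funext c w
  refine eq_of_forall_cov (fibreEquiv F C _) fun ξ => ?_
  obtain ⟨x, -, -, -, hx⟩ := exists_test_point ρ θ hp hq c w ξ
  refine (hx _ _).trans ((VE_evArgs_update_left_smul ρ hθ hp hq u v x i
    (algebraMap ℝ (smoothFunM EM M) t) a).trans ?_)
  rw [dfun_algebraMap, ← hx]
  refine Eq.trans ?_ (map_smul ξ t _).symm
  simp only [zero_apply, zero_mul, Finset.sum_const_zero, add_zero]
  rfl

lemma VEΩ_eq_zero_of_eq (hp : k + l = p) (hq : k + r = q) (u : Fin l → Alg 𝒢)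
    (v : Fin k → Alg 𝒢) (hθ : θ.1.IsNormalized) {i j : Fin l} (h : u i = u j) (hij : i ≠ j) :
    VEΩ ρ θ.1 k l r hp hq u v = 0 := by
  funext c w
  refine eq_of_forall_cov (fibreEquiv F C _) fun ξ => ?_
  obtain ⟨x, -, -, -, hx⟩ := exists_test_point ρ θ hp hq c w ξ
  exact (hx _ _).trans ((VE_evArgs_eq_zero ρ hθ hp hq u v x h hij).trans (map_zero ξ).symm)

/-- `c_k(u | v)` as an alternating map in `u`. -/
def VEΩAlt (hp : k + l = p) (hq : k + r = q) (v : Fin k → Alg 𝒢) (hθ : θ.1.IsNormalized) :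
    (Alg 𝒢) [⋀^Fin l]→ₗ[ℝ] PreForm C 𝒢 0 r where
  toFun u := VEΩ ρ θ.1 k l r hp hq u v
  map_update_add' {inst} u i a b := by
    obtain rfl : inst = instDecidableEqFin l := Subsingleton.elim _ _
    exact VEΩ_add_left ρ hp hq u v hθ i a b
  map_update_smul' {inst} u i t a := by
    obtain rfl : inst = instDecidableEqFin l := Subsingleton.elim _ _
    exact VEΩ_smul_left ρ hp hq u v hθ i t a
  map_eq_zero_of_eq' u _ _ h hij := VEΩ_eq_zero_of_eq ρ hp hq u v hθ h hij

lemma VEΩ_comp_perm (hp : k + l = p) (hq : k + r = q) (u : Fin l → Alg 𝒢) (v : Fin k → Alg 𝒢)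
    (hθ : θ.1.IsNormalized) (σ : Equiv.Perm (Fin k)) :
    VEΩ ρ θ.1 k l r hp hq u (v ∘ σ) = VEΩ ρ θ.1 k l r hp hq u v := by
  funext c w
  refine eq_of_forall_cov (fibreEquiv F C _) fun ξ => ?_
  obtain ⟨x, -, -, hη⟩ := exists_bigObj ρ hq c w ξ
  exact (hη r id _).symm.trans ((VE_evArgs_comp_perm ρ hθ hp hq u v x σ).trans (hη r id _))

lemma VEΩ_add_right (hp : k + l = p) (hq : k + r = q) (u : Fin l → Alg 𝒢) (v : Fin k → Alg 𝒢)
    (hθ : θ.1.IsNormalized) (i : Fin k) (a b : Alg 𝒢) :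
    VEΩ ρ θ.1 k l r hp hq u (Function.update v i (a + b)) =
      VEΩ ρ θ.1 k l r hp hq u (Function.update v i a) +
        VEΩ ρ θ.1 k l r hp hq u (Function.update v i b) := by
  funext c w
  refine eq_of_forall_cov (fibreEquiv F C _) fun ξ => ?_
  obtain ⟨x, -, -, -, hx⟩ := exists_test_point ρ θ hp hq c w ξ
  refine (hx _ _).trans ((VE_evArgs_update_right_add ρ hθ hp hq u v x i a b).trans ?_)
  rw [← hx, ← hx]
  exact (map_add ξ _ _).symm

lemma VEΩ_smul_right (hp : k + l = p) (hq : k + r = q) (u : Fin l → Alg 𝒢) (v : Fin k → Alg 𝒢)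
    (hθ : θ.1.IsNormalized) (i : Fin k) (f : smoothFunM EM M) (a : Alg 𝒢) :
    VEΩ ρ θ.1 k l r hp hq u (Function.update v i (f • a)) =
      fsmul f.1 (VEΩ ρ θ.1 k l r hp hq u (Function.update v i a)) := by
  funext c w
  refine eq_of_forall_cov (fibreEquiv F C _) fun ξ => ?_
  obtain ⟨x, hpt, -, -, hx⟩ := exists_test_point ρ θ hp hq c w ξ
  refine (hx _ _).trans ((VE_evArgs_update_right_smul ρ hθ hp hq u v x i f a).trans ?_)
  rw [← hx, hpt]
  exact (map_smul ξ (f.1 (c.vert 0)) _).symm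

/-- The Leibniz rule, before the terms of `df ∧ ·` are identified. -/
lemma VE_evArgs_cons_smul (hp : k + (l + 1) = p) (hq : k + r = q) (u₁ : Alg 𝒢) (u : Fin l → Alg 𝒢)
    (v : Fin k → Alg 𝒢) (hθ : θ.1.IsNormalized) (f : smoothFunM EM M) (x : BigObj F EM C q) :
    (VE (big q ρ) (frak ρ θ) (evArgs ρ hp hq (Fin.cons (f • u₁) u) v)).1 x =
      f.1 x.pt * (VE (big q ρ) (frak ρ θ) (evArgs ρ hp hq (Fin.cons u₁ u) v)).1 x +
        ∑ j : Fin r, dfun f.1 x.pt (x.vec (Fin.cast hq (Fin.natAdd k j))) *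
          (VE (big q ρ) (frak ρ θ) (Function.update (evArgs ρ hp hq (Fin.cons u₁ u) v)
            (Fin.cast hp (Fin.natAdd k 0))
            (coreSec ρ (Fin.cast hq (Fin.natAdd k j)) u₁))).1 x := by
  have h := VE_evArgs_update_left_smul ρ hθ hp hq (Fin.cons u₁ u) v x 0 f u₁
  have h1 : ∀ a : Alg 𝒢, Function.update (Fin.cons u₁ u : Fin (l + 1) → Alg 𝒢) 0 a =
      Fin.cons a u := fun a =>
    Fin.update_cons_zero (α := fun _ => Alg 𝒢) u₁ u a
  rw [h1, h1] at h
  refine h.trans (congrArg (f.1 x.pt *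
    (VE (big q ρ) (frak ρ θ) (evArgs ρ hp hq (Fin.cons u₁ u) v)).1 x + ·) ?_)
  -- Of the q core terms, the k in occupied slots vanish and the r in free slots remain.
  rw [← (finCongr hq).sum_comp, Fin.sum_univ_add]
  refine add_eq_right.2 (Finset.sum_eq_zero fun j _ => ?_)
  have h2 := VE_frak_update_coreSec ρ θ hp hq (Fin.cons u₁ u) v 0 j u₁
  exact (congrArg (fun g => dfun f.1 x.pt (x.vec (Fin.cast hq (Fin.castAdd r j))) * g.1 x)
    h2).trans (mul_zero _)

/-- The core terms in the r + 1 free slots, with their signs (-1)^j, are the expansion of df ∧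
c_{k+1} on the given tangent vectors. -/
lemma VEΩ_leibniz (hp : k + (l + 1) = p) (hq : k + (r + 1) = q) (u₁ : Alg 𝒢)
    (u : Fin l → Alg 𝒢) (v : Fin k → Alg 𝒢) (hθ : θ.1.IsNormalized) (f : smoothFunM EM M) :
    VEΩ ρ θ.1 k (l + 1) (r + 1) hp hq (Fin.cons (f • u₁) u) v =
      fsmul f.1 (VEΩ ρ θ.1 k (l + 1) (r + 1) hp hq (Fin.cons u₁ u) v) +
        dwedge f.1 (VEΩ ρ θ.1 (k + 1) l r (by omega) (by omega) u (Fin.cons u₁ v)) := by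
  subst hp hq
  funext c w
  refine eq_of_forall_cov (fibreEquiv F C _) fun ξ => ?_
  obtain ⟨x, hpt, hv, hη, hx⟩ := exists_test_point ρ θ rfl rfl c w ξ
  refine (hx _ _).trans ((VE_evArgs_cons_smul ρ rfl rfl u₁ u v hθ f x).trans ?_)
  have h1 : ξ (fsmul f.1 (VEΩ ρ θ.1 k (l + 1) (r + 1) rfl rfl (Fin.cons u₁ u) v) c w) =
      f.1 x.pt * (VE (big _ ρ) (frak ρ θ) (evArgs ρ rfl rfl (Fin.cons u₁ u) v)).1 x := by
    rw [← hx, hpt]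
    exact map_smul ξ (f.1 (c.vert 0)) _
  have h2 : ξ (dwedge f.1 (VEΩ ρ θ.1 (k + 1) l r (by omega) (by omega) u (Fin.cons u₁ v)) c w) =
      ∑ j : Fin (r + 1), dfun f.1 x.pt (x.vec (Fin.cast rfl (Fin.natAdd k j))) *
        (VE (big _ ρ) (frak ρ θ) (Function.update (evArgs ρ rfl rfl (Fin.cons u₁ u) v)
          (Fin.cast rfl (Fin.natAdd k 0))
          (coreSec ρ (Fin.cast rfl (Fin.natAdd k j)) u₁))).1 x := by
    rw [dwedge, map_sum]
    refine Finset.sum_congr rfl fun j _ => ?_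
    have h3 := VE_frak_update_coreSec_natAdd ρ θ hθ u₁ u v j x
    have h4 := hη r j.succAbove
      (VEΩ ρ θ.1 (k + 1) l r (by omega) (by omega) u (Fin.cons u₁ v))
    refine Eq.trans ?_ (congrArg (fun y => dfun f.1 x.pt (x.vec (Fin.natAdd k j)) * y)
      (h3.trans (congrArg (fun y => (-1 : ℝ) ^ (j : ℕ) * y) h4))).symm
    rw [map_smul, hpt, ← hv, smul_eq_mul]
    exact (congrArg (fun y => y * _) (mul_comm _ _)).trans (mul_assoc _ _ _)
  rw [← h1, ← h2]
  exact (map_add ξ _ _).symm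

/-- With r = 0 every slot is occupied, so no core term survives. -/
lemma VEΩ_leibniz_zero (hp : k + (l + 1) = p) (hq : k + 0 = q) (u₁ : Alg 𝒢)
    (u : Fin l → Alg 𝒢) (v : Fin k → Alg 𝒢) (hθ : θ.1.IsNormalized) (f : smoothFunM EM M) :
    VEΩ ρ θ.1 k (l + 1) 0 hp hq (Fin.cons (f • u₁) u) v =
      fsmul f.1 (VEΩ ρ θ.1 k (l + 1) 0 hp hq (Fin.cons u₁ u) v) := by
  funext c w
  refine eq_of_forall_cov (fibreEquiv F C _) fun ξ => ?_
  obtain ⟨x, hpt, -, -, hx⟩ := exists_test_point ρ θ hp hq c w ξ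
  refine (hx _ _).trans ((VE_evArgs_cons_smul ρ hp hq u₁ u v hθ f x).trans ?_)
  rw [← hx, hpt, Finset.univ_eq_empty, Finset.sum_empty, add_zero]
  exact (map_smul ξ (f.1 (c.vert 0)) _).symm

/-- `VE_Ω` maps normalized forms to the Weil complex. -/
lemma isWeil_VEΩ (hθ : θ.1.IsNormalized) : IsWeil F (VEΩ ρ θ.1) where
  isForm _ _ _ hp hq u v := isForm_VEΩ ρ θ hp hq u v
  alternating _ _ _ hp hq v := ⟨VEΩAlt ρ hp hq v hθ, rfl⟩
  symmetric _ _ _ hp hq u v σ := VEΩ_comp_perm ρ hp hq u v hθ σ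
  add_right _ _ _ hp hq u v i a b := VEΩ_add_right ρ hp hq u v hθ i a b
  smul_right _ _ _ hp hq u v i f a := VEΩ_smul_right ρ hp hq u v hθ i f a
  leibniz _ _ _ hp hq f u₁ u v := VEΩ_leibniz ρ hp hq u₁ u v hθ f
  leibniz_zero _ _ hp hq f u₁ u v := VEΩ_leibniz_zero ρ hp hq u₁ u v hθ f

end Weil

end VanEst

end

theorem lemma4p7 {EM M EG G F : Type*}
    [NormedAddCommGroup EM] [NormedSpace ℝ EM] [FiniteDimensional ℝ EM]
    [TopologicalSpace M] [ChartedSpace EM M] [IsManifold 𝓘(ℝ, EM) ∞ M] [T2Space M]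
    [NormedAddCommGroup EG] [NormedSpace ℝ EG] [FiniteDimensional ℝ EG]
    [TopologicalSpace G] [ChartedSpace EG G] [IsManifold 𝓘(ℝ, EG) ∞ G] [T2Space G]
    [NormedAddCommGroup F] [NormedSpace ℝ F] [FiniteDimensional ℝ F]
    {C : M → Type*} [TopologicalSpace (TotalSpace F C)]
    [∀ x, AddCommGroup (C x)] [∀ x, Module ℝ (C x)] [∀ x, TopologicalSpace (C x)]
    [FiberBundle F C] [VectorBundle ℝ F C] [ContMDiffVectorBundle ∞ F C 𝓘(ℝ, EM)]
    (𝒢 : VanEst.LieGroupoid EM M EG G) (ρ : VanEst.Representation F C 𝒢) (p q : ℕ)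
    (θ : VanEst.Form F C 𝒢 p q) :
    VanEst.IsExtFun ρ (VanEst.frak ρ θ) ∧
    (θ.1.IsNormalized →
      VanEst.IsNormalized (VanEst.frak ρ θ) ∧
      VanEst.IsExtForm ρ (VanEst.VE (VanEst.big q ρ) (VanEst.frak ρ θ)) ∧
      VanEst.IsWeil F (VanEst.VEΩ ρ θ.1)) ∧
    VanEst.HasEv ρ (VanEst.VE (VanEst.big q ρ) (VanEst.frak ρ θ)) (VanEst.VEΩ ρ θ.1) ∧
    VanEst.ev ρ (VanEst.VE (VanEst.big q ρ) (VanEst.frak ρ θ)) = VanEst.VEΩ ρ θ.1 :=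
  ⟨VanEst.isExtFun_frak ρ θ, fun hθ => ⟨VanEst.isNormalized_frak ρ hθ,
    VanEst.isExtForm_VE_frak ρ hθ, VanEst.isWeil_VEΩ ρ hθ⟩, VanEst.hasEv_VE_frak ρ θ,
    (VanEst.hasEv_VE_frak ρ θ).ev_eq⟩
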